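/- Let $\lambda_P>0$ and $\theta=\lambda_P^2$. **Moyal plane.** On $\mathcal A=\mathcal S(\mathbb R^2)$ let $(f\star g)(x)=(\pi\theta)^{-2}\iint f(x+u)\,g(x+v)\,e^{-\frac{2i}{\theta}u\cdot\Theta_0^{-1}v}\,du\,dv$ with $\Theta_0=\begin{pmatrix}0&1\\-1&0\end{pmatrix}$. Let $\mathcal A$ act on $\mathcal H=L^2(\mathbb R^2)\otimes\mathbb C^2$ by $f\mapsto (f\star\cdot)\otimes 1$, and let $D=-i\begin{pmatrix}0&\partial_1+i\partial_2\\ \partial_1-i\partial_2&0\end{pmatrix}$. For functionals $\varphi,\tilde\varphi$ on $\mathcal A$ put $d_D(\varphi,\tilde\varphi)=\sup\{|\varphi(a)-\tilde\varphi(a)| : a\in\mathcal A,\ \|[D,a]\|\le 1\}\in[0,\infty]$. For $\Lambda\in\mathbb C$, the doubled (two-sheet) triple is $\mathcal A'=\mathcal A\otimes\mathbb C^2$, $\mathcal H'=\mathcal H\otimes\mathbb C^2$, $D'=D\otimes 1+\Gamma\otimes\begin{pmatrix}0&\bar\Lambda\\ \Lambda&0\end{pmatrix}$, where $\Gamma=\mathrm{diag}(1,-1)$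 is the grading of $\mathcal H$; $d_{D'}$ is the analogous distance, and $\omega^i$ ($i=1,2$) is the functional $(a_1,a_2)\mapsto\omega(a_i)$. **States.** On $L^2(\mathbb R)$ let $(\mathfrak q\psi)(x)=x\psi(x)$, $\mathfrak p=-i\theta\,\partial_x$, and let $|m\rangle$ ($m\in\mathbb N=\{0,1,2,\dots\}$) be the normalized eigenfunction of $\frac12(\mathfrak q^2+\mathfrak p^2)$ with eigenvalue $\theta(m+\frac12)$. Let $\pi_S(f)=\int\hat f(k)\,e^{\frac i\theta(\mathfrak qk_1+\mathfrak pk_2)}\,dk$, where $f(x)=\int\hat f(k)\,e^{\frac i\theta k\cdot x}\,dk$. Put $\omega_m(f)=\langle m|\pi_S(f)|m\rangle$. For $\kappa\in\mathbb C\simeq\mathbb R^2$ put $(\alpha_\kappa\varphi)(f)=\varphi(f(\cdot+\kappa))$, and let $\mathcal C(\omega_m)=\{\alpha_\kappa\omega_m:\kappa\in\mathbb C\}$ and $\mathcal C=\bigcup_{m}\mathcal C(\omega_m)$ (the generalized coherent states). **Quantum length.** With $dq_1=\mathfrak q\otimes1-1\otimes\mathfrak q$, $dq_2=\mathfrak p\otimes1-1\otimes\mathfrak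 p$ and $L^2=(dq_1)^2+(dq_2)^2$, let $d_{L^2}(\omega,\tilde\omega)=(\omega\otimes\tilde\omega)(L^2)=\langle\psi\otimes\tilde\psi,L^2(\psi\otimes\tilde\psi)\rangle$ for state vectors $\psi,\tilde\psi$ of $\omega,\tilde\omega$ in the Schwartz space. The modified quantum length is $$d'_L(\omega,\tilde\omega)=\sqrt{\Big|d_{L^2}(\omega,\tilde\omega)-\sqrt{d_{L^2}(\omega,\omega)\,d_{L^2}(\tilde\omega,\tilde\omega)}\Big|}.$$ **Proposition.** 1. Let $m\in\mathbb N$, and let $\Lambda\in\mathbb C$ satisfy $|\Lambda|^{-2}=d_{L^2}(\omega_m,\omega_m)$. Then $d_{D'}(\omega^1,\tilde\omega^2)<\infty$ and $d_{L^2}(\omega,\tilde\omega)=d_{D'}^2(\omega^1,\tilde\omega^2)$ for all $\omega,\tilde\omega\in\mathcal C(\omega_m)$. 2. For all $m\in\mathbb N$ and all $\omega,\tilde\omega\in\mathcal C(\omega_m)$, $d_D(\omega,\tilde\omega)<\infty$ and $d_D(\omega,\tilde\omega)=d'_L(\omega,\tilde\omega)$. 3. $d_D$ is finite on $\mathcal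 C\times\mathcal C$ and coincides there with $d'_L$ asymptotically, in the following two senses. For all $m,n\in\mathbb N$ and $\tilde\kappa\in\mathbb C$, $$\lim_{\kappa\to\infty}\frac{d_D(\alpha_\kappa\omega_m,\alpha_{\tilde\kappa}\omega_n)-d'_L(\alpha_\kappa\omega_m,\alpha_{\tilde\kappa}\omega_n)}{d'_L(\alpha_\kappa\omega_m,\alpha_{\tilde\kappa}\omega_n)}=0 ,$$ and for all $m\in\mathbb N$ and $\kappa,\tilde\kappa\in\mathbb C$, $$\lim_{n\to\infty}\frac{d_D(\alpha_\kappa\omega_m,\alpha_{\tilde\kappa}\omega_n)-d'_L(\alpha_\kappa\omega_m,\alpha_{\tilde\kappa}\omega_n)}{d'_L(\alpha_\kappa\omega_m,\alpha_{\tilde\kappa}\omega_n)}=0 .$$ -/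

import Mathlib

open Filter Topology MeasureTheory
open scoped SchwartzMap ENNReal ComplexConjugate

namespace Moyal

/-! Throughout, `lP` is the Planck length `λ_P > 0` and `θ = lP ^ 2`. -/

/-! ### The Moyal algebra -/

/-- The vector space `S(ℝ²)` of the Moyal algebra. -/
abbrev Alg := 𝓢(ℝ × ℝ, ℂ)

/-- The Moyal product
`(f ⋆ ψ)(x) = (πθ)⁻² ∫∫ f(x+u) ψ(x+v) exp(-(2i/θ) u · Θ₀⁻¹ v) du dv`, `Θ₀ = ((0, 1), (-1, 0))`,
so that `u · Θ₀⁻¹ v = u₂ v₁ - u₁ v₂`. The second factor may take values in `E = ℂᵏ`; the product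
is then the componentwise one. -/
noncomputable def moyal {E : Type*} [NormedAddCommGroup E] [NormedSpace ℂ E] (lP : ℝ)
    (f : ℝ × ℝ → ℂ) (ψ : ℝ × ℝ → E) (x : ℝ × ℝ) : E :=
  ((1 / (Real.pi * lP ^ 2 : ℂ)) ^ 2) •
    ∫ w : (ℝ × ℝ) × (ℝ × ℝ),
      (f (x + w.1) *
        Complex.exp (-(2 * Complex.I / (lP : ℂ) ^ 2) *
          ((w.1.2 : ℂ) * (w.2.1 : ℂ) - (w.1.1 : ℂ) * (w.2.2 : ℂ)))) • ψ (x + w.2)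

/-! ### Spectral distance

Operators on `L²(ℝ²) ⊗ ℂᵏ` are given by their action on functions, and are evaluated on the core
of Schwartz spinors. -/

/-- The operator norm of `T` on `L²(ℝ²) ⊗ E`, computed on the dense subspace of Schwartz
functions (`∞` if `T` is unbounded there). -/
noncomputable def opNorm {E : Type*} [NormedAddCommGroup E] [NormedSpace ℝ E]
    (T : (ℝ × ℝ → E) → (ℝ × ℝ → E)) : ℝ≥0∞ :=
  ⨆ Ψ : 𝓢(ℝ × ℝ, E), ⨆ _ : eLpNorm (⇑Ψ) 2 volume ≤ 1, eLpNorm (T Ψ) 2 volume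

/-- The commutator of two operators. -/
def commutator {V : Type*} [Sub V] (S T : V → V) : V → V := fun Ψ => S (T Ψ) - T (S Ψ)

/-- The spectral distance `sup { |φ₁(a) - φ₂(a)| : a ∈ A, ‖[D, π(a)]‖ ≤ 1 }` between two
functionals on `A`, where `A` is represented by `rep`. -/
noncomputable def spectralDist {A E : Type*} [NormedAddCommGroup E] [NormedSpace ℝ E]
    (rep : A → (ℝ × ℝ → E) → (ℝ × ℝ → E)) (D : (ℝ × ℝ → E) → (ℝ × ℝ → E))
    (φ₁ φ₂ : A → ℂ) : ℝ≥0∞ :=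
  ⨆ a : A, ⨆ _ : opNorm (commutator D (rep a)) ≤ 1, ‖φ₁ a - φ₂ a‖ₑ

/-! ### The spectral triple of the Moyal plane -/

/-- The fibre `ℂ²` of the spinor space `L²(ℝ²) ⊗ ℂ²`. -/
abbrev Spin := EuclideanSpace ℂ (Fin 2)

/-- The Dirac operator `-i γ^μ ∂_μ` of the plane, with off-diagonal entries
`-i (∂₁ + i ∂₂)` (upper right) and `-i (∂₁ - i ∂₂)` (lower left). -/
noncomputable def dirac (Ψ : ℝ × ℝ → Spin) : ℝ × ℝ → Spin := fun x =>
  !₂[-Complex.I * (fderiv ℝ Ψ x (1, 0) 1 + Complex.I * fderiv ℝ Ψ x (0, 1) 1),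
     -Complex.I * (fderiv ℝ Ψ x (1, 0) 0 - Complex.I * fderiv ℝ Ψ x (0, 1) 0)]

/-- The representation of the Moyal algebra on spinors: `f` acts by `f ⋆ ·` on both components. -/
noncomputable def rep (lP : ℝ) (f : Alg) (Ψ : ℝ × ℝ → Spin) : ℝ × ℝ → Spin :=
  moyal lP f Ψ

/-- The spectral distance `d_D` on the Moyal plane. -/
noncomputable def distD (lP : ℝ) (φ₁ φ₂ : Alg → ℂ) : ℝ≥0∞ :=
  spectralDist (rep lP) dirac φ₁ φ₂

/-! ### The doubled spectral triple

`A' = A ⊗ ℂ²` is `Fin 2 → A`, and `H' = H ⊗ ℂ²`; the first index is the spin index, the second one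
labels the sheet. -/

/-- The fibre `ℂ² ⊗ ℂ²` (spin, sheet). -/
abbrev Spin' := EuclideanSpace ℂ (Fin 2 × Fin 2)

/-- The restriction of a doubled spinor to the sheet `i`. -/
noncomputable def sheet (Ψ : ℝ × ℝ → Spin') (i : Fin 2) : ℝ × ℝ → Spin := fun x =>
  WithLp.toLp 2 fun s => Ψ x (s, i)

/-- The diagonal of the grading `Γ = diag(1, -1)` of the spinor space. -/
def grading : Fin 2 → ℂ := ![1, -1]

/-- The internal Dirac operator `D_I` on `ℂ²`. -/
noncomputable def diracI (Λ : ℂ) : Matrix (Fin 2) (Fin 2) ℂ := !![0, conj Λ; Λ, 0]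

/-- `D' = D ⊗ 1 + Γ ⊗ D_I`. -/
noncomputable def dirac' (Λ : ℂ) (Ψ : ℝ × ℝ → Spin') : ℝ × ℝ → Spin' := fun x =>
  WithLp.toLp 2 fun p =>
    dirac (sheet Ψ p.2) x p.1 + grading p.1 * ∑ j, diracI Λ p.2 j * Ψ x (p.1, j)

/-- The representation of `A ⊗ ℂ²`: the component `a i` acts on the sheet `i`. -/
noncomputable def rep' (lP : ℝ) (a : Fin 2 → Alg) (Ψ : ℝ × ℝ → Spin') : ℝ × ℝ → Spin' := fun x =>
  WithLp.toLp 2 fun p => rep lP (a p.2) (sheet Ψ p.2) x p.1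

/-- The state `ω^i = (ω, δ_i)` of `A ⊗ ℂ²`. -/
def onSheet (ω : Alg → ℂ) (i : Fin 2) : (Fin 2 → Alg) → ℂ := fun a => ω (a i)

/-- The spectral distance `d_{D'}` on the two-sheet model with parameter `Λ`. -/
noncomputable def distD' (lP : ℝ) (Λ : ℂ) (φ₁ φ₂ : (Fin 2 → Alg) → ℂ) : ℝ≥0∞ :=
  spectralDist (rep' lP) (dirac' Λ) φ₁ φ₂

/-! ### Quantum points -/

/-- The Fourier transform `f̂`, normalized by `f(x) = ∫ f̂(k) exp((i/θ) k · x) dk`. -/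
noncomputable def fourierHat (lP : ℝ) (f : ℝ × ℝ → ℂ) (k : ℝ × ℝ) : ℂ :=
  (1 / (2 * Real.pi * lP ^ 2 : ℂ)) ^ 2 *
    ∫ x : ℝ × ℝ, f x *
      Complex.exp (-(Complex.I / (lP : ℂ) ^ 2) * ((k.1 : ℂ) * (x.1 : ℂ) + (k.2 : ℂ) * (x.2 : ℂ)))

/-- The Weyl operator `exp((i/θ)(q k₁ + p k₂))` on wave functions, for `(qψ)(x) = x ψ(x)` and
`(pψ)(x) = -iθ ψ'(x)`. -/
noncomputable def weyl (lP : ℝ) (k : ℝ × ℝ) (ψ : ℝ → ℂ) (x : ℝ) : ℂ :=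
  Complex.exp ((Complex.I / (lP : ℂ) ^ 2) * ((k.1 : ℂ) * ((x : ℂ) + (k.2 : ℂ) / 2))) * ψ (x + k.2)

/-- The Schrödinger representation `π_S(f) = ∫ f̂(k) exp((i/θ)(q k₁ + p k₂)) dk`. -/
noncomputable def schrodinger (lP : ℝ) (f : Alg) (ψ : ℝ → ℂ) (x : ℝ) : ℂ :=
  ∫ k : ℝ × ℝ, fourierHat lP f k * weyl lP k ψ x

/-- The vector state `f ↦ ⟨ψ, π_S(f) ψ⟩`. -/
noncomputable def vectorState (lP : ℝ) (ψ : ℝ → ℂ) (f : Alg) : ℂ :=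
  ∫ x : ℝ, conj (ψ x) * schrodinger lP f ψ x

/-- The normalized eigenfunction `|m⟩` of `(q² + p²)/2`, for the eigenvalue `θ (m + 1/2)`
(`Polynomial.hermite` is the probabilists' Hermite polynomial). -/
noncomputable def eigenfunction (lP : ℝ) (m : ℕ) (x : ℝ) : ℂ :=
  (((Real.pi * lP ^ 2) ^ (-(1 / 4) : ℝ) / Real.sqrt (m.factorial : ℝ) *
    Polynomial.aeval (Real.sqrt 2 * x / lP) (Polynomial.hermite m) *
    Real.exp (-(x ^ 2) / (2 * lP ^ 2)) : ℝ) : ℂ)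

/-- The eigenstate `ω_m` of the harmonic oscillator. -/
noncomputable def eigenstate (lP : ℝ) (m : ℕ) : Alg → ℂ := vectorState lP (eigenfunction lP m)

/-- The translate `α_κ φ` of a functional: `(α_κ φ)(f) = φ(f(· + κ))`, where `κ ∈ ℂ` is
the vector `(Re κ, Im κ)` of `ℝ²`. -/
noncomputable def translate (κ : ℂ) (φ : Alg → ℂ) : Alg → ℂ := fun f =>
  φ (f.compSubConstCLM ℂ (-(κ.re, κ.im)))

/-- `C(ω_m)`, the set of translates of `ω_m`. -/
def coherent (lP : ℝ) (m : ℕ) : Set (Alg → ℂ) := {ω | ∃ κ : ℂ, ω = translate κ (eigenstate lP m)}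

/-- The set of all generalized coherent states. -/
def allCoherent (lP : ℝ) : Set (Alg → ℂ) := ⋃ m : ℕ, coherent lP m

/-! ### Quantum length -/

/-- `dq₁ = q ⊗ 1 - 1 ⊗ q` on functions of two variables. -/
def dq₁ (Ψ : ℝ → ℝ → ℂ) : ℝ → ℝ → ℂ := fun x y => ((x : ℂ) - (y : ℂ)) * Ψ x y

/-- `dq₂ = p ⊗ 1 - 1 ⊗ p` on functions of two variables. -/
noncomputable def dq₂ (lP : ℝ) (Ψ : ℝ → ℝ → ℂ) : ℝ → ℝ → ℂ := fun x y =>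
  -Complex.I * (lP : ℂ) ^ 2 * (deriv (fun t => Ψ t y) x - deriv (fun t => Ψ x t) y)

/-- The square `L² = (dq₁)² + (dq₂)²` of the length operator. -/
noncomputable def lengthSq (lP : ℝ) (Ψ : ℝ → ℝ → ℂ) : ℝ → ℝ → ℂ :=
  dq₁ (dq₁ Ψ) + dq₂ lP (dq₂ lP Ψ)

/-- The mean value `⟨ψ ⊗ ψ', L² (ψ ⊗ ψ')⟩`. -/
noncomputable def meanLengthSq (lP : ℝ) (ψ ψ' : ℝ → ℂ) : ℂ :=
  ∫ z : ℝ × ℝ, conj (ψ z.1 * ψ' z.2) * lengthSq lP (fun x y => ψ x * ψ' y) z.1 z.2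

/-- `ψ` is a state vector of `ω`, in the (Schwartz) domain of the position and momentum
operators. -/
def IsStateVector (lP : ℝ) (ω : Alg → ℂ) (ψ : 𝓢(ℝ, ℂ)) : Prop :=
  ∫ x : ℝ, ‖ψ x‖ ^ 2 = 1 ∧ ∀ f : Alg, ω f = vectorState lP ψ f

/-- The quantum square-length `d_{L²}(ω, ω') = (ω ⊗ ω')(L²)`, that is, the mean value of `L²` in the
vector `ψ ⊗ ψ'` for state vectors `ψ` of `ω` and `ψ'` of `ω'`. State vectors are
unique up to a phase, so that the set below has only one element as soon as `ω` and `ω'` have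
state vectors in the domain. -/
noncomputable def sqLength (lP : ℝ) (ω ω' : Alg → ℂ) : ℝ :=
  sInf {r : ℝ | ∃ ψ ψ' : 𝓢(ℝ, ℂ),
    IsStateVector lP ω ψ ∧ IsStateVector lP ω' ψ' ∧ (r : ℂ) = meanLengthSq lP ψ ψ'}

/-- The modified quantum length
`d'_L(ω, ω') = √|d_{L²}(ω, ω') - √(d_{L²}(ω, ω) d_{L²}(ω', ω'))|`. -/
noncomputable def modLength (lP : ℝ) (ω ω' : Alg → ℂ) : ℝ :=
  Real.sqrt |sqLength lP ω ω' - Real.sqrt (sqLength lP ω ω * sqLength lP ω' ω')|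

end Moyal

/-!
On generalized coherent states both the spectral distances and the quantum lengths can be estimated
by explicit functions of the translation and of the energies; within one orbit they are computed
exactly. Write `θ = λ_P²`.

**Moyal multiplication.** The product `f ⋆ Ψ` is a superposition, with weight `f̂`, of twisted
translations of `Ψ` (`Moyal.moyal_eq`). It obeys the Leibniz rule (`Moyal.fderiv_moyal`), so the
commutators of the Dirac operators with `f` are Clifford multiplication by the gradient of `f`, with
an additional term `Λ (f₂ - f₁)` between the sheets of the doubled model
(`Moyal.commutator_dirac`, `Moyal.commutator_dirac'`).

**Upper bounds.** A Wigner transform realizes `ω_m` as a vector state of the Moyal action on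
`L²(ℝ²)`, in the lowest Landau level function `Moyal.landau` (`Moyal.matElem_eq`). Hence a
bound of the norm of a commutator bounds the matrix elements of the derivatives of `f`
(`Moyal.norm_sum_matElem_smul_le`). Integrating along the segment between two translates of one state
gives `d_D ≤ ‖κ - κ'‖` (`Moyal.distD_translate_le`). In the doubled model one interpolates between the
sheets at the same time, and the Cauchy–Schwarz inequality yields the Pythagorean bound
`d_{D'}² ≤ ‖κ - κ'‖² + |Λ|⁻²` (`Moyal.distD'_le`). By the commutation relation of the creation operator
with Weyl operators, the difference of two consecutive eigenstates is a matrix element of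
`(∂₁ - i ∂₂) f`, and telescoping gives `d_D(ω_m, ω_n) ≤ √2 λ_P |√n - √m|` (`Moyal.distD_eigenstate_le`).

**Lower bounds.** Elements of the algebra with controlled commutators come from quantization by
coherent states: the projections `Moyal.cohProj` resolve the identity, so a matrix-valued symbol of
norm at most `1` is quantized to a contraction (`Moyal.opNorm_antiWick_le`). Quantization commutes with
derivatives, and the diagonal matrix elements of the quantized symbol are its means for the Husimi
densities (`Moyal.matElem_antiWick`). So a function with gradient of length at most `1` can be used as
in classical optimal transport. Linear functions, damped by wide Gaussians so as to be Schwartz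
functions, match the upper bounds (`Moyal.norm_sub_le_distD`, `Moyal.sqrt_le_distD'`). The function
`√(1 + |x|²)`, damped likewise, gives `d_D ≥ √(2θn) - K` for large energies
(`Moyal.exists_sqrt_sub_le_distD`), with moments of the Husimi densities in place of their exact radial
means.

**Quantum lengths.** A state vector is determined up to a phase, because a functional determines all
products `conj (B ψ p) * B ψ q` of values of the Bargmann transform
(`Moyal.IsStateVector.exists_phase`). The mean of `L²` in translated eigenvectors then gives
`d_{L²} = ‖κ - κ'‖² + 2θ(m + n + 1)` (`Moyal.sqLength_translate`) and
`d'_L² = ‖κ - κ'‖² + θ(√(2m+1) - √(2n+1))²` (`Moyal.modLength_translate`).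

For `m = n`, and `|Λ|⁻² = 2θ(2m + 1)`, these are the values of the spectral distances. In the two
limits, `d_D` and `d'_L` differ by a bounded amount while `d'_L` tends to infinity
(`Moyal.tendsto_sub_div_of_bounded`).
-/

namespace Moyal

/-! ### Exponentials as Schwartz functions -/

theorem norm_iteratedFDeriv_cexp (n : ℕ) (z : ℂ) :
    ‖iteratedFDeriv ℝ n Complex.exp z‖ =
      Real.exp z.re * ‖iteratedFDeriv ℝ n Complex.exp (0 : ℂ)‖ := by
  have h : Complex.exp = fun w => Complex.exp z • Complex.exp (w + -z) := by
    ext w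
    rw [smul_eq_mul, ← Complex.exp_add]
    congr 1; ring
  have hc : ContDiff ℝ n (fun w : ℂ => Complex.exp (w + -z)) := by fun_prop
  conv_lhs => rw [h]
  rw [show (fun w => Complex.exp z • Complex.exp (w + -z)) = Complex.exp z • (fun w : ℂ => Complex.exp (w + -z)) from rfl, iteratedFDeriv_const_smul_apply hc.contDiffAt, iteratedFDeriv_comp_add_right,
    norm_smul, Complex.norm_exp, add_neg_cancel]

theorem one_add_pow_mul_exp_le (P : ℕ) {c r : ℝ} (hc : 0 < c) (hr : 0 ≤ r) :
    (1 + r) ^ P * Real.exp (-c * r ^ 2) ≤ P.factorial * Real.exp (1 + 1 / (4 * c)) := by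
  have h1 : (1 + r) ^ P ≤ P.factorial * Real.exp (1 + r) := by
    have := Real.pow_div_factorial_le_exp (1 + r) (by positivity) P
    rwa [div_le_iff₀ (by positivity), mul_comm] at this
  have h2 : 1 + r + -c * r ^ 2 ≤ 1 + 1 / (4 * c) := by
    have : 1 / (4 * c) - (r - c * r ^ 2) = c * (r - 1 / (2 * c)) ^ 2 := by
      field_simp; ring
    nlinarith [mul_nonneg hc.le (sq_nonneg (r - 1 / (2 * c)))]
  calc (1 + r) ^ P * Real.exp (-c * r ^ 2)
      ≤ P.factorial * Real.exp (1 + r) * Real.exp (-c * r ^ 2) := by gcongr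
    _ = P.factorial * Real.exp (1 + r + -c * r ^ 2) := by rw [mul_assoc, ← Real.exp_add]
    _ ≤ _ := by gcongr

section
variable {E : Type*} [NormedAddCommGroup E] [NormedSpace ℝ E]

/-- By the Faà di Bruno bound the derivatives of `exp ∘ f` cost only a polynomial factor. -/
theorem exists_norm_iteratedFDeriv_exp_comp_le {f : E → ℂ} (hf : f.HasTemperateGrowth) (n : ℕ) :
    ∃ (P : ℕ) (K : ℝ), 0 ≤ K ∧ ∀ x, ‖iteratedFDeriv ℝ n (fun x => Complex.exp (f x)) x‖ ≤
      K * (1 + ‖x‖) ^ P * Real.exp (f x).re := by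
  obtain ⟨N, K, hK, hN⟩ := hf.norm_iteratedFDeriv_le_uniform n
  set A := (Finset.range (n + 1)).sup' ⟨0, by simp⟩
    (fun i => ‖iteratedFDeriv ℝ i Complex.exp (0 : ℂ)‖) with hA
  have hA0 : 0 ≤ A := (norm_nonneg _).trans
    (Finset.le_sup' (fun i => ‖iteratedFDeriv ℝ i Complex.exp (0 : ℂ)‖)
      (Finset.mem_range.2 (Nat.succ_pos n)))
  refine ⟨N * n, n.factorial * A * (K + 1) ^ n, by positivity, fun x => ?_⟩
  have h1 : ‖iteratedFDeriv ℝ n (Complex.exp ∘ f) x‖ ≤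
      n.factorial * (Real.exp (f x).re * A) * ((K + 1) * (1 + ‖x‖) ^ N) ^ n := by
    refine norm_iteratedFDeriv_comp_le (N := (n : ℕ∞)) (Complex.contDiff_exp.of_le le_top)
      (hf.1.of_le (by exact_mod_cast le_top)) le_rfl x (fun i hi => ?_) (fun i hi1 hi => ?_)
    · rw [norm_iteratedFDeriv_cexp]
      gcongr
      exact Finset.le_sup' (fun i => ‖iteratedFDeriv ℝ i Complex.exp (0 : ℂ)‖)
        (Finset.mem_range.2 (Nat.lt_succ_of_le hi))
    · have h1 : (1 : ℝ) ≤ (K + 1) * (1 + ‖x‖) ^ N :=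
        one_le_mul_of_one_le_of_one_le (by linarith)
          (one_le_pow₀ (by linarith [norm_nonneg x]))
      calc _ ≤ K * (1 + ‖x‖) ^ N := hN i hi x
        _ ≤ (K + 1) * (1 + ‖x‖) ^ N := by gcongr; linarith
        _ ≤ _ := le_self_pow₀ h1 (by omega)
  refine h1.trans (le_of_eq ?_)
  rw [mul_pow, pow_mul]; ring

theorem hasTemperateGrowth_cexp {f : E → ℂ} (hf : f.HasTemperateGrowth) {C : ℝ}
    (hC : ∀ x, (f x).re ≤ C) : (fun x => Complex.exp (f x)).HasTemperateGrowth := by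
  refine ⟨by have := hf.1; fun_prop, fun n => ?_⟩
  obtain ⟨P, K, hK, h⟩ := exists_norm_iteratedFDeriv_exp_comp_le hf n
  refine ⟨P, K * Real.exp C, fun x => (h x).trans ?_⟩
  rw [mul_right_comm]
  gcongr
  exact hC x

/-- The Schwartz function `exp ∘ f`, for a phase `f` of temperate growth whose real part tends to
`-∞` at least quadratically. -/
noncomputable def expSchwartz (f : E → ℂ) (hf : f.HasTemperateGrowth) {c : ℝ} (hc : 0 < c) (C : ℝ)
    (hre : ∀ x, (f x).re ≤ C - c * ‖x‖ ^ 2) : 𝓢(E, ℂ) where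
  toFun x := Complex.exp (f x)
  smooth' := by
    have := hf.1
    fun_prop
  decay' k n := by
    obtain ⟨P, K, hK, h1⟩ := exists_norm_iteratedFDeriv_exp_comp_le hf n
    refine ⟨K * Real.exp C * ((k + P).factorial * Real.exp (1 + 1 / (4 * c))), fun x => ?_⟩
    have h2 : Real.exp (f x).re ≤ Real.exp C * Real.exp (-c * ‖x‖ ^ 2) := by
      rw [← Real.exp_add]
      gcongr
      linarith [hre x]
    have h3 : ‖x‖ ^ k ≤ (1 + ‖x‖) ^ k := by gcongr; linarith
    calc ‖x‖ ^ k * ‖iteratedFDeriv ℝ n (fun x => Complex.exp (f x)) x‖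
        ≤ (1 + ‖x‖) ^ k * (K * (1 + ‖x‖) ^ P * (Real.exp C * Real.exp (-c * ‖x‖ ^ 2))) := by
          gcongr
          exact (h1 x).trans (by gcongr)
      _ = K * Real.exp C * ((1 + ‖x‖) ^ (k + P) * Real.exp (-c * ‖x‖ ^ 2)) := by
          rw [pow_add]; ring
      _ ≤ _ := mul_le_mul_of_nonneg_left (one_add_pow_mul_exp_le _ hc (norm_nonneg x))
            (by positivity)

@[simp] theorem expSchwartz_apply (f : E → ℂ) (hf : f.HasTemperateGrowth) {c : ℝ} (hc : 0 < c)
    (C : ℝ) (hre : ∀ x, (f x).re ≤ C - c * ‖x‖ ^ 2) (x : E) :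
    expSchwartz f hf hc C hre x = Complex.exp (f x) := rfl
end

/-! ### The Fourier transform of the plane -/

/-- The plane wave `e_k(x) = exp((i/θ) k · x)`. -/
noncomputable def wave (lP : ℝ) (k x : ℝ × ℝ) : ℂ :=
  Complex.exp ((Complex.I / (lP : ℂ) ^ 2) * ((k.1 : ℂ) * (x.1 : ℂ) + (k.2 : ℂ) * (x.2 : ℂ)))

theorem norm_wave (lP : ℝ) (k x : ℝ × ℝ) : ‖wave lP k x‖ = 1 := by
  have : (Complex.I / (lP : ℂ) ^ 2) * ((k.1 : ℂ) * (x.1 : ℂ) + (k.2 : ℂ) * (x.2 : ℂ)) =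
      (((k.1 * x.1 + k.2 * x.2) / lP ^ 2 : ℝ) : ℂ) * Complex.I := by
    push_cast; ring
  rw [wave, this, Complex.norm_exp_ofReal_mul_I]

/-- A Schwartz function on `ℝ × ℝ`, as a function on the Euclidean plane `ℂ`. -/
noncomputable def toPlane (f : Alg) : 𝓢(ℂ, ℂ) :=
  SchwartzMap.compCLMOfContinuousLinearEquiv ℂ Complex.equivRealProdCLM f

/-- The identification `k ↦ (k₁ + i k₂) / (2πθ)` of frequencies, matching `fourierHat` with the
Fourier transform of the Euclidean plane. -/
noncomputable def freqEquiv (lP : ℝ) (hlP : lP ≠ 0) : (ℝ × ℝ) ≃L[ℝ] ℂ :=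
  Complex.equivRealProdCLM.symm.trans
    (ContinuousLinearEquiv.smulLeft (Units.mk0 ((2 * Real.pi * lP ^ 2)⁻¹ : ℝ)
      (by have := Real.pi_pos; positivity)))

theorem fourierHat_eq_fourier (lP : ℝ) (hlP : lP ≠ 0) (f : Alg) (k : ℝ × ℝ) :
    fourierHat lP f k = (1 / (2 * Real.pi * lP ^ 2 : ℂ)) ^ 2 *
      FourierTransform.fourier (toPlane f) (freqEquiv lP hlP k) := by
  rw [fourierHat, SchwartzMap.fourier_coe, Real.fourier_eq',
    ← Complex.volume_preserving_equiv_real_prod.integral_comp'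
      (g := fun x : ℝ × ℝ => f x * Complex.exp (-(Complex.I / (lP : ℂ) ^ 2) *
        ((k.1 : ℂ) * (x.1 : ℂ) + (k.2 : ℂ) * (x.2 : ℂ))))]
  congr 1
  refine integral_congr_ae (Eventually.of_forall fun z => ?_)
  have h1 : freqEquiv lP hlP k =
      ((2 * Real.pi * lP ^ 2)⁻¹ : ℝ) • (Complex.equivRealProdCLM.symm k) := rfl
  have h2 : (inner ℝ z (freqEquiv lP hlP k) : ℝ) =
      (2 * Real.pi * lP ^ 2)⁻¹ * (k.1 * z.re + k.2 * z.im) := by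
    rw [h1, inner_smul_right]
    congr 1
    have h3 : Complex.equivRealProdCLM.symm k = ⟨k.1, k.2⟩ := by
      rw [ContinuousLinearEquiv.symm_apply_eq]; rfl
    rw [Complex.inner, h3]
    simp
  have hpi := Real.pi_ne_zero
  simp only [smul_eq_mul]
  rw [h2, mul_comm]
  congr 1
  · congr 1
    simp only [Complex.measurableEquivRealProd_apply]
    push_cast
    have : (Real.pi : ℂ) ≠ 0 := by exact_mod_cast hpi
    have : (lP : ℂ) ≠ 0 := by exact_mod_cast hlP
    field_simp

/-- The Fourier transform `f̂` as a Schwartz function. -/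
noncomputable def hatS (lP : ℝ) (hlP : lP ≠ 0) (f : Alg) : Alg :=
  ((1 / (2 * Real.pi * lP ^ 2 : ℂ)) ^ 2) • SchwartzMap.compCLMOfContinuousLinearEquiv ℂ
    (freqEquiv lP hlP) (FourierTransform.fourier (toPlane f))

theorem hatS_apply (lP : ℝ) (hlP : lP ≠ 0) (f : Alg) (k : ℝ × ℝ) :
    hatS lP hlP f k = fourierHat lP f k := by
  rw [fourierHat_eq_fourier lP hlP]; rfl

/-- The transform `f ↦ f̂` is onto the Schwartz functions, so a symbol may be prescribed by its
transform. -/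
theorem exists_fourierHat_eq (lP : ℝ) (hlP : lP ≠ 0) (g : Alg) :
    ∃ f : Alg, ∀ k, fourierHat lP f k = g k := by
  have hpi : (Real.pi : ℂ) ≠ 0 := by exact_mod_cast Real.pi_ne_zero
  have hl : (lP : ℂ) ≠ 0 := by exact_mod_cast hlP
  set c : ℂ := (1 / (2 * Real.pi * lP ^ 2 : ℂ)) ^ 2 with hc
  have hc0 : c ≠ 0 := by rw [hc]; exact pow_ne_zero _ (one_div_ne_zero (by simp [hpi, hl]))
  set G : 𝓢(ℂ, ℂ) := FourierTransformInv.fourierInv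
    (SchwartzMap.compCLMOfContinuousLinearEquiv ℂ (freqEquiv lP hlP).symm (c⁻¹ • g)) with hG
  refine ⟨SchwartzMap.compCLMOfContinuousLinearEquiv ℂ Complex.equivRealProdCLM.symm G,
    fun k => ?_⟩
  rw [fourierHat_eq_fourier lP hlP]
  have h1 : toPlane (SchwartzMap.compCLMOfContinuousLinearEquiv ℂ
      Complex.equivRealProdCLM.symm G) = G := by
    ext z
    exact congrArg G (Complex.equivRealProdCLM.symm_apply_apply z)
  rw [h1, hG, FourierTransform.fourier_fourierInv_eq]
  simp only [SchwartzMap.compCLMOfContinuousLinearEquiv_apply, Function.comp,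
    ContinuousLinearEquiv.symm_apply_apply, _root_.smul_apply, smul_eq_mul]
  rw [← hc, ← mul_assoc, mul_inv_cancel₀ hc0, one_mul]

end Moyal

namespace Moyal
open scoped LineDeriv

/-! ### The Moyal product as a superposition of twisted translations -/

theorem fourierHat_add (lP : ℝ) (hlP : lP ≠ 0) (f g : Alg) (k : ℝ × ℝ) :
    fourierHat lP (f + g : Alg) k = fourierHat lP f k + fourierHat lP g k := by
  simp only [← hatS_apply lP hlP]
  simp [hatS, toPlane, FourierTransform.fourier_add]

theorem fourierHat_smul (lP : ℝ) (hlP : lP ≠ 0) (c : ℂ) (f : Alg) (k : ℝ × ℝ) :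
    fourierHat lP (c • f : Alg) k = c * fourierHat lP f k := by
  simp only [← hatS_apply lP hlP]
  simp [hatS, toPlane, FourierTransform.fourier_smul]
  ring

theorem fourierHat_lineDeriv (lP : ℝ) (hlP : lP ≠ 0) (f : Alg) (v k : ℝ × ℝ) :
    fourierHat lP (∂_{v} f : Alg) k =
      (Complex.I / (lP : ℂ) ^ 2) * ((k.1 : ℂ) * v.1 + (k.2 : ℂ) * v.2) * fourierHat lP f k := by
  have hpi : (Real.pi : ℂ) ≠ 0 := by exact_mod_cast Real.pi_ne_zero
  have hl : (lP : ℂ) ≠ 0 := by exact_mod_cast hlP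
  have h1 : toPlane (∂_{v} f) = ∂_{(⟨v.1, v.2⟩ : ℂ)} (toPlane f) := by
    rw [toPlane, toPlane, SchwartzMap.lineDerivOp_compCLMOfContinuousLinearEquiv]
    rfl
  have h2 : (fun x : ℂ => inner ℝ x (⟨v.1, v.2⟩ : ℂ)).HasTemperateGrowth := by fun_prop
  have h3 : freqEquiv lP hlP k =
      ((2 * Real.pi * lP ^ 2)⁻¹ : ℝ) • (⟨k.1, k.2⟩ : ℂ) := by
    have h3 : Complex.equivRealProdCLM.symm k = ⟨k.1, k.2⟩ := by
      rw [ContinuousLinearEquiv.symm_apply_eq]; rfl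
    rw [← h3]; rfl
  have h4 : inner ℝ (freqEquiv lP hlP k) (⟨v.1, v.2⟩ : ℂ) =
      (2 * Real.pi * lP ^ 2)⁻¹ * (k.1 * v.1 + k.2 * v.2) := by
    rw [h3, real_inner_smul_left]
    congr 1
    rw [Complex.inner]; simp [mul_comm]
  rw [fourierHat_eq_fourier lP hlP, fourierHat_eq_fourier lP hlP, h1,
    SchwartzMap.fourier_lineDerivOp_eq, _root_.smul_apply,
    SchwartzMap.smulLeftCLM_apply_apply h2, h4, smul_eq_mul, Complex.real_smul]
  push_cast
  field_simp

theorem fourierHat_shift (lP : ℝ) (f : Alg) (κ k : ℝ × ℝ) :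
    fourierHat lP (f.compSubConstCLM ℂ (-κ)) k = wave lP k κ * fourierHat lP f k := by
  unfold fourierHat
  rw [mul_left_comm]
  congr 1
  rw [← integral_const_mul]
  rw [← integral_add_right_eq_self (μ := volume) (fun x : ℝ × ℝ => wave lP k κ * (f x * Complex.exp (-(Complex.I / (lP : ℂ) ^ 2) *
        ((k.1 : ℂ) * (x.1 : ℂ) + (k.2 : ℂ) * (x.2 : ℂ))))) κ]
  refine integral_congr_ae (Eventually.of_forall fun x => ?_)
  simp only [SchwartzMap.compSubConstCLM_apply, sub_neg_eq_add, wave]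
  rw [mul_left_comm, ← Complex.exp_add]
  congr 2
  simp only [Prod.fst_add, Prod.snd_add]
  push_cast; ring

theorem integrable_fourierHat (lP : ℝ) (hlP : lP ≠ 0) (f : Alg) :
    Integrable (fourierHat lP f) := by
  have := (hatS lP hlP f).integrable (μ := volume)
  exact this.congr (Eventually.of_forall fun k => hatS_apply lP hlP f k)

theorem continuous_fourierHat (lP : ℝ) (hlP : lP ≠ 0) (f : Alg) :
    Continuous (fourierHat lP f) := by
  have := (hatS lP hlP f).continuous
  exact this.congr fun k => hatS_apply lP hlP f k

@[fun_prop]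
theorem continuous_wave (lP : ℝ) {X : Type*} [TopologicalSpace X] {f g : X → ℝ × ℝ}
    (hf : Continuous f) (hg : Continuous g) : Continuous fun x => wave lP (f x) (g x) := by
  unfold wave; fun_prop

/-- The rotation `k ↦ (k₂, -k₁)` of the plane. -/
noncomputable def rot : (ℝ × ℝ) ≃ᵐ (ℝ × ℝ) :=
  MeasurableEquiv.prodComm.trans (MeasurableEquiv.prodCongr (.refl ℝ) (.neg ℝ))

@[simp] theorem rot_apply (k : ℝ × ℝ) : rot k = (k.2, -k.1) := rfl

theorem measurePreserving_rot : MeasurePreserving rot volume volume := by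
  have h1 : MeasurePreserving (Prod.swap : ℝ × ℝ → ℝ × ℝ) volume volume :=
    Measure.measurePreserving_swap
  have h2 : MeasurePreserving (Prod.map id Neg.neg : ℝ × ℝ → ℝ × ℝ) volume volume :=
    (MeasurePreserving.id volume).prod (Measure.measurePreserving_neg volume)
  exact h2.comp h1

/-- The translation `(k₂/2, -k₁/2)` by which the plane wave `e_k` acts in the Moyal product. -/
noncomputable def halfRot (k : ℝ × ℝ) : ℝ × ℝ := (k.2 / 2, -k.1 / 2)

@[fun_prop]
theorem continuous_halfRot : Continuous halfRot := by unfold halfRot; fun_prop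

theorem integral_comp_halfRot {E : Type*} [NormedAddCommGroup E] [NormedSpace ℝ E]
    (F : ℝ × ℝ → E) : ∫ k, F (halfRot k) = (4 : ℝ) • ∫ v, F v := by
  have h1 : ∀ k, F (halfRot k) = F ((1 / 2 : ℝ) • rot k) := by
    intro k; congr 1; ext <;> simp [halfRot] <;> ring
  simp_rw [h1]
  rw [measurePreserving_rot.integral_comp' (g := fun v => F ((1 / 2 : ℝ) • v)),
    Measure.integral_comp_smul]
  congr 1
  norm_num

section
variable {E : Type*} [NormedAddCommGroup E] [NormedSpace ℂ E]

/-- The Moyal product is a superposition of the twisted translations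
`Ψ ↦ e_k(x) Ψ(x + (k₂, -k₁) / 2)` with weight `f̂`. -/
theorem moyal_eq [CompleteSpace E] (lP : ℝ) (hlP : lP ≠ 0) (f : Alg) {Ψ : ℝ × ℝ → E} (hΨ : Integrable Ψ)
    (x : ℝ × ℝ) :
    moyal lP f Ψ x = ∫ k, (fourierHat lP f k * wave lP k x) • Ψ (x + halfRot k) := by
  have hpi : (Real.pi : ℂ) ≠ 0 := by exact_mod_cast Real.pi_ne_zero
  have hl : (lP : ℂ) ≠ 0 := by exact_mod_cast hlP
  have hf : Integrable (fun u => f (x + u)) := (f.integrable (μ := volume)).comp_add_left x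
  have hΨ' : Integrable (fun v => Ψ (x + v)) := hΨ.comp_add_left x
  have hint : Integrable (fun w : (ℝ × ℝ) × (ℝ × ℝ) => (f (x + w.1) *
        Complex.exp (-(2 * Complex.I / (lP : ℂ) ^ 2) *
          ((w.1.2 : ℂ) * (w.2.1 : ℂ) - (w.1.1 : ℂ) * (w.2.2 : ℂ)))) • Ψ (x + w.2))
        (volume.prod volume) := by
    have h0 := (hf.smul_prod hΨ')
    have h1 : Continuous fun w : (ℝ × ℝ) × (ℝ × ℝ) => Complex.exp (-(2 * Complex.I / (lP : ℂ) ^ 2) *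
          ((w.1.2 : ℂ) * (w.2.1 : ℂ) - (w.1.1 : ℂ) * (w.2.2 : ℂ))) := by fun_prop
    refine (h0.bdd_smul 1 h1.aestronglyMeasurable (Eventually.of_forall fun w => ?_)).congr
      (Eventually.of_forall fun w => ?_)
    · have : -(2 * Complex.I / (lP : ℂ) ^ 2) *
          ((w.1.2 : ℂ) * (w.2.1 : ℂ) - (w.1.1 : ℂ) * (w.2.2 : ℂ)) =
          ((-2 / lP ^ 2 * (w.1.2 * w.2.1 - w.1.1 * w.2.2) : ℝ) : ℂ) * Complex.I := by
        push_cast; ring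
      rw [this, Complex.norm_exp_ofReal_mul_I]
    · simp only [Pi.smul_apply', smul_smul]; congr 1; ring
  have inner : ∀ v : ℝ × ℝ, ∫ u : ℝ × ℝ, (f (x + u) *
        Complex.exp (-(2 * Complex.I / (lP : ℂ) ^ 2) *
          ((u.2 : ℂ) * (v.1 : ℂ) - (u.1 : ℂ) * (v.2 : ℂ)))) • Ψ (x + v) =
      ((2 * Real.pi * lP ^ 2 : ℂ) ^ 2 * (fourierHat lP f (-2 * v.2, 2 * v.1) *
        wave lP (-2 * v.2, 2 * v.1) x)) • Ψ (x + v) := by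
    intro v
    rw [integral_smul_const]
    congr 1
    rw [fourierHat, ← mul_assoc, ← mul_assoc, ← mul_pow,
      mul_one_div_cancel (by simp [hpi, hl]), one_pow, one_mul, ← integral_mul_const]
    refine (integral_congr_ae (Eventually.of_forall fun u => ?_)).trans
      (integral_add_left_eq_self (μ := volume) _ x)
    simp only [wave]
    rw [mul_assoc, ← Complex.exp_add]
    congr 2
    simp only [Prod.fst_add, Prod.snd_add]
    push_cast; ring
  rw [moyal, Measure.volume_eq_prod, integral_prod_symm _ hint]
  simp_rw [inner]
  have h2 : ∀ k : ℝ × ℝ, (fourierHat lP f k * wave lP k x) • Ψ (x + halfRot k) =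
      (fun v : ℝ × ℝ => (fourierHat lP f (-2 * v.2, 2 * v.1) *
        wave lP (-2 * v.2, 2 * v.1) x) • Ψ (x + v)) (halfRot k) := by
    intro k
    have : ((-2 * (halfRot k).2, 2 * (halfRot k).1) : ℝ × ℝ) = k := by
      ext <;> simp [halfRot] <;> ring
    simp only [this]
  rw [(integral_congr_ae (Eventually.of_forall h2)).trans (integral_comp_halfRot
    (fun v : ℝ × ℝ => (fourierHat lP f (-2 * v.2, 2 * v.1) *
      wave lP (-2 * v.2, 2 * v.1) x) • Ψ (x + v)))]
  simp_rw [mul_smul ((2 * Real.pi * lP ^ 2 : ℂ) ^ 2), integral_smul, smul_smul]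
  rw [← Complex.coe_smul]
  congr 1
  field_simp
  norm_num

theorem integrable_moyal_integrand (lP : ℝ) (hlP : lP ≠ 0) (f : Alg) (Ψ : 𝓢(ℝ × ℝ, E))
    (x : ℝ × ℝ) :
    Integrable fun k => (fourierHat lP f k * wave lP k x) • Ψ (x + halfRot k) := by
  have hc := continuous_fourierHat lP hlP f
  refine ((integrable_fourierHat lP hlP f).norm.mul_const (SchwartzMap.seminorm ℝ 0 0 Ψ)).mono'
    (by fun_prop) (Eventually.of_forall fun k => ?_)
  rw [norm_smul, norm_mul, norm_wave, mul_one]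
  gcongr
  exact SchwartzMap.norm_le_seminorm ℝ Ψ _

variable (lP : ℝ)

/-- The phase of the plane wave `e_k`. -/
noncomputable def waveCLM (k : ℝ × ℝ) : ℝ × ℝ →L[ℝ] ℂ :=
  (Complex.I / (lP : ℂ) ^ 2) • (Complex.ofRealCLM ∘L
    (k.1 • ContinuousLinearMap.fst ℝ ℝ ℝ + k.2 • ContinuousLinearMap.snd ℝ ℝ ℝ))

theorem waveCLM_apply (k x : ℝ × ℝ) : waveCLM lP k x =
    (Complex.I / (lP : ℂ) ^ 2) * ((k.1 : ℂ) * (x.1 : ℂ) + (k.2 : ℂ) * (x.2 : ℂ)) := by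
  simp [waveCLM, mul_add]

theorem continuous_waveCLM : Continuous (waveCLM lP) := by
  unfold waveCLM; fun_prop

theorem norm_waveCLM_le (k : ℝ × ℝ) : ‖waveCLM lP k‖ ≤ 2 / lP ^ 2 * ‖k‖ := by
  refine ContinuousLinearMap.opNorm_le_bound _ (by positivity) fun x => ?_
  rw [waveCLM_apply, norm_mul]
  have h1 : ‖Complex.I / (lP : ℂ) ^ 2‖ = 1 / lP ^ 2 := by simp
  have h2 : ‖(k.1 : ℂ) * (x.1 : ℂ) + (k.2 : ℂ) * (x.2 : ℂ)‖ ≤ ‖k‖ * ‖x‖ + ‖k‖ * ‖x‖ := by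
    refine (norm_add_le _ _).trans ?_
    simp only [norm_mul, Complex.norm_real]
    gcongr
    exacts [norm_fst_le k, norm_fst_le x, norm_snd_le k, norm_snd_le x]
  rw [h1]
  calc _ ≤ 1 / lP ^ 2 * (‖k‖ * ‖x‖ + ‖k‖ * ‖x‖) := by gcongr
    _ = _ := by ring

theorem hasFDerivAt_wave (k x : ℝ × ℝ) :
    HasFDerivAt (wave lP k) (wave lP k x • waveCLM lP k) x := by
  have h := ((waveCLM lP k).hasFDerivAt (x := x)).cexp
  have h2 : (fun x => Complex.exp (waveCLM lP k x)) = wave lP k := by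
    ext y; rw [waveCLM_apply, wave]
  rw [h2] at h
  rwa [show Complex.exp (waveCLM lP k x) = wave lP k x by rw [waveCLM_apply, wave]] at h

theorem continuous_smulRight {X : Type*} [TopologicalSpace X] {a : X → ℝ × ℝ →L[ℝ] ℂ} {b : X → E}
    (ha : Continuous a) (hb : Continuous b) : Continuous fun k => (a k).smulRight (b k) :=
  (((ContinuousLinearMap.lsmul ℝ ℂ : ℂ →L[ℝ] E →L[ℝ] E).flip.continuous.comp hb).clm_comp ha).congr
    fun _ => rfl

theorem norm_smulRight_le (a : ℝ × ℝ →L[ℝ] ℂ) (b : E) : ‖a.smulRight b‖ ≤ ‖a‖ * ‖b‖ := by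
  refine ContinuousLinearMap.opNorm_le_bound _ (by positivity) fun x => ?_
  rw [ContinuousLinearMap.smulRight_apply, norm_smul, mul_right_comm]
  gcongr
  exact a.le_opNorm x

/-- Differentiation of `moyal_eq` under the integral: the summands come from the derivatives of `Ψ`
and of the plane waves, and the latter is Moyal multiplication by the derivative of `f`. -/
theorem hasFDerivAt_moyal [CompleteSpace E] (hlP : lP ≠ 0) (f : Alg) (Ψ : 𝓢(ℝ × ℝ, E))
    (x : ℝ × ℝ) :
    HasFDerivAt (moyal lP f Ψ)
      (∫ k, ((fourierHat lP f k * wave lP k x) • fderiv ℝ Ψ (x + halfRot k) +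
        (fourierHat lP f k • wave lP k x • waveCLM lP k).smulRight (Ψ (x + halfRot k)))) x ∧
      Integrable (fun k => (fourierHat lP f k * wave lP k x) • fderiv ℝ Ψ (x + halfRot k) +
        (fourierHat lP f k • wave lP k x • waveCLM lP k).smulRight (Ψ (x + halfRot k))) := by
  have hc := continuous_fourierHat lP hlP f
  have hcw := continuous_waveCLM lP
  have hΨ' : Continuous (fderiv ℝ Ψ) := (SchwartzMap.fderivCLM ℝ _ _ Ψ).continuous
  have h0 : moyal lP f Ψ = fun x => ∫ k, (fourierHat lP f k * wave lP k x) • Ψ (x + halfRot k) := by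
    ext x; exact moyal_eq lP hlP f (Ψ.integrable (μ := volume)) x
  set C0 := SchwartzMap.seminorm ℝ 0 0 Ψ
  set C1 := SchwartzMap.seminorm ℝ 0 0 (SchwartzMap.fderivCLM ℝ _ _ Ψ)
  have hb : Integrable (fun k => ‖fourierHat lP f k‖ * C1 +
      2 / lP ^ 2 * (‖k‖ * ‖fourierHat lP f k‖) * C0) := by
    refine ((integrable_fourierHat lP hlP f).norm.mul_const _).add (Integrable.mul_const ?_ _)
    have := (hatS lP hlP f).integrable_pow_mul (volume) 1
    simp only [pow_one, hatS_apply] at this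
    exact this.const_mul _
  have hcont : ∀ x, Continuous (fun k => (fourierHat lP f k * wave lP k x) • fderiv ℝ Ψ (x + halfRot k) +
        (fourierHat lP f k • wave lP k x • waveCLM lP k).smulRight (Ψ (x + halfRot k))) := by
    intro x
    refine Continuous.add (by fun_prop) (continuous_smulRight ?_ (by fun_prop))
    fun_prop
  have hle : ∀ x k, ‖(fourierHat lP f k * wave lP k x) • fderiv ℝ Ψ (x + halfRot k) +
        (fourierHat lP f k • wave lP k x • waveCLM lP k).smulRight (Ψ (x + halfRot k))‖ ≤
        ‖fourierHat lP f k‖ * C1 + 2 / lP ^ 2 * (‖k‖ * ‖fourierHat lP f k‖) * C0 := by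
    intro x k
    refine (norm_add_le _ _).trans ?_
    have h0 := norm_smulRight_le (fourierHat lP f k • wave lP k x • waveCLM lP k)
      (Ψ (x + halfRot k))
    rw [norm_smul, norm_smul, norm_wave, one_mul] at h0
    rw [norm_smul, norm_mul, norm_wave, mul_one]
    have h1 := norm_waveCLM_le lP k
    have h2 := SchwartzMap.norm_le_seminorm ℝ Ψ (x + halfRot k)
    have h3 := SchwartzMap.norm_le_seminorm ℝ (SchwartzMap.fderivCLM ℝ _ _ Ψ) (x + halfRot k)
    rw [SchwartzMap.fderivCLM_apply] at h3
    refine (add_le_add_right h0 _).trans ?_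
    calc _ ≤ ‖fourierHat lP f k‖ * C1 + ‖fourierHat lP f k‖ * (2 / lP ^ 2 * ‖k‖) * C0 := by gcongr
      _ = _ := by ring
  refine ⟨?_, hb.mono' (hcont x).aestronglyMeasurable (Eventually.of_forall fun k => hle x k)⟩
  rw [h0]
  refine hasFDerivAt_integral_of_dominated_of_fderiv_le (s := Set.univ) univ_mem
    (Eventually.of_forall fun y => ?_) (integrable_moyal_integrand lP hlP f Ψ x)
    (hcont x).aestronglyMeasurable (Eventually.of_forall fun k y _ => hle y k) hb
    (Eventually.of_forall fun k y _ => ?_)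
  · exact (integrable_moyal_integrand lP hlP f Ψ y).aestronglyMeasurable
  · have h1 := ((hasFDerivAt_wave lP k y).const_mul (fourierHat lP f k))
    have h2 : HasFDerivAt (fun y => Ψ (y + halfRot k)) (fderiv ℝ Ψ (y + halfRot k)) y :=
      (hasFDerivAt_comp_add_right (halfRot k)).2 (Ψ.hasFDerivAt (y + halfRot k))
    exact h1.smul h2

/-- The Leibniz rule for the Moyal product. -/
theorem fderiv_moyal [CompleteSpace E] (hlP : lP ≠ 0) (f : Alg) (Ψ : 𝓢(ℝ × ℝ, E))
    (x v : ℝ × ℝ) :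
    fderiv ℝ (moyal lP f Ψ) x v = moyal lP (∂_{v} f : Alg) Ψ x +
      moyal lP f (∂_{v} Ψ : 𝓢(ℝ × ℝ, E)) x := by
  obtain ⟨h1, h2⟩ := hasFDerivAt_moyal lP hlP f Ψ x
  rw [h1.fderiv, ContinuousLinearMap.integral_apply h2,
    moyal_eq lP hlP _ (Ψ.integrable (μ := volume)), moyal_eq lP hlP _ (SchwartzMap.integrable (μ := volume) _),
    ← integral_add (integrable_moyal_integrand lP hlP _ Ψ x)
      (integrable_moyal_integrand lP hlP f _ x)]
  refine integral_congr_ae (Eventually.of_forall fun k => ?_)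
  simp only [add_apply, FunLike.coe_smul, Pi.smul_apply,
    ContinuousLinearMap.smulRight_apply, SchwartzMap.lineDerivOp_apply_eq_fderiv, waveCLM_apply,
    fourierHat_lineDeriv lP hlP]
  rw [add_comm]
  congr 2
  simp only [smul_eq_mul]
  ring

theorem continuous_moyal [CompleteSpace E] (hlP : lP ≠ 0) (f : Alg) (Ψ : 𝓢(ℝ × ℝ, E)) :
    Continuous (moyal lP f Ψ) :=
  continuous_iff_continuousAt.2 fun x => (hasFDerivAt_moyal lP hlP f Ψ x).1.continuousAt

end
end Moyal

namespace Moyal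

/-! ### Hermite functions -/

@[fun_prop]
theorem hasTemperateGrowth_coe : (fun t : ℝ => (t : ℂ)).HasTemperateGrowth :=
  Complex.ofRealCLM.hasTemperateGrowth

theorem hasTemperateGrowth_aeval (p : Polynomial ℤ) (a : ℝ) :
    (fun t : ℝ => ((Polynomial.aeval (a * t) p : ℝ) : ℂ)).HasTemperateGrowth := by
  induction p using Polynomial.induction_on' with
  | add p q hp hq =>
    simp only [map_add, Complex.ofReal_add]
    exact hp.add hq
  | monomial n b =>
    have : (fun t : ℝ => ((Polynomial.aeval (a * t) (Polynomial.monomial n b) : ℝ) : ℂ)) =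
        fun t : ℝ => ((b : ℂ) * (a : ℂ) ^ n) * (t : ℂ) ^ n := by
      ext t; simp [Polynomial.aeval_monomial, mul_pow, mul_assoc]
    rw [this]
    fun_prop

theorem quadratic_le (r b t : ℝ) (hb : 0 < b) : -b * t ^ 2 + r * t ≤ r ^ 2 / (2 * b) - b / 2 * t ^ 2 := by
  have : r ^ 2 / (2 * b) - b / 2 * t ^ 2 - (-b * t ^ 2 + r * t) = b / 2 * (t - r / b) ^ 2 := by
    field_simp; ring
  nlinarith [mul_nonneg (half_pos hb).le (sq_nonneg (t - r / b))]

/-- The Schwartz function `t ↦ p(a t) exp(-b t² + z t)`. -/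
noncomputable def polyGauss (p : Polynomial ℤ) (a : ℝ) {b : ℝ} (hb : 0 < b) (z : ℂ) : 𝓢(ℝ, ℂ) :=
  SchwartzMap.smulLeftCLM ℂ (fun t : ℝ => ((Polynomial.aeval (a * t) p : ℝ) : ℂ))
    (expSchwartz (fun t : ℝ => -(b : ℂ) * (t : ℂ) ^ 2 + z * t)
      (by fun_prop)
      (half_pos hb) (z.re ^ 2 / (2 * b)) (fun t => by
        have := quadratic_le z.re b t hb
        simpa [← Complex.ofReal_pow] using this))

theorem polyGauss_apply (p : Polynomial ℤ) (a : ℝ) {b : ℝ} (hb : 0 < b) (z : ℂ) (t : ℝ) :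
    polyGauss p a hb z t = ((Polynomial.aeval (a * t) p : ℝ) : ℂ) *
      Complex.exp (-(b : ℂ) * (t : ℂ) ^ 2 + z * t) := by
  rw [polyGauss, SchwartzMap.smulLeftCLM_apply_apply (hasTemperateGrowth_aeval p a)]
  rfl

/-- The Laplace transform of a Hermite polynomial against the Gaussian weight is a monomial times
a Gaussian. -/
theorem integral_hermite_mul_cexp (m : ℕ) (z : ℂ) :
    ∫ t : ℝ, ((Polynomial.aeval t (Polynomial.hermite m) : ℝ) : ℂ) *
      Complex.exp (-(1 / 2 : ℝ) * (t : ℂ) ^ 2 + z * t) =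
      z ^ m * (Real.sqrt (2 * Real.pi) * Complex.exp (z ^ 2 / 2)) := by
  have hb : (0 : ℝ) < 1 / 2 := by norm_num
  have hint : ∀ p : Polynomial ℤ, Integrable fun t : ℝ => ((Polynomial.aeval t p : ℝ) : ℂ) *
      Complex.exp (-(1 / 2 : ℝ) * (t : ℂ) ^ 2 + z * t) := by
    intro p
    have := (polyGauss p 1 hb z).integrable (μ := volume)
    refine this.congr (Eventually.of_forall fun t => ?_)
    simp only [polyGauss_apply, one_mul]
  induction m with
  | zero =>
    have h := integral_cexp_quadratic (b := -(1 / 2 : ℝ)) (by norm_num) z 0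
    simp only [Polynomial.hermite_zero, map_one, Complex.ofReal_one, one_mul, pow_zero]
    simp only [add_zero] at h
    rw [h]
    congr 1
    · rw [neg_neg, ← Complex.ofReal_div, Real.sqrt_eq_rpow, Complex.ofReal_cpow (by positivity)]
      congr 1
      · congr 1; ring
      · norm_num
    · congr 1; push_cast; ring
  | succ m ih =>
    have hd : ∀ t : ℝ, HasDerivAt (fun t : ℝ => ((Polynomial.aeval t (Polynomial.hermite m) : ℝ) : ℂ) *
        Complex.exp (-(1 / 2 : ℝ) * (t : ℂ) ^ 2 + z * t))
        (z * (((Polynomial.aeval t (Polynomial.hermite m) : ℝ) : ℂ) *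
          Complex.exp (-(1 / 2 : ℝ) * (t : ℂ) ^ 2 + z * t)) -
        ((Polynomial.aeval t (Polynomial.hermite (m + 1)) : ℝ) : ℂ) *
        Complex.exp (-(1 / 2 : ℝ) * (t : ℂ) ^ 2 + z * t)) t := by
      intro t
      have h1 : HasDerivAt (fun t : ℝ => ((Polynomial.aeval t (Polynomial.hermite m) : ℝ) : ℂ))
          ((Polynomial.aeval t (Polynomial.derivative (Polynomial.hermite m)) : ℝ) : ℂ) t :=
        ((Polynomial.hermite m).hasDerivAt_aeval t).ofReal_comp
      have h2 : HasDerivAt (fun t : ℝ => -(1 / 2 : ℝ) * (t : ℂ) ^ 2 + z * t) (-t + z) t := by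
        have h3 := (hasDerivAt_id t).ofReal_comp
        have := ((h3.pow 2).const_mul (-(1 / 2 : ℝ) : ℂ)).add (h3.const_mul z)
        refine this.congr_deriv ?_
        simp
      refine (h1.mul h2.cexp).congr_deriv ?_
      rw [Polynomial.hermite_succ]
      simp only [map_sub, map_mul, Polynomial.aeval_X]
      push_cast; ring
    have h0 := integral_eq_zero_of_hasDerivAt_of_integrable hd
      (((hint _).const_mul z).sub (hint _)) (hint _)
    rw [integral_sub ((hint _).const_mul z) (hint _), integral_const_mul, ih] at h0
    rw [← sub_eq_zero.1 h0]; ring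

variable (lP : ℝ)

theorem hermite_weight_pos (hlP : 0 < lP) : 0 < 1 / (2 * lP ^ 2) := by positivity

/-- The normalizing constant of the eigenfunction `|m⟩`. -/
noncomputable def eigenConst (m : ℕ) : ℝ :=
  (Real.pi * lP ^ 2) ^ (-(1 / 4) : ℝ) / Real.sqrt (m.factorial : ℝ)

/-- The eigenfunction `|m⟩` as a Schwartz function. -/
noncomputable def eigenS (hlP : 0 < lP) (m : ℕ) : 𝓢(ℝ, ℂ) :=
  ((eigenConst lP m : ℝ) : ℂ) •
    polyGauss (Polynomial.hermite m) (Real.sqrt 2 / lP) (hermite_weight_pos lP hlP) 0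

theorem eigenfunction_eq (m : ℕ) (x : ℝ) : eigenfunction lP m x = eigenConst lP m *
    (((Polynomial.aeval (Real.sqrt 2 / lP * x) (Polynomial.hermite m) : ℝ) : ℂ) *
      Complex.exp (-((1 / (2 * lP ^ 2) : ℝ) : ℂ) * (x : ℂ) ^ 2 + 0 * x)) := by
  rw [eigenfunction, eigenConst]
  push_cast
  rw [mul_assoc]
  congr 3
  · congr 2
    rw [mul_div_right_comm]
  · ring

theorem eigenS_apply (hlP : 0 < lP) (m : ℕ) (x : ℝ) : eigenS lP hlP m x = eigenfunction lP m x := by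
  rw [eigenfunction_eq, eigenS, _root_.smul_apply, polyGauss_apply, smul_eq_mul]

theorem coe_eigenS (hlP : 0 < lP) (m : ℕ) : ⇑(eigenS lP hlP m) = eigenfunction lP m :=
  funext (eigenS_apply lP hlP m)

theorem conj_eigenfunction (m : ℕ) (x : ℝ) : conj (eigenfunction lP m x) = eigenfunction lP m x := by
  rw [eigenfunction, Complex.conj_ofReal]

theorem derivative_hermite_succ (m : ℕ) : Polynomial.derivative (Polynomial.hermite (m + 1)) =
    ((m : Polynomial ℤ) + 1) * Polynomial.hermite m := by
  induction m with
  | zero => simp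
  | succ m ih =>
    rw [Polynomial.hermite_succ (m + 1), Polynomial.derivative_sub, Polynomial.derivative_mul, ih,
      Polynomial.derivative_X, Polynomial.derivative_mul]
    rw [show Polynomial.derivative ((m : Polynomial ℤ) + 1) = 0 by simp]
    rw [Polynomial.hermite_succ m]
    push_cast; ring

theorem hasDerivAt_eigenfunction (m : ℕ) (x : ℝ) :
    HasDerivAt (eigenfunction lP m) (eigenConst lP m * ((((Real.sqrt 2 / lP : ℝ) : ℂ) *
      ((Polynomial.aeval (Real.sqrt 2 / lP * x) (Polynomial.derivative (Polynomial.hermite m)) : ℝ) : ℂ) -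
      (x / (lP : ℂ) ^ 2) *
      ((Polynomial.aeval (Real.sqrt 2 / lP * x) (Polynomial.hermite m) : ℝ) : ℂ)) *
      Complex.exp (-((1 / (2 * lP ^ 2) : ℝ) : ℂ) * (x : ℂ) ^ 2 + 0 * x))) x := by
  have h0 : eigenfunction lP m = fun x : ℝ => eigenConst lP m *
    (((Polynomial.aeval (Real.sqrt 2 / lP * x) (Polynomial.hermite m) : ℝ) : ℂ) *
      Complex.exp (-((1 / (2 * lP ^ 2) : ℝ) : ℂ) * (x : ℂ) ^ 2 + 0 * x)) :=
    funext (eigenfunction_eq lP m)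
  rw [h0]
  refine HasDerivAt.const_mul _ ?_
  have h1 : HasDerivAt (fun t : ℝ => ((Polynomial.aeval (Real.sqrt 2 / lP * t) (Polynomial.hermite m) : ℝ) : ℂ))
      ((Polynomial.aeval (Real.sqrt 2 / lP * x) (Polynomial.derivative (Polynomial.hermite m)) *
        (Real.sqrt 2 / lP * 1) : ℝ) : ℂ) x :=
    (HasDerivAt.comp x ((Polynomial.hermite m).hasDerivAt_aeval (Real.sqrt 2 / lP * x))
      ((hasDerivAt_id x).const_mul (Real.sqrt 2 / lP))).ofReal_comp
  have h2 : HasDerivAt (fun x : ℝ => -((1 / (2 * lP ^ 2) : ℝ) : ℂ) * (x : ℂ) ^ 2 + 0 * x)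
      (-(x / (lP : ℂ) ^ 2)) x := by
    have h3 := (hasDerivAt_id x).ofReal_comp
    have := ((h3.pow 2).const_mul (-((1 / (2 * lP ^ 2) : ℝ) : ℂ))).add (h3.const_mul 0)
    refine this.congr_deriv ?_
    simp; ring
  refine (h1.mul h2.cexp).congr_deriv ?_
  push_cast; ring

theorem eigenConst_succ (m : ℕ) :
    eigenConst lP m = Real.sqrt (m + 1) * eigenConst lP (m + 1) := by
  have h : Real.sqrt ((m : ℝ) + 1) ≠ 0 := by positivity
  rw [eigenConst, eigenConst, Nat.factorial_succ]
  push_cast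
  rw [Real.sqrt_mul (by positivity)]
  field_simp

/-- The creation operator: `(q - i p) |m⟩ = √(2θ(m+1)) |m+1⟩`. -/
theorem creation (hlP : 0 < lP) (m : ℕ) (x : ℝ) :
    x * eigenfunction lP m x - (lP : ℂ) ^ 2 * deriv (eigenfunction lP m) x =
      (Real.sqrt 2 * lP * Real.sqrt (m + 1) : ℝ) * eigenfunction lP (m + 1) x := by
  have hl : (lP : ℂ) ≠ 0 := by exact_mod_cast hlP.ne'
  rw [(hasDerivAt_eigenfunction lP m x).deriv, eigenfunction_eq, eigenfunction_eq,
    eigenConst_succ lP m, Polynomial.hermite_succ]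
  have h2 : ((Real.sqrt 2 : ℝ) : ℂ) ^ 2 = 2 := by
    rw [← Complex.ofReal_pow, Real.sq_sqrt (by norm_num)]; norm_num
  simp only [map_sub, map_mul, Polynomial.aeval_X]
  push_cast
  field_simp
  linear_combination (-(x * (eigenConst lP (m + 1) : ℂ) *
    ((Polynomial.aeval (Real.sqrt 2 * x / lP) (Polynomial.hermite m) : ℝ) : ℂ))) * h2

/-- The annihilation operator: `(q + i p) |m+1⟩ = √(2θ(m+1)) |m⟩`. -/
theorem annihilation (hlP : 0 < lP) (m : ℕ) (x : ℝ) :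
    x * eigenfunction lP (m + 1) x + (lP : ℂ) ^ 2 * deriv (eigenfunction lP (m + 1)) x =
      (Real.sqrt 2 * lP * Real.sqrt (m + 1) : ℝ) * eigenfunction lP m x := by
  have hl : (lP : ℂ) ≠ 0 := by exact_mod_cast hlP.ne'
  rw [(hasDerivAt_eigenfunction lP (m + 1) x).deriv, eigenfunction_eq, eigenfunction_eq,
    eigenConst_succ lP m, derivative_hermite_succ]
  have h2 : ((Real.sqrt (m + 1) : ℝ) : ℂ) ^ 2 = m + 1 := by
    rw [← Complex.ofReal_pow, Real.sq_sqrt (by positivity)]; norm_num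
  simp only [map_add, map_mul, map_natCast, map_one]
  push_cast
  field_simp
  linear_combination (-((eigenConst lP (m + 1) : ℂ) * lP * Real.sqrt 2 *
    ((Polynomial.aeval (Real.sqrt 2 * x / lP) (Polynomial.hermite m) : ℝ) : ℂ))) * h2

end Moyal

namespace Moyal

/-! ### Weyl operators and vector states -/

variable (lP : ℝ)

/-- The phase `exp((i/θ) k₁ (x + k₂/2))` of the Weyl operator. -/
noncomputable def weylPhase (k : ℝ × ℝ) (x : ℝ) : ℂ :=
  Complex.exp ((Complex.I / (lP : ℂ) ^ 2) * ((k.1 : ℂ) * ((x : ℂ) + (k.2 : ℂ) / 2)))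

theorem weyl_apply (k : ℝ × ℝ) (ψ : ℝ → ℂ) (x : ℝ) :
    weyl lP k ψ x = weylPhase lP k x * ψ (x + k.2) := rfl

@[fun_prop]
theorem continuous_weylPhase {X : Type*} [TopologicalSpace X] {f : X → ℝ × ℝ} {g : X → ℝ}
    (hf : Continuous f) (hg : Continuous g) : Continuous fun x => weylPhase lP (f x) (g x) := by
  unfold weylPhase; fun_prop

theorem weylPhase_arg (k : ℝ × ℝ) (x : ℝ) :
    (Complex.I / (lP : ℂ) ^ 2) * ((k.1 : ℂ) * ((x : ℂ) + (k.2 : ℂ) / 2)) =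
      ((k.1 * (x + k.2 / 2) / lP ^ 2 : ℝ) : ℂ) * Complex.I := by
  push_cast; ring

theorem norm_weylPhase (k : ℝ × ℝ) (x : ℝ) : ‖weylPhase lP k x‖ = 1 := by
  rw [weylPhase, weylPhase_arg, Complex.norm_exp_ofReal_mul_I]

theorem conj_weylPhase (k : ℝ × ℝ) (x : ℝ) : conj (weylPhase lP k x) = (weylPhase lP k x)⁻¹ := by
  rw [Complex.inv_def, Complex.normSq_eq_norm_sq, norm_weylPhase]
  simp

theorem hasTemperateGrowth_weylPhase (k : ℝ × ℝ) : (weylPhase lP k).HasTemperateGrowth := by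
  unfold weylPhase
  refine hasTemperateGrowth_cexp (by fun_prop) (C := 0) fun x => ?_
  rw [weylPhase_arg, Complex.re_ofReal_mul, Complex.I_re, mul_zero]

/-- The Weyl operator on Schwartz functions. -/
noncomputable def weylS (k : ℝ × ℝ) (ψ : 𝓢(ℝ, ℂ)) : 𝓢(ℝ, ℂ) :=
  SchwartzMap.smulLeftCLM ℂ (weylPhase lP k) (SchwartzMap.compSubConstCLM ℂ (-k.2) ψ)

theorem weylS_apply (k : ℝ × ℝ) (ψ : 𝓢(ℝ, ℂ)) (x : ℝ) : weylS lP k ψ x = weyl lP k ψ x := by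
  rw [weylS, SchwartzMap.smulLeftCLM_apply_apply (hasTemperateGrowth_weylPhase lP k),
    SchwartzMap.compSubConstCLM_apply, sub_neg_eq_add, smul_eq_mul, weyl_apply]

theorem coe_weylS (k : ℝ × ℝ) (ψ : 𝓢(ℝ, ℂ)) : ⇑(weylS lP k ψ) = weyl lP k ψ :=
  funext (weylS_apply lP k ψ)

/-- The matrix element `⟨φ, W(k) ψ⟩` of a Weyl operator. -/
noncomputable def weylElem (φ ψ : ℝ → ℂ) (k : ℝ × ℝ) : ℂ := ∫ x, conj (φ x) * weyl lP k ψ x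

theorem norm_weyl_le (k : ℝ × ℝ) (ψ : 𝓢(ℝ, ℂ)) (x : ℝ) :
    ‖weyl lP k ψ x‖ ≤ SchwartzMap.seminorm ℝ 0 0 ψ := by
  rw [weyl_apply, norm_mul, norm_weylPhase, one_mul]
  exact SchwartzMap.norm_le_seminorm ℝ ψ _

theorem integrable_conj (φ : 𝓢(ℝ, ℂ)) : Integrable fun x => conj (φ x) := by
  refine (φ.integrable (μ := volume)).norm.mono' (by fun_prop) (Eventually.of_forall fun x => ?_)
  rw [RCLike.norm_conj]

theorem integrable_conj_mul_weyl (φ ψ : 𝓢(ℝ, ℂ)) (k : ℝ × ℝ) :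
    Integrable fun x => conj (φ x) * weyl lP k ψ x := by
  refine (integrable_conj φ).mul_bdd (c := SchwartzMap.seminorm ℝ 0 0 ψ) ?_
    (Eventually.of_forall (norm_weyl_le lP k ψ))
  rw [← coe_weylS]
  exact (weylS lP k ψ).continuous.aestronglyMeasurable

theorem norm_weylElem_le (φ ψ : 𝓢(ℝ, ℂ)) (k : ℝ × ℝ) :
    ‖weylElem lP φ ψ k‖ ≤ (∫ x, ‖φ x‖) * SchwartzMap.seminorm ℝ 0 0 ψ := by
  rw [← integral_mul_const]
  refine norm_integral_le_of_norm_le ((φ.integrable (μ := volume)).norm.mul_const _)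
    (Eventually.of_forall fun x => ?_)
  rw [norm_mul, RCLike.norm_conj]
  gcongr
  exact norm_weyl_le lP k ψ x

theorem integrable_mul_conj_mul_weyl {g : ℝ × ℝ → ℂ} (hg : Integrable g) (φ ψ : 𝓢(ℝ, ℂ)) :
    Integrable (fun p : ℝ × (ℝ × ℝ) => conj (φ p.1) * (g p.2 * weyl lP p.2 ψ p.1))
      (volume.prod volume) := by
  have h := ((integrable_conj φ).mul_prod hg).mul_bdd
    (g := fun p : ℝ × (ℝ × ℝ) => weyl lP p.2 ψ p.1) (c := SchwartzMap.seminorm ℝ 0 0 ψ)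
    (by simp only [weyl_apply]; exact Continuous.aestronglyMeasurable (by fun_prop))
    (Eventually.of_forall fun p => norm_weyl_le lP p.2 ψ p.1)
  refine h.congr (Eventually.of_forall fun p => ?_)
  simp only
  ring

theorem integral_mul_weylElem {g : ℝ × ℝ → ℂ} (hg : Integrable g) (φ ψ : 𝓢(ℝ, ℂ)) :
    ∫ x, conj (φ x) * ∫ k, g k * weyl lP k ψ x = ∫ k, g k * weylElem lP φ ψ k := by
  simp_rw [weylElem, ← integral_const_mul]
  rw [integral_integral_swap (integrable_mul_conj_mul_weyl lP hg φ ψ)]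
  refine integral_congr_ae (Eventually.of_forall fun k => ?_)
  refine integral_congr_ae (Eventually.of_forall fun x => ?_)
  simp only
  ring

theorem vectorState_eq (hlP : lP ≠ 0) (ψ : 𝓢(ℝ, ℂ)) (f : Alg) :
    vectorState lP ψ f = ∫ k, fourierHat lP f k * weylElem lP ψ ψ k := by
  rw [← integral_mul_weylElem lP (integrable_fourierHat lP hlP f)]
  rfl

theorem continuous_weylElem (φ ψ : 𝓢(ℝ, ℂ)) : Continuous (weylElem lP φ ψ) := by
  refine continuous_of_dominated (bound := fun x => ‖φ x‖ * SchwartzMap.seminorm ℝ 0 0 ψ)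
    (fun k => (integrable_conj_mul_weyl lP φ ψ k).aestronglyMeasurable)
    (fun k => Eventually.of_forall fun x => ?_)
    ((φ.integrable (μ := volume)).norm.mul_const _)
    (Eventually.of_forall fun x => ?_)
  · rw [norm_mul, RCLike.norm_conj]
    gcongr
    exact norm_weyl_le lP k ψ x
  · simp only [weyl_apply]
    fun_prop

/-- The Weyl relations: conjugating by a Weyl operator multiplies `W(k)` by a character. -/
theorem weylElem_weylS (ψ : 𝓢(ℝ, ℂ)) (κ k : ℝ × ℝ) :
    weylElem lP (weylS lP (κ.2, -κ.1) ψ) (weylS lP (κ.2, -κ.1) ψ) k =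
      wave lP k κ * weylElem lP ψ ψ k := by
  unfold weylElem
  rw [← integral_const_mul, ← integral_add_right_eq_self (μ := volume) _ κ.1]
  refine integral_congr_ae (Eventually.of_forall fun x => ?_)
  simp only [coe_weylS, weyl_apply, map_mul, conj_weylPhase]
  simp only [weylPhase, wave]
  rw [← Complex.exp_neg]
  have h : ∀ a b c d : ℂ, ∀ u v : ℂ, Complex.exp a * u * (Complex.exp b * (Complex.exp c * v)) =
      Complex.exp (a + b + c) * (u * v) := by
    intros; rw [Complex.exp_add, Complex.exp_add]; ring
  rw [h _ _ _ 0]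
  have h2 : ∀ a b : ℂ, ∀ u v : ℂ, Complex.exp a * (u * (Complex.exp b * v)) =
      Complex.exp (a + b) * (u * v) := by
    intros; rw [Complex.exp_add]; ring
  rw [h2]
  congr 1
  · congr 1
    push_cast; ring
  · congr 2
    · congr 1; ring
    · ring

theorem vectorState_weylS (hlP : lP ≠ 0) (ψ : 𝓢(ℝ, ℂ)) (κ : ℂ) :
    vectorState lP (weylS lP (κ.im, -κ.re) ψ) = translate κ (vectorState lP ψ) := by
  ext f
  rw [translate, vectorState_eq lP hlP, vectorState_eq lP hlP]
  refine integral_congr_ae (Eventually.of_forall fun k => ?_)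
  simp only
  rw [weylElem_weylS lP ψ (κ.re, κ.im), fourierHat_shift]
  ring

/-- The commutation relation of the creation operator with the Weyl operators, in matrix
elements. -/
theorem weylElem_succ_sub (hlP : 0 < lP) (m : ℕ) (k : ℝ × ℝ) :
    ((Real.sqrt 2 * lP * Real.sqrt (m + 1) : ℝ) : ℂ) *
      (weylElem lP (eigenS lP hlP (m + 1)) (eigenS lP hlP (m + 1)) k -
        weylElem lP (eigenS lP hlP m) (eigenS lP hlP m) k) =
      (k.2 + Complex.I * k.1) * weylElem lP (eigenS lP hlP (m + 1)) (eigenS lP hlP m) k := by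
  have hl : (lP : ℂ) ≠ 0 := by exact_mod_cast hlP.ne'
  set c : ℂ := ((Real.sqrt 2 * lP * Real.sqrt (m + 1) : ℝ) : ℂ)
  set a := eigenS lP hlP m
  set b := eigenS lP hlP (m + 1)
  have hbc : ∀ x, conj (b x) = b x := by
    intro x; simp only [b, eigenS_apply, conj_eigenfunction]
  have hac : ∀ x, conj (a x) = a x := by
    intro x; simp only [a, eigenS_apply, conj_eigenfunction]
  have hda : ∀ x, HasDerivAt a (deriv a x) x := a.hasDerivAt
  have hdb : ∀ x, HasDerivAt b (deriv b x) x := b.hasDerivAt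
  have hcr : ∀ x : ℝ, x * a x - (lP : ℂ) ^ 2 * deriv a x = c * b x := by
    intro x; simp only [a, b, coe_eigenS]; exact creation lP hlP m x
  have han : ∀ x : ℝ, x * b x + (lP : ℂ) ^ 2 * deriv b x = c * a x := by
    intro x; simp only [a, b, coe_eigenS]; exact annihilation lP hlP m x
  have hE : ∀ x : ℝ, HasDerivAt (weylPhase lP k) (weylPhase lP k x * (Complex.I / (lP : ℂ) ^ 2 * k.1)) x := by
    intro x
    have h3 := (hasDerivAt_id x).ofReal_comp
    have := ((((h3.add_const ((k.2 : ℂ) / 2)).const_mul (k.1 : ℂ))).const_mul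
      (Complex.I / (lP : ℂ) ^ 2)).cexp
    refine this.congr_deriv ?_
    simp [weylPhase]
  have hG : ∀ x : ℝ, HasDerivAt (fun x => (lP : ℂ) ^ 2 * (b x * (weylPhase lP k x * a (x + k.2))))
      ((c * (conj (a x) * weyl lP k a x) + (k.2 + Complex.I * k.1) * (conj (b x) * weyl lP k a x))
        - c * (conj (b x) * weyl lP k b x)) x := by
    intro x
    have h1 := ((hdb x).mul ((hE x).mul ((hda (x + k.2)).comp_add_const x k.2))).const_mul ((lP : ℂ) ^ 2)
    refine h1.congr_deriv ?_
    have e1 := hcr (x + k.2)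
    have e2 := han x
    push_cast at e1
    simp only [Pi.mul_apply]
    rw [weyl_apply, weyl_apply, hbc, hac]
    have e3 : (lP : ℂ) ^ 2 * (Complex.I / (lP : ℂ) ^ 2 * k.1) = Complex.I * k.1 := by
      field_simp
    linear_combination (weylPhase lP k x * a (x + k.2)) * e2 - (b x * weylPhase lP k x) * e1 +
      (b x * weylPhase lP k x * a (x + k.2)) * e3
  have i1 := (integrable_conj_mul_weyl lP a a k).const_mul c
  have i2 := (integrable_conj_mul_weyl lP b a k).const_mul (k.2 + Complex.I * k.1)
  have i3 := (integrable_conj_mul_weyl lP b b k).const_mul c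
  have i12 : Integrable (fun x => c * (conj (a x) * weyl lP k a x) +
      (k.2 + Complex.I * k.1) * (conj (b x) * weyl lP k a x)) := i1.add i2
  have h0 := integral_eq_zero_of_hasDerivAt_of_integrable hG (i12.sub i3) (by
    have := (integrable_conj_mul_weyl lP b a k).const_mul ((lP : ℂ) ^ 2)
    refine this.congr (Eventually.of_forall fun x => ?_)
    simp only [hbc, weyl_apply])
  rw [integral_sub i12 i3, integral_add i1 i2, integral_const_mul, integral_const_mul,
    integral_const_mul] at h0
  unfold weylElem
  linear_combination -h0

/-! ### State vectors are unique up to a phase -/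

/-- The exponent of the Fourier transform of the (generally off-diagonal) Gaussian operator with
integral kernel `exp(-(x² + y²)/(2θ) + (p x + q y)/θ)`. -/
noncomputable def gaussExponent (p q : ℂ) (k : ℝ × ℝ) : ℂ :=
  -((1 / (4 * lP ^ 2) : ℝ) : ℂ) * ((k.1 : ℂ) ^ 2 + (k.2 : ℂ) ^ 2) +
    (-Complex.I * (p + q) * k.1 + (q - p) * k.2) / (2 * (lP : ℂ) ^ 2)

theorem re_gaussExponent_le (hlP : 0 < lP) (p q : ℂ) : ∃ C : ℝ, ∀ k,
    (gaussExponent lP p q k).re ≤ C - 1 / (8 * lP ^ 2) * ‖k‖ ^ 2 := by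
  have hl : (lP : ℂ) ≠ 0 := by exact_mod_cast hlP.ne'
  set r := (-Complex.I * (p + q) / (2 * (lP : ℂ) ^ 2)).re
  set s := ((q - p) / (2 * (lP : ℂ) ^ 2)).re
  have hb : (0 : ℝ) < 1 / (4 * lP ^ 2) := by positivity
  refine ⟨r ^ 2 / (2 * (1 / (4 * lP ^ 2))) + s ^ 2 / (2 * (1 / (4 * lP ^ 2))), fun k => ?_⟩
  have h1 := quadratic_le r (1 / (4 * lP ^ 2)) k.1 hb
  have h2 := quadratic_le s (1 / (4 * lP ^ 2)) k.2 hb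
  have h3 : gaussExponent lP p q k = ((-(1 / (4 * lP ^ 2)) * k.1 ^ 2 : ℝ) : ℂ) +
      (k.1 : ℝ) * (-Complex.I * (p + q) / (2 * (lP : ℂ) ^ 2)) +
      (((-(1 / (4 * lP ^ 2)) * k.2 ^ 2 : ℝ) : ℂ) + (k.2 : ℝ) * ((q - p) / (2 * (lP : ℂ) ^ 2))) := by
    rw [gaussExponent]; push_cast; ring
  have h4 : (gaussExponent lP p q k).re = -(1 / (4 * lP ^ 2)) * k.1 ^ 2 + r * k.1 +
      (-(1 / (4 * lP ^ 2)) * k.2 ^ 2 + s * k.2) := by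
    rw [h3]
    simp only [Complex.add_re, Complex.ofReal_re, Complex.re_ofReal_mul]
    ring
  have h5 : ‖k‖ ^ 2 ≤ k.1 ^ 2 + k.2 ^ 2 := by
    rw [Prod.norm_def]
    rcases max_choice ‖k.1‖ ‖k.2‖ with h | h <;> rw [h, Real.norm_eq_abs, sq_abs] <;> nlinarith [sq_nonneg k.1, sq_nonneg k.2]
  have h6 : 1 / (4 * lP ^ 2) / 2 = 1 / (8 * lP ^ 2) := by field_simp; norm_num
  rw [h4]
  have h7 : 1 / (8 * lP ^ 2) * ‖k‖ ^ 2 ≤ 1 / (8 * lP ^ 2) * (k.1 ^ 2 + k.2 ^ 2) := by gcongr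
  rw [h6] at h1 h2
  linarith

@[fun_prop]
theorem hasTemperateGrowth_coe_fst : (fun k : ℝ × ℝ => (k.1 : ℂ)).HasTemperateGrowth :=
  (Complex.ofRealCLM ∘L ContinuousLinearMap.fst ℝ ℝ ℝ).hasTemperateGrowth

@[fun_prop]
theorem hasTemperateGrowth_coe_snd : (fun k : ℝ × ℝ => (k.2 : ℂ)).HasTemperateGrowth :=
  (Complex.ofRealCLM ∘L ContinuousLinearMap.snd ℝ ℝ ℝ).hasTemperateGrowth

theorem hasTemperateGrowth_gaussExponent (p q : ℂ) :
    (gaussExponent lP p q).HasTemperateGrowth := by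
  unfold gaussExponent
  simp only [div_eq_mul_inv]
  fun_prop

theorem exists_gaussSymbol (hlP : 0 < lP) (p q : ℂ) :
    ∃ g : Alg, ∀ k, g k = Complex.exp (gaussExponent lP p q k) := by
  obtain ⟨C, hC⟩ := re_gaussExponent_le lP hlP p q
  exact ⟨expSchwartz _ (hasTemperateGrowth_gaussExponent lP p q) (by positivity) C hC,
    fun _ => rfl⟩

/-- The Gaussian (Bargmann) transform `∫ ψ(y) exp(-y²/(2θ) + q y/θ) dy`. -/
noncomputable def bargmann (ψ : ℝ → ℂ) (q : ℂ) : ℂ :=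
  ∫ y : ℝ, ψ y * Complex.exp (-((1 / (2 * lP ^ 2) : ℝ) : ℂ) * (y : ℂ) ^ 2 + q / (lP : ℂ) ^ 2 * y)

theorem conj_bargmann (ψ : ℝ → ℂ) (q : ℂ) : conj (bargmann lP ψ q) =
    ∫ y : ℝ, conj (ψ y) * Complex.exp (-((1 / (2 * lP ^ 2) : ℝ) : ℂ) * (y : ℂ) ^ 2 +
      conj q / (lP : ℂ) ^ 2 * y) := by
  rw [bargmann, ← integral_conj]
  refine integral_congr_ae (Eventually.of_forall fun x => ?_)
  simp only [map_mul, ← Complex.exp_conj, map_add, map_neg, map_pow, Complex.conj_ofReal, map_div₀]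

/-- A Gaussian superposition of Weyl operators is a rank-one operator built from Gaussian
functions. -/
theorem integral_gauss_mul_weylElem (hlP : 0 < lP) (φ ψ : 𝓢(ℝ, ℂ)) (p q : ℂ) :
    ∫ k, Complex.exp (gaussExponent lP p q k) * weylElem lP φ ψ k =
      Real.sqrt (4 * Real.pi * lP ^ 2) * Complex.exp (-(p + q) ^ 2 / (4 * (lP : ℂ) ^ 2)) *
        (conj (bargmann lP φ (conj p)) * bargmann lP ψ q) := by
  have hl : (lP : ℂ) ≠ 0 := by exact_mod_cast hlP.ne'
  obtain ⟨g, hg⟩ := exists_gaussSymbol lP hlP p q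
  have hgi : Integrable fun k => Complex.exp (gaussExponent lP p q k) :=
    (g.integrable (μ := volume)).congr (Eventually.of_forall hg)
  rw [← integral_mul_weylElem lP hgi, conj_bargmann, Complex.conj_conj, ← integral_mul_const,
    ← integral_const_mul]
  refine integral_congr_ae (Eventually.of_forall fun x => ?_)
  have hint : Integrable (fun k : ℝ × ℝ => Complex.exp (gaussExponent lP p q k) * weyl lP k ψ x)
      (volume.prod volume) := by
    refine hgi.mul_bdd (c := SchwartzMap.seminorm ℝ 0 0 ψ)
      (by simp only [weyl_apply]; exact Continuous.aestronglyMeasurable (by fun_prop))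
      (Eventually.of_forall fun k => norm_weyl_le lP k ψ x)
  have hinner : ∀ k₂ : ℝ, ∫ k₁ : ℝ, Complex.exp (gaussExponent lP p q (k₁, k₂)) * weyl lP (k₁, k₂) ψ x =
      Real.sqrt (4 * Real.pi * lP ^ 2) * Complex.exp (-(p + q) ^ 2 / (4 * (lP : ℂ) ^ 2)) *
        Complex.exp (-((1 / (2 * lP ^ 2) : ℝ) : ℂ) * (x : ℂ) ^ 2 + p / (lP : ℂ) ^ 2 * x) *
        (ψ (x + k₂) * Complex.exp (-((1 / (2 * lP ^ 2) : ℝ) : ℂ) * ((x + k₂ : ℝ) : ℂ) ^ 2 +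
          q / (lP : ℂ) ^ 2 * ((x + k₂ : ℝ) : ℂ))) := by
    intro k₂
    have h1 : ∀ k₁ : ℝ, Complex.exp (gaussExponent lP p q (k₁, k₂)) * weyl lP (k₁, k₂) ψ x =
        Complex.exp (-((1 / (4 * lP ^ 2) : ℝ) : ℂ) * (k₁ : ℂ) ^ 2 +
          (Complex.I * (x + k₂ / 2 - (p + q) / 2) / (lP : ℂ) ^ 2) * k₁ +
          (-((1 / (4 * lP ^ 2) : ℝ) : ℂ) * (k₂ : ℂ) ^ 2 + (q - p) * k₂ / (2 * (lP : ℂ) ^ 2))) *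
          ψ (x + k₂) := by
      intro k₁
      rw [weyl_apply, weylPhase, ← mul_assoc, ← Complex.exp_add, gaussExponent]
      congr 2
      field_simp
      ring
    simp_rw [h1]
    rw [integral_mul_const, integral_cexp_quadratic (by
      rw [← Complex.ofReal_neg, Complex.ofReal_re]
      have : 0 < 1 / (4 * lP ^ 2) := by positivity
      linarith)]
    have h2 : ((Real.pi : ℂ) / -(-((1 / (4 * lP ^ 2) : ℝ) : ℂ))) ^ (1 / 2 : ℂ) =
        Real.sqrt (4 * Real.pi * lP ^ 2) := by
      rw [neg_neg, ← Complex.ofReal_div, Real.sqrt_eq_rpow, Complex.ofReal_cpow (by positivity)]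
      congr 1
      · congr 1; field_simp
      · norm_num
    rw [h2]
    have h3 : ∀ s A B C D u : ℂ, A = B + C + D → s * Complex.exp A * u =
        s * Complex.exp B * Complex.exp C * (u * Complex.exp D) := by
      intro s A B C D u h
      rw [h, Complex.exp_add, Complex.exp_add]; ring
    refine h3 _ _ _ _ _ _ ?_
    push_cast
    field_simp
    ring_nf
    rw [Complex.I_sq]
    ring
  simp only
  rw [Measure.volume_eq_prod, integral_prod_symm _ hint]
  simp_rw [hinner]
  rw [integral_const_mul, integral_add_left_eq_self (μ := volume) (fun y : ℝ => ψ y * Complex.exp (-((1 / (2 * lP ^ 2) : ℝ) : ℂ) * (y : ℂ) ^ 2 +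
          q / (lP : ℂ) ^ 2 * (y : ℂ))), bargmann]
  ring

/-- On the imaginary axis the Bargmann transform is the Fourier transform of `ψ` times a Gaussian,
so `ψ` can be recovered from it. -/
theorem bargmann_eq_fourier (hlP : 0 < lP) (ψ : 𝓢(ℝ, ℂ)) :
    ∃ g : 𝓢(ℝ, ℂ), (∀ y, g y = ψ y * Complex.exp (-((1 / (2 * lP ^ 2) : ℝ) : ℂ) * (y : ℂ) ^ 2)) ∧
      ∀ ξ : ℝ, FourierTransform.fourier g ξ =
        bargmann lP ψ (-(2 * Real.pi * lP ^ 2 * ξ) * Complex.I) := by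
  have hl : (lP : ℂ) ≠ 0 := by exact_mod_cast hlP.ne'
  have ht : (fun y : ℝ => Complex.exp (-((1 / (2 * lP ^ 2) : ℝ) : ℂ) * (y : ℂ) ^ 2)).HasTemperateGrowth := by
    refine hasTemperateGrowth_cexp (by fun_prop) (C := 0) fun y => ?_
    rw [← Complex.ofReal_pow, ← Complex.ofReal_neg, ← Complex.ofReal_mul, Complex.ofReal_re]
    have : 0 ≤ 1 / (2 * lP ^ 2) * y ^ 2 := by positivity
    linarith
  refine ⟨SchwartzMap.smulLeftCLM ℂ (fun y : ℝ => Complex.exp (-((1 / (2 * lP ^ 2) : ℝ) : ℂ) *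
    (y : ℂ) ^ 2)) ψ, fun y => ?_, fun ξ => ?_⟩
  · rw [SchwartzMap.smulLeftCLM_apply_apply ht, smul_eq_mul, mul_comm]
  · rw [SchwartzMap.fourier_coe, Real.fourier_eq', bargmann]
    refine integral_congr_ae (Eventually.of_forall fun y => ?_)
    simp only [SchwartzMap.smulLeftCLM_apply_apply ht, smul_eq_mul]
    rw [mul_left_comm, ← mul_assoc, mul_comm _ (ψ y), mul_assoc, ← Complex.exp_add]
    congr 2
    simp only [RCLike.inner_apply, conj_trivial]
    push_cast
    field_simp

/-- Two state vectors of the same functional agree up to a phase: by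
`integral_gauss_mul_weylElem` the functional determines all products
`conj (B ψ p) * B ψ q` of values of the Bargmann transform of `ψ`, which is injective. -/
theorem IsStateVector.exists_phase (hlP : 0 < lP) {ω : Alg → ℂ} {ψ φ : 𝓢(ℝ, ℂ)}
    (hψ : IsStateVector lP ω ψ) (hφ : IsStateVector lP ω φ) :
    ∃ c : ℂ, ‖c‖ = 1 ∧ ψ = c • φ := by
  have key : ∀ p q : ℂ, conj (bargmann lP ψ p) * bargmann lP ψ q =
      conj (bargmann lP φ p) * bargmann lP φ q := by
    intro p q
    obtain ⟨g, hg⟩ := exists_gaussSymbol lP hlP (conj p) q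
    obtain ⟨f, hf⟩ := exists_fourierHat_eq lP hlP.ne' g
    have h1 := (hψ.2 f).symm.trans (hφ.2 f)
    rw [vectorState_eq lP hlP.ne', vectorState_eq lP hlP.ne'] at h1
    simp_rw [hf, hg] at h1
    rw [integral_gauss_mul_weylElem lP hlP, integral_gauss_mul_weylElem lP hlP,
      Complex.conj_conj] at h1
    refine mul_left_cancel₀ (mul_ne_zero ?_ (Complex.exp_ne_zero _)) h1
    have : 0 < Real.sqrt (4 * Real.pi * lP ^ 2) := by have := Real.pi_pos; positivity
    exact_mod_cast this.ne'
  have hinj : ∀ u : 𝓢(ℝ, ℂ),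
      FourierTransformInv.fourierInv (FourierTransform.fourier u : 𝓢(ℝ, ℂ)) = u :=
    fun u => FourierTransform.fourierInv_fourier_eq u
  obtain ⟨g, hg, hgB⟩ := bargmann_eq_fourier lP hlP ψ
  obtain ⟨g', hg', hgB'⟩ := bargmann_eq_fourier lP hlP φ
  have hne : ∃ p, bargmann lP ψ p ≠ 0 := by
    by_contra! h0
    have h1 : FourierTransform.fourier g = 0 := by
      ext ξ; rw [hgB, h0]; rfl
    have h2 : g = 0 := by
      rw [← hinj g, h1]
      exact (FourierTransform.fourierInvCLM ℂ 𝓢(ℝ, ℂ)).map_zero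
    have h3 : ∀ y, ψ y = 0 := by
      intro y
      have := hg y
      rw [h2] at this
      simpa [Complex.exp_ne_zero] using this.symm
    have h4 := hψ.1
    simp [h3] at h4
  obtain ⟨p, hp⟩ := hne
  have hnorm : ‖bargmann lP φ p‖ = ‖bargmann lP ψ p‖ := by
    have := congrArg norm (key p p)
    simp only [norm_mul, RCLike.norm_conj] at this
    exact ((mul_self_inj (norm_nonneg _) (norm_nonneg _)).1 this).symm
  set c : ℂ := conj (bargmann lP φ p) / conj (bargmann lP ψ p) with hc
  have hp' : conj (bargmann lP ψ p) ≠ 0 := by simpa using hp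
  refine ⟨c, ?_, ?_⟩
  · rw [hc, norm_div, RCLike.norm_conj, RCLike.norm_conj, hnorm, div_self (norm_ne_zero_iff.2 hp)]
  · have hB : ∀ q, bargmann lP ψ q = c * bargmann lP φ q := by
      intro q
      rw [hc, div_mul_eq_mul_div, eq_div_iff hp', ← key p q]; ring
    have h1 : FourierTransform.fourier g = FourierTransform.fourier (c • g') := by
      rw [FourierTransform.fourier_smul]
      ext ξ
      rw [hgB, hB, _root_.smul_apply, hgB', smul_eq_mul]
    have h2 : g = c • g' := by
      rw [← hinj g, h1, hinj]
    ext y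
    have h3 := hg y
    rw [h2, _root_.smul_apply, hg', smul_eq_mul, ← mul_assoc] at h3
    rw [_root_.smul_apply, smul_eq_mul]
    exact (mul_right_cancel₀ (Complex.exp_ne_zero _) h3).symm

end Moyal

namespace Moyal

/-! ### Lowest Landau level functions on the plane -/

theorem norm_sq_le_add_sq (x : ℝ × ℝ) : ‖x‖ ^ 2 ≤ x.1 ^ 2 + x.2 ^ 2 := by
  rw [Prod.norm_def]
  rcases max_choice ‖x.1‖ ‖x.2‖ with h | h <;> rw [h, Real.norm_eq_abs, sq_abs] <;>
    nlinarith [sq_nonneg x.1, sq_nonneg x.2]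

/-- The Gaussian `exp(-b (x₁² + x₂²))` on the plane. -/
noncomputable def planeGauss {b : ℝ} (hb : 0 < b) : Alg :=
  expSchwartz (fun x : ℝ × ℝ => -(b : ℂ) * ((x.1 : ℂ) ^ 2 + (x.2 : ℂ) ^ 2)) (by fun_prop) hb 0
    (fun x => by
      have h : -(b : ℂ) * ((x.1 : ℂ) ^ 2 + (x.2 : ℂ) ^ 2) =
        ((-b * (x.1 ^ 2 + x.2 ^ 2) : ℝ) : ℂ) := by push_cast; ring
      rw [h, Complex.ofReal_re]
      nlinarith [norm_sq_le_add_sq x])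

theorem planeGauss_apply {b : ℝ} (hb : 0 < b) (x : ℝ × ℝ) :
    planeGauss hb x = Real.exp (-b * (x.1 ^ 2 + x.2 ^ 2)) := by
  rw [planeGauss, expSchwartz_apply]
  push_cast
  rfl

/-- Gaussian moments of the plane. -/
theorem integral_pow_mul_exp {c : ℝ} (hc : 0 < c) (j : ℕ) :
    ∫ x : ℝ × ℝ, ((x.1 ^ 2 + x.2 ^ 2) / c) ^ j * Real.exp (-((x.1 ^ 2 + x.2 ^ 2) / c)) =
      Real.pi * c * j.factorial := by
  have h := Complex.integral_rpow_mul_exp_neg_mul_rpow (p := 2) (q := 2 * j) (b := 1 / c)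
    (by norm_num) (by linarith [(Nat.cast_nonneg j : (0 : ℝ) ≤ j)]) (by positivity)
  rw [← Complex.volume_preserving_equiv_real_prod.integral_comp']
  have h2 : ∀ z : ℂ, (((Complex.measurableEquivRealProd z).1 ^ 2 +
      (Complex.measurableEquivRealProd z).2 ^ 2) / c) ^ j * Real.exp (-(((Complex.measurableEquivRealProd z).1 ^ 2 +
      (Complex.measurableEquivRealProd z).2 ^ 2) / c)) =
      (1 / c) ^ j * (‖z‖ ^ (2 * j : ℝ) * Real.exp (-(1 / c) * ‖z‖ ^ (2 : ℝ))) := by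
    intro z
    have h3 : (Complex.measurableEquivRealProd z).1 ^ 2 +
      (Complex.measurableEquivRealProd z).2 ^ 2 = ‖z‖ ^ 2 := by
      rw [Complex.sq_norm, Complex.normSq_apply]
      simp only [Complex.measurableEquivRealProd_apply]
      ring
    have h4 : ‖z‖ ^ (2 * j : ℝ) = (‖z‖ ^ 2) ^ j := by
      rw [← pow_mul, ← Real.rpow_natCast]; push_cast; rfl
    rw [h3, h4, Real.rpow_two, div_pow, one_div, inv_pow, neg_mul, ← div_eq_inv_mul]
    ring_nf
  simp_rw [h2]
  rw [integral_const_mul, h]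
  have h5 : ((2 * j + 2 : ℝ) / 2) = j + 1 := by ring
  have h6 : (-(2 * j + 2 : ℝ) / 2) = -((j + 1 : ℕ) : ℝ) := by push_cast; ring
  rw [h5, h6, Real.Gamma_nat_eq_factorial, Real.rpow_neg (by positivity), Real.rpow_natCast]
  simp only [one_div, inv_pow]
  field_simp
  rw [pow_succ]

variable (lP : ℝ)

/-- `Ψ_m(x) = (2/(πθ))^{1/2} (m!)^{-1/2} (√2/λ_P)^m (x₁ - i x₂)^m exp(-|x|²/θ)`: the Wigner
transform of the pair `(|m⟩, |0⟩)`. -/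
noncomputable def landau (hlP : 0 < lP) (m : ℕ) : Alg :=
  ((Real.sqrt (2 / (Real.pi * lP ^ 2)) / Real.sqrt m.factorial * (Real.sqrt 2 / lP) ^ m : ℝ) : ℂ) •
  SchwartzMap.smulLeftCLM ℂ (fun x : ℝ × ℝ => ((x.1 : ℂ) - Complex.I * x.2) ^ m)
    (planeGauss (b := 1 / lP ^ 2) (by positivity))

theorem landau_apply (hlP : 0 < lP) (m : ℕ) (x : ℝ × ℝ) : landau lP hlP m x =
    ((Real.sqrt (2 / (Real.pi * lP ^ 2)) / Real.sqrt m.factorial * (Real.sqrt 2 / lP) ^ m : ℝ) : ℂ) *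
      (((x.1 : ℂ) - Complex.I * x.2) ^ m * Real.exp (-(1 / lP ^ 2) * (x.1 ^ 2 + x.2 ^ 2))) := by
  rw [landau, _root_.smul_apply, SchwartzMap.smulLeftCLM_apply_apply (by fun_prop),
    planeGauss_apply, smul_eq_mul, smul_eq_mul]

theorem norm_sq_sub_I_mul (x : ℝ × ℝ) : ‖(x.1 : ℂ) - Complex.I * x.2‖ ^ 2 = x.1 ^ 2 + x.2 ^ 2 := by
  rw [Complex.sq_norm, Complex.normSq_apply]
  simp
  ring

theorem norm_landau_sq (hlP : 0 < lP) (m : ℕ) (x : ℝ × ℝ) : ‖landau lP hlP m x‖ ^ 2 =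
    2 / (Real.pi * lP ^ 2) / m.factorial * (((x.1 ^ 2 + x.2 ^ 2) / (lP ^ 2 / 2)) ^ m *
      Real.exp (-((x.1 ^ 2 + x.2 ^ 2) / (lP ^ 2 / 2)))) := by
  have hpi := Real.pi_pos
  rw [landau_apply, norm_mul, norm_mul, norm_pow, mul_pow, mul_pow, ← pow_mul, mul_comm m 2, pow_mul,
    norm_sq_sub_I_mul, Complex.norm_real, Complex.norm_real, Real.norm_eq_abs, Real.norm_eq_abs,
    sq_abs, sq_abs, mul_pow, div_pow, Real.sq_sqrt (by positivity), Real.sq_sqrt (by positivity),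
    ← pow_mul, mul_comm m 2, pow_mul, div_pow, Real.sq_sqrt (by positivity), ← Real.exp_nat_mul]
  have h : (x.1 ^ 2 + x.2 ^ 2) / (lP ^ 2 / 2) = 2 / lP ^ 2 * (x.1 ^ 2 + x.2 ^ 2) := by
    field_simp
  rw [h, mul_pow (2 / lP ^ 2)]
  have h2 : ((2 : ℕ) : ℝ) * (-(1 / lP ^ 2) * (x.1 ^ 2 + x.2 ^ 2)) =
      -(2 / lP ^ 2 * (x.1 ^ 2 + x.2 ^ 2)) := by push_cast; ring
  rw [h2]; ring

theorem integral_norm_landau_sq (hlP : 0 < lP) (m : ℕ) : ∫ x, ‖landau lP hlP m x‖ ^ 2 = 1 := by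
  have hpi := Real.pi_pos
  simp_rw [norm_landau_sq]
  rw [integral_const_mul, integral_pow_mul_exp (by positivity)]
  have : (m.factorial : ℝ) ≠ 0 := by positivity
  field_simp

/-- The Wigner transform of the pair `(ψ, |0⟩)`, an isometry from `L²(ℝ)` to `L²(ℝ²)` which
intertwines Weyl operators with the action of plane waves by Moyal multiplication. -/
noncomputable def wigner (ψ : ℝ → ℂ) (x : ℝ × ℝ) : ℂ :=
  Real.sqrt (2 / (Real.pi * lP ^ 2)) * ∫ s : ℝ, ψ (x.1 + s) * eigenfunction lP 0 (x.1 - s) *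
    Complex.exp (-(2 * Complex.I * x.2 * s / (lP : ℂ) ^ 2))

theorem wigner_weyl (k : ℝ × ℝ) (ψ : ℝ → ℂ) (x : ℝ × ℝ) :
    wigner lP (weyl lP k ψ) x = wave lP k x * wigner lP ψ (x + halfRot k) := by
  rw [wigner, wigner, mul_left_comm]
  congr 1
  rw [← integral_const_mul, ← integral_sub_right_eq_self (μ := volume) _ (k.2 / 2)]
  refine integral_congr_ae (Eventually.of_forall fun s => ?_)
  simp only [weyl_apply, weylPhase, wave, halfRot, Prod.fst_add, Prod.snd_add]
  have h1 : x.1 + (s - k.2 / 2) + k.2 = x.1 + k.2 / 2 + s := by ring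
  have h2 : x.1 - (s - k.2 / 2) = x.1 + k.2 / 2 - s := by ring
  rw [h1, h2]
  have h3 : ∀ a b c d u v : ℂ, a + b = c + d → Complex.exp a * u * v * Complex.exp b =
      Complex.exp c * (u * v * Complex.exp d) := by
    intro a b c d u v h
    have h4 : Complex.exp a * Complex.exp b = Complex.exp c * Complex.exp d := by
      rw [← Complex.exp_add, ← Complex.exp_add, h]
    linear_combination (u * v) * h4
  apply h3
  push_cast
  ring

theorem eigenfunction_zero (x : ℝ) : eigenfunction lP 0 x =
    ((Real.pi * lP ^ 2) ^ (-(1 / 4) : ℝ) : ℝ) * Complex.exp (-((x : ℂ) ^ 2 / (2 * (lP : ℂ) ^ 2))) := by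
  rw [eigenfunction]
  simp [neg_div]

theorem rpow_quarter_sq {c : ℝ} (hc : 0 < c) : c ^ (-(1 / 4) : ℝ) * c ^ (-(1 / 4) : ℝ) = (Real.sqrt c)⁻¹ := by
  rw [← Real.rpow_add hc, Real.sqrt_eq_rpow, ← Real.rpow_neg hc.le]
  norm_num

theorem wigner_eigenfunction (hlP : 0 < lP) (m : ℕ) (x : ℝ × ℝ) :
    wigner lP (eigenfunction lP m) x = landau lP hlP m x := by
  have hl : (lP : ℂ) ≠ 0 := by exact_mod_cast hlP.ne'
  have hpi := Real.pi_pos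
  have h2 : ((Real.sqrt 2 : ℝ) : ℂ) ^ 2 = 2 := by
    rw [← Complex.ofReal_pow, Real.sq_sqrt (by norm_num)]; norm_num
  have h20 : ((Real.sqrt 2 : ℝ) : ℂ) ≠ 0 := by
    intro h; rw [h] at h2; norm_num at h2
  set z : ℂ := (x.1 : ℂ) - Complex.I * x.2
  set N : ℝ := (Real.pi * lP ^ 2) ^ (-(1 / 4) : ℝ) with hN
  have hsub : ∫ s : ℝ, eigenfunction lP m (x.1 + s) * eigenfunction lP 0 (x.1 - s) *
      Complex.exp (-(2 * Complex.I * x.2 * s / (lP : ℂ) ^ 2)) =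
      ((lP / Real.sqrt 2 : ℝ) : ℂ) * (eigenConst lP m * N *
        Complex.exp (-(2 * x.1 ^ 2 - 2 * Complex.I * x.1 * x.2) / (lP : ℂ) ^ 2) *
        ∫ t : ℝ, ((Polynomial.aeval t (Polynomial.hermite m) : ℝ) : ℂ) *
          Complex.exp (-(1 / 2 : ℝ) * (t : ℂ) ^ 2 + (Real.sqrt 2 / lP * z) * t)) := by
    have h3 := Measure.integral_comp_mul_left (fun t : ℝ => (eigenConst lP m * N *
        Complex.exp (-(2 * x.1 ^ 2 - 2 * Complex.I * x.1 * x.2) / (lP : ℂ) ^ 2)) *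
        (((Polynomial.aeval t (Polynomial.hermite m) : ℝ) : ℂ) *
          Complex.exp (-(1 / 2 : ℝ) * (t : ℂ) ^ 2 + (Real.sqrt 2 / lP * z) * t))) (Real.sqrt 2 / lP)
    rw [abs_of_pos (by positivity), inv_div, Complex.real_smul, integral_const_mul _
      (fun t : ℝ => ((Polynomial.aeval t (Polynomial.hermite m) : ℝ) : ℂ) *
          Complex.exp (-(1 / 2 : ℝ) * (t : ℂ) ^ 2 + (Real.sqrt 2 / lP * z) * t))] at h3
    rw [← h3, ← integral_add_left_eq_self (μ := volume) (fun s : ℝ => (eigenConst lP m * N *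
        Complex.exp (-(2 * x.1 ^ 2 - 2 * Complex.I * x.1 * x.2) / (lP : ℂ) ^ 2)) *
        (((Polynomial.aeval (Real.sqrt 2 / lP * s) (Polynomial.hermite m) : ℝ) : ℂ) *
          Complex.exp (-(1 / 2 : ℝ) * ((Real.sqrt 2 / lP * s : ℝ) : ℂ) ^ 2 +
            (Real.sqrt 2 / lP * z) * (Real.sqrt 2 / lP * s : ℝ)))) x.1]
    refine integral_congr_ae (Eventually.of_forall fun s => ?_)
    simp only
    rw [eigenfunction_eq, eigenfunction_zero, ← hN]
    have h4 : ∀ a b c d e p r q : ℂ, a + b + c = d + e → r * (p * Complex.exp a) * (q * Complex.exp b) *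
        Complex.exp c = r * q * Complex.exp d * (p * Complex.exp e) := by
      intro a b c d e p r q h
      have h5 : Complex.exp a * Complex.exp b * Complex.exp c = Complex.exp d * Complex.exp e := by
        rw [← Complex.exp_add, ← Complex.exp_add, ← Complex.exp_add, h]
      linear_combination (p * q * r) * h5
    apply h4
    simp only [z]
    push_cast
    field_simp
    linear_combination (((x.1 : ℂ) + s) ^ 2 - 2 * ((x.1 : ℂ) + s) * (x.1 - Complex.I * x.2)) * h2
  rw [wigner, hsub, integral_hermite_mul_cexp, landau_apply]
  have hexp : Complex.exp (-(2 * x.1 ^ 2 - 2 * Complex.I * x.1 * x.2) / (lP : ℂ) ^ 2) *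
      Complex.exp ((Real.sqrt 2 / lP * z) ^ 2 / 2) =
      ((Real.exp (-(1 / lP ^ 2) * (x.1 ^ 2 + x.2 ^ 2)) : ℝ) : ℂ) := by
    rw [← Complex.exp_add]
    push_cast
    congr 1
    rw [mul_pow, div_pow, h2]
    simp only [z]
    field_simp
    ring_nf
    rw [Complex.I_sq]
    ring
  rw [← hexp]
  -- The normalizing constants of the two eigenfunctions cancel the Gaussian integral.
  have hconst : (lP / Real.sqrt 2) * (eigenConst lP m * N * Real.sqrt (2 * Real.pi)) =
      1 / Real.sqrt m.factorial := by
    rw [eigenConst, ← hN]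
    have h6 : N * N = (Real.sqrt (Real.pi * lP ^ 2))⁻¹ := rpow_quarter_sq (by positivity)
    rw [Real.sqrt_mul (by positivity), Real.sqrt_sq hlP.le] at h6
    rw [Real.sqrt_mul (by norm_num)]
    have h7 : N * N * (Real.sqrt Real.pi * lP) = 1 := by rw [h6]; field_simp
    have h8 : Real.sqrt (m.factorial : ℝ) ≠ 0 := by positivity
    field_simp
    linear_combination h7
  have hconst' := congrArg (fun r : ℝ => (r : ℂ)) hconst
  push_cast at hconst' ⊢
  rw [mul_pow]
  linear_combination (Real.sqrt (2 / (Real.pi * lP ^ 2)) * ((Real.sqrt 2 / lP : ℂ) ^ m * z ^ m) *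
    (Complex.exp (-(2 * x.1 ^ 2 - 2 * Complex.I * x.1 * x.2) / (lP : ℂ) ^ 2) *
      Complex.exp ((Real.sqrt 2 / lP * z) ^ 2 / 2))) * hconst'

theorem integral_eigenfunction_zero_sq (hlP : 0 < lP) :
    ∫ x : ℝ, eigenfunction lP 0 x * eigenfunction lP 0 x = 1 := by
  have hpi := Real.pi_pos
  have h : ∀ x : ℝ, eigenfunction lP 0 x * eigenfunction lP 0 x =
      (((Real.sqrt (Real.pi * lP ^ 2))⁻¹ * Real.exp (-(1 / lP ^ 2) * x ^ 2) : ℝ) : ℂ) := by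
    intro x
    rw [eigenfunction_zero, mul_mul_mul_comm, ← Complex.ofReal_mul, rpow_quarter_sq (by positivity),
      ← Complex.exp_add]
    push_cast
    congr 2
    ring
  simp_rw [h]
  rw [integral_complex_ofReal, integral_const_mul, integral_gaussian, div_div_eq_mul_div, div_one,
    inv_mul_cancel₀ (by positivity), Complex.ofReal_one]

/-- Parseval's identity for the Wigner transform. -/
theorem integral_conj_wigner_mul (hlP : 0 < lP) (φ ψ : 𝓢(ℝ, ℂ))
    (hint : Integrable fun x => conj (wigner lP φ x) * wigner lP ψ x) :
    ∫ x, conj (wigner lP φ x) * wigner lP ψ x = ∫ t, conj (φ t) * ψ t := by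
  have hpi := Real.pi_pos
  have hl : (lP : ℂ) ≠ 0 := by exact_mod_cast hlP.ne'
  set g := eigenS lP hlP 0
  have hg : ∀ x, g x = eigenfunction lP 0 x := eigenS_apply lP hlP 0
  have heven : ∀ x, eigenfunction lP 0 (-x) = eigenfunction lP 0 x := by
    intro x; rw [eigenfunction_zero, eigenfunction_zero]; simp
  -- For fixed `x₁` the Wigner transform is a rescaled Fourier transform in `x₂`.
  let slice : ℝ → 𝓢(ℝ, ℂ) → 𝓢(ℝ, ℂ) := fun x₁ χ =>
    SchwartzMap.smulLeftCLM ℂ (SchwartzMap.compSubConstCLM ℂ x₁ g) (SchwartzMap.compSubConstCLM ℂ (-x₁) χ)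
  have hslice : ∀ x₁ χ s, slice x₁ χ s = χ (x₁ + s) * eigenfunction lP 0 (x₁ - s) := by
    intro x₁ χ s
    simp only [slice]
    rw [SchwartzMap.smulLeftCLM_apply_apply (SchwartzMap.hasTemperateGrowth _),
      SchwartzMap.compSubConstCLM_apply, SchwartzMap.compSubConstCLM_apply, hg, ← heven, smul_eq_mul,
      mul_comm, sub_neg_eq_add, add_comm s, neg_sub]
  have hw : ∀ (χ : 𝓢(ℝ, ℂ)) (x₁ x₂ : ℝ), wigner lP χ (x₁, x₂) = Real.sqrt (2 / (Real.pi * lP ^ 2)) *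
      FourierTransform.fourier (slice x₁ χ) (x₂ / (Real.pi * lP ^ 2)) := by
    intro χ x₁ x₂
    rw [wigner, SchwartzMap.fourier_coe, Real.fourier_eq']
    congr 1
    refine integral_congr_ae (Eventually.of_forall fun s => ?_)
    simp only [hslice, smul_eq_mul]
    rw [mul_comm]
    congr 2
    simp only [RCLike.inner_apply, conj_trivial]
    have : (Real.pi : ℂ) ≠ 0 := by exact_mod_cast hpi.ne'
    push_cast
    field_simp
  have hinner : ∀ x₁ : ℝ, ∫ x₂ : ℝ, conj (wigner lP φ (x₁, x₂)) * wigner lP ψ (x₁, x₂) =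
      2 * ∫ u : ℝ, (conj (φ u) * ψ u) * (g (2 * x₁ - u) * g (2 * x₁ - u)) := by
    intro x₁
    have h1 : ∀ x₂ : ℝ, conj (wigner lP φ (x₁, x₂)) * wigner lP ψ (x₁, x₂) =
        ((2 / (Real.pi * lP ^ 2) : ℝ) : ℂ) *
          (fun ξ => inner ℂ (FourierTransform.fourier (slice x₁ φ) ξ)
            (FourierTransform.fourier (slice x₁ ψ) ξ)) (x₂ / (Real.pi * lP ^ 2)) := by
      intro x₂
      have h2 : ((Real.sqrt (2 / (Real.pi * lP ^ 2)) : ℝ) : ℂ) ^ 2 = ((2 / (Real.pi * lP ^ 2) : ℝ) : ℂ) := by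
        rw [← Complex.ofReal_pow, Real.sq_sqrt (by positivity)]
      simp only [hw, RCLike.inner_apply, map_mul, Complex.conj_ofReal]
      rw [← h2]; ring
    simp_rw [h1]
    rw [integral_const_mul, Measure.integral_comp_div (fun ξ => inner ℂ (FourierTransform.fourier (slice x₁ φ) ξ)
      (FourierTransform.fourier (slice x₁ ψ) ξ)), SchwartzMap.integral_inner_fourier_fourier,
      abs_of_pos (by positivity), Complex.real_smul, ← mul_assoc, ← Complex.ofReal_mul,
      div_mul_cancel₀ _ (by positivity)]
    push_cast
    congr 1
    rw [← integral_add_left_eq_self (μ := volume) (fun u => (conj (φ u) * ψ u) *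
      (g (2 * x₁ - u) * g (2 * x₁ - u))) x₁]
    refine integral_congr_ae (Eventually.of_forall fun s => ?_)
    simp only [RCLike.inner_apply, hslice, map_mul, conj_eigenfunction, hg]
    rw [show 2 * x₁ - (x₁ + s) = x₁ - s by ring]
    ring
  rw [Measure.volume_eq_prod, integral_prod _ hint]
  simp_rw [hinner]
  rw [integral_const_mul]
  have i1 : Integrable fun u => conj (φ u) * ψ u := (integrable_conj φ).mul_bdd
    (c := SchwartzMap.seminorm ℝ 0 0 ψ) ψ.continuous.aestronglyMeasurable
    (Eventually.of_forall fun u => SchwartzMap.norm_le_seminorm ℝ ψ u)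
  have i2 : Integrable fun u => g u * g u := (g.integrable (μ := volume)).mul_bdd
    (c := SchwartzMap.seminorm ℝ 0 0 g) g.continuous.aestronglyMeasurable
    (Eventually.of_forall fun u => SchwartzMap.norm_le_seminorm ℝ g u)
  have h5 := integral_convolution (ContinuousLinearMap.mul ℝ ℂ) i1 i2
  have h6 := Measure.integral_comp_mul_left (fun y => ∫ u : ℝ, (conj (φ u) * ψ u) * (g (y - u) * g (y - u))) 2
  rw [h6]
  have h7 : ∫ y, ∫ u : ℝ, (conj (φ u) * ψ u) * (g (y - u) * g (y - u)) = ∫ t, conj (φ t) * ψ t := by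
    refine h5.trans ?_
    simp only [hg]
    rw [integral_eigenfunction_zero_sq lP hlP]
    simp
  rw [h7, Complex.real_smul, abs_of_pos (by norm_num)]
  push_cast
  ring

/-- The matrix elements of Weyl operators between eigenfunctions, as matrix elements of the
Moyal action of plane waves. -/
theorem weylElem_eigenS (hlP : 0 < lP) (j m : ℕ) (k : ℝ × ℝ) :
    weylElem lP (eigenS lP hlP j) (eigenS lP hlP m) k =
      ∫ x, conj (landau lP hlP j x) * (wave lP k x * landau lP hlP m (x + halfRot k)) := by
  have h1 : ∀ x, wigner lP (eigenS lP hlP j) x = landau lP hlP j x := by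
    intro x; rw [coe_eigenS]; exact wigner_eigenfunction lP hlP j x
  have h2 : ∀ x, wigner lP (weylS lP k (eigenS lP hlP m)) x =
      wave lP k x * landau lP hlP m (x + halfRot k) := by
    intro x
    rw [coe_weylS, wigner_weyl, coe_eigenS, wigner_eigenfunction lP hlP]
  have h := integral_conj_wigner_mul lP hlP (eigenS lP hlP j) (weylS lP k (eigenS lP hlP m)) ?_
  · simp_rw [h1, h2, weylS_apply] at h
    exact h.symm
  · simp_rw [h1, h2]
    have i1 : Integrable fun x => conj (landau lP hlP j x) := by
      refine ((landau lP hlP j).integrable (μ := volume)).norm.mono' (by fun_prop) (Eventually.of_forall fun x => ?_)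
      rw [RCLike.norm_conj]
    refine i1.mul_bdd (c := SchwartzMap.seminorm ℝ 0 0 (landau lP hlP m))
      (Continuous.aestronglyMeasurable (by fun_prop)) (Eventually.of_forall fun x => ?_)
    rw [norm_mul, norm_wave, one_mul]
    exact SchwartzMap.norm_le_seminorm ℝ _ _

end Moyal

namespace Moyal
open scoped LineDeriv

/-! ### Commutators with the Dirac operators -/

section
variable {E F : Type*} [NormedAddCommGroup E] [NormedSpace ℂ E] [CompleteSpace E]
  [NormedAddCommGroup F] [NormedSpace ℂ F] [CompleteSpace F] (lP : ℝ)

theorem moyal_clm (hlP : lP ≠ 0) (f : Alg) (L : E →L[ℂ] F) (Ψ : 𝓢(ℝ × ℝ, E)) (x : ℝ × ℝ) :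
    moyal lP f (fun y => L (Ψ y)) x = L (moyal lP f Ψ x) := by
  rw [moyal_eq lP hlP f (Ψ := fun y => L (Ψ y)) ((Ψ.postcompCLM L).integrable (μ := volume)),
    moyal_eq lP hlP f (Ψ.integrable (μ := volume)),
    ← L.integral_comp_comm (integrable_moyal_integrand lP hlP f Ψ x)]
  simp

theorem moyal_add_right (hlP : lP ≠ 0) (f : Alg) (Ψ Φ : 𝓢(ℝ × ℝ, E)) (x : ℝ × ℝ) :
    moyal lP f (⇑(Ψ + Φ)) x = moyal lP f Ψ x + moyal lP f Φ x := by
  rw [moyal_eq lP hlP f ((Ψ + Φ).integrable (μ := volume)),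
    moyal_eq lP hlP f (Ψ.integrable (μ := volume)), moyal_eq lP hlP f (Φ.integrable (μ := volume)),
    ← integral_add (integrable_moyal_integrand lP hlP f Ψ x) (integrable_moyal_integrand lP hlP f Φ x)]
  simp

theorem moyal_sub_left (hlP : lP ≠ 0) (f g : Alg) (Ψ : 𝓢(ℝ × ℝ, E)) (x : ℝ × ℝ) :
    moyal lP (⇑(f - g)) Ψ x = moyal lP f Ψ x - moyal lP g Ψ x := by
  rw [moyal_eq lP hlP _ (Ψ.integrable (μ := volume)),
    moyal_eq lP hlP f (Ψ.integrable (μ := volume)), moyal_eq lP hlP g (Ψ.integrable (μ := volume)),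
    ← integral_sub (integrable_moyal_integrand lP hlP f Ψ x) (integrable_moyal_integrand lP hlP g Ψ x)]
  refine integral_congr_ae (Eventually.of_forall fun k => ?_)
  have h := fourierHat_add lP hlP f ((-1 : ℂ) • g) k
  rw [fourierHat_smul lP hlP] at h
  have h2 : f - g = f + (-1 : ℂ) • g := by rw [neg_one_smul, sub_eq_add_neg]
  simp only [h2, h]
  rw [← sub_smul]
  congr 1
  ring

end

/-- Clifford multiplication by the covector `(c, d)`. -/
noncomputable def clifford (c d : ℂ) : Spin →L[ℂ] Spin :=
  LinearMap.toContinuousLinearMap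
    { toFun := fun u => !₂[-Complex.I * ((c + Complex.I * d) * u 1),
        -Complex.I * ((c - Complex.I * d) * u 0)]
      map_add' := fun u v => by ext i; fin_cases i <;> simp <;> ring
      map_smul' := fun r u => by ext i; fin_cases i <;> simp <;> ring }

theorem clifford_apply (c d : ℂ) (u : Spin) : clifford c d u =
    !₂[-Complex.I * ((c + Complex.I * d) * u 1), -Complex.I * ((c - Complex.I * d) * u 0)] := rfl

theorem smul_clifford_add (c d : ℂ) (u : Spin) :
    c • clifford 1 0 u + d • clifford 0 1 u = clifford c d u := by
  ext i; fin_cases i <;> simp [clifford_apply] <;> ring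

theorem dirac_eq (Ψ : ℝ × ℝ → Spin) (x : ℝ × ℝ) : dirac Ψ x =
    clifford 1 0 (fderiv ℝ Ψ x (1, 0)) + clifford 0 1 (fderiv ℝ Ψ x (0, 1)) := by
  ext i; fin_cases i <;> simp [clifford_apply, dirac] <;> ring

theorem commutator_dirac (lP : ℝ) (hlP : lP ≠ 0) (f : Alg) (Ψ : 𝓢(ℝ × ℝ, Spin)) (x : ℝ × ℝ) :
    commutator dirac (rep lP f) Ψ x =
      clifford 1 0 (moyal lP (∂_{((1, 0) : ℝ × ℝ)} f : Alg) Ψ x) +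
      clifford 0 1 (moyal lP (∂_{((0, 1) : ℝ × ℝ)} f : Alg) Ψ x) := by
  have h1 : dirac Ψ = ⇑((∂_{((1, 0) : ℝ × ℝ)} Ψ : 𝓢(ℝ × ℝ, Spin)).postcompCLM (clifford 1 0) +
      (∂_{((0, 1) : ℝ × ℝ)} Ψ : 𝓢(ℝ × ℝ, Spin)).postcompCLM (clifford 0 1)) := by
    ext1 y
    rw [dirac_eq]
    simp [SchwartzMap.lineDerivOp_apply_eq_fderiv]
  simp only [commutator, rep, Pi.sub_apply]
  rw [h1, moyal_add_right lP hlP, dirac_eq, fderiv_moyal lP hlP, fderiv_moyal lP hlP]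
  have h2 := moyal_clm lP hlP f (clifford 1 0) (∂_{((1, 0) : ℝ × ℝ)} Ψ : 𝓢(ℝ × ℝ, Spin)) x
  have h3 := moyal_clm lP hlP f (clifford 0 1) (∂_{((0, 1) : ℝ × ℝ)} Ψ : 𝓢(ℝ × ℝ, Spin)) x
  have h4 : ∀ (L : Spin →L[ℂ] Spin) (Φ : 𝓢(ℝ × ℝ, Spin)), ⇑(Φ.postcompCLM L) = fun y => L (Φ y) :=
    fun _ _ => rfl
  rw [h4, h4, h2, h3, map_add, map_add]
  abel

/-- Restriction of a doubled spinor to the sheet `i`. -/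
noncomputable def sheetCLM (i : Fin 2) : Spin' →L[ℂ] Spin :=
  LinearMap.toContinuousLinearMap
    { toFun := fun u => WithLp.toLp 2 fun s => u (s, i)
      map_add' := fun u v => by ext s; simp
      map_smul' := fun r u => by ext s; simp }

theorem sheetCLM_apply (i s : Fin 2) (u : Spin') : sheetCLM i u s = u (s, i) := rfl

/-- Inclusion of the spinors on the sheet `i` into the doubled spinors. -/
noncomputable def inclCLM (i : Fin 2) : Spin →L[ℂ] Spin' :=
  LinearMap.toContinuousLinearMap
    { toFun := fun u => WithLp.toLp 2 fun p => if p.2 = i then u p.1 else 0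
      map_add' := fun u v => by ext p; by_cases h : p.2 = i <;> simp [h]
      map_smul' := fun r u => by ext p; by_cases h : p.2 = i <;> simp [h] }

theorem inclCLM_apply (i : Fin 2) (u : Spin) (p : Fin 2 × Fin 2) :
    inclCLM i u p = if p.2 = i then u p.1 else 0 := rfl

/-- Clifford multiplication by the covector `(c, d)` on the sheet `i`. -/
noncomputable def cliffordOn (i : Fin 2) (c d : ℂ) : Spin' →L[ℂ] Spin' :=
  inclCLM i ∘L clifford c d ∘L sheetCLM i

theorem cliffordOn_apply (i : Fin 2) (c d : ℂ) (u : Spin') :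
    cliffordOn i c d u = inclCLM i (clifford c d (sheetCLM i u)) := rfl

theorem smul_cliffordOn_add (i : Fin 2) (c d : ℂ) (u : Spin') :
    c • cliffordOn i 1 0 u + d • cliffordOn i 0 1 u = cliffordOn i c d u := by
  simp only [cliffordOn_apply]
  rw [← smul_clifford_add c d, map_add, map_smul, map_smul]

/-- The operator `Γ ⊗ D_I` on doubled spinors. -/
noncomputable def internal (Λ : ℂ) : Spin' →L[ℂ] Spin' :=
  LinearMap.toContinuousLinearMap
    { toFun := fun u => WithLp.toLp 2 fun p => grading p.1 * ∑ j, diracI Λ p.2 j * u (p.1, j)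
      map_add' := fun u v => by ext p; simp; ring
      map_smul' := fun r u => by ext p; simp; ring }

theorem internal_apply (Λ : ℂ) (u : Spin') (p : Fin 2 × Fin 2) :
    internal Λ u p = grading p.1 * ∑ j, diracI Λ p.2 j * u (p.1, j) := rfl

/-- The commutator of `Γ ⊗ D_I` with the projection on the sheet `1`. -/
noncomputable def internalComm (Λ : ℂ) : Spin' →L[ℂ] Spin' :=
  internal Λ ∘L inclCLM 1 ∘L sheetCLM 1 - inclCLM 1 ∘L sheetCLM 1 ∘L internal Λ

theorem internalComm_apply (Λ : ℂ) (u : Spin') (s i : Fin 2) : internalComm Λ u (s, i) =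
    grading s * (![conj Λ * u (s, 1), -Λ * u (s, 0)] i) := by
  fin_cases i <;> simp [internalComm, internal_apply, inclCLM_apply, sheetCLM_apply, diracI]

theorem rep'_eq (lP : ℝ) (hlP : lP ≠ 0) (a : Fin 2 → Alg) (Ψ : 𝓢(ℝ × ℝ, Spin')) (x : ℝ × ℝ) :
    rep' lP a Ψ x = ∑ i, inclCLM i (sheetCLM i (moyal lP (a i) Ψ x)) := by
  have h : ∀ i, rep lP (a i) (sheet Ψ i) x = sheetCLM i (moyal lP (a i) Ψ x) := fun i =>
    moyal_clm lP hlP (a i) (sheetCLM i) Ψ x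
  ext ⟨s, i⟩
  simp only [rep', h]
  fin_cases i <;> simp [inclCLM_apply]

theorem dirac'_eq (Λ : ℂ) (Ψ : ℝ × ℝ → Spin') (x : ℝ × ℝ) (h : DifferentiableAt ℝ Ψ x) :
    dirac' Λ Ψ x = ∑ i, (cliffordOn i 1 0 (fderiv ℝ Ψ x (1, 0)) +
      cliffordOn i 0 1 (fderiv ℝ Ψ x (0, 1))) + internal Λ (Ψ x) := by
  have h1 : ∀ i v, fderiv ℝ (sheet Ψ i) x v = sheetCLM i (fderiv ℝ Ψ x v) := fun i v => by
    have := ((sheetCLM i).restrictScalars ℝ).hasFDerivAt.comp x h.hasFDerivAt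
    have h2 : sheet Ψ i = (sheetCLM i).restrictScalars ℝ ∘ Ψ := rfl
    rw [h2, this.fderiv]; rfl
  ext ⟨s, i⟩
  simp only [dirac', dirac_eq, h1]
  fin_cases i <;> simp [cliffordOn_apply, inclCLM_apply, internal_apply]

theorem commutator_dirac' (lP : ℝ) (hlP : lP ≠ 0) (Λ : ℂ) (a : Fin 2 → Alg) (Ψ : 𝓢(ℝ × ℝ, Spin'))
    (x : ℝ × ℝ) : commutator (dirac' Λ) (rep' lP a) Ψ x =
      ∑ i, (cliffordOn i 1 0 (moyal lP (∂_{((1, 0) : ℝ × ℝ)} (a i) : Alg) Ψ x) +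
        cliffordOn i 0 1 (moyal lP (∂_{((0, 1) : ℝ × ℝ)} (a i) : Alg) Ψ x)) +
      internalComm Λ (moyal lP (⇑(a 1 - a 0)) Ψ x) := by
  set Φ : 𝓢(ℝ × ℝ, Spin') :=
    ∑ i, ((∂_{((1, 0) : ℝ × ℝ)} Ψ : 𝓢(ℝ × ℝ, Spin')).postcompCLM (cliffordOn i 1 0) +
      (∂_{((0, 1) : ℝ × ℝ)} Ψ : 𝓢(ℝ × ℝ, Spin')).postcompCLM (cliffordOn i 0 1)) +
    Ψ.postcompCLM (internal Λ) with hΦ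
  have h1 : dirac' Λ Ψ = ⇑Φ := by
    ext1 y
    rw [dirac'_eq Λ _ y Ψ.differentiableAt, hΦ]
    simp [SchwartzMap.lineDerivOp_apply_eq_fderiv]
  have h4 : ∀ (f : Alg) (L : Spin' →L[ℂ] Spin') (Φ : 𝓢(ℝ × ℝ, Spin')),
      moyal lP f (⇑(Φ.postcompCLM L)) x = L (moyal lP f Φ x) :=
    fun f L Φ => moyal_clm lP hlP f L Φ x
  have h2 : ∀ y, HasFDerivAt (rep' lP a Ψ)
      (∑ i, ((inclCLM i ∘L sheetCLM i).restrictScalars ℝ) ∘L fderiv ℝ (moyal lP (a i) Ψ) y) y := by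
    intro y
    have h3 : rep' lP a Ψ = fun y => ∑ i, ((inclCLM i ∘L sheetCLM i).restrictScalars ℝ)
        (moyal lP (a i) Ψ y) := by
      ext1 y; exact rep'_eq lP hlP a Ψ y
    rw [h3]
    refine HasFDerivAt.fun_sum fun i _ => ?_
    exact ((inclCLM i ∘L sheetCLM i).restrictScalars ℝ).hasFDerivAt.comp y
      (hasFDerivAt_moyal lP hlP (a i) Ψ y).1.differentiableAt.hasFDerivAt
  simp only [commutator, Pi.sub_apply]
  rw [h1, dirac'_eq Λ _ x (h2 x).differentiableAt, (h2 x).fderiv, rep'_eq lP hlP, rep'_eq lP hlP]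
  simp only [hΦ, Fin.sum_univ_two, moyal_add_right lP hlP, h4, moyal_sub_left lP hlP,
    add_apply, ContinuousLinearMap.comp_apply, ContinuousLinearMap.coe_restrictScalars',
    fderiv_moyal lP hlP]
  generalize moyal lP (∂_{((1, 0) : ℝ × ℝ)} (a 0) : Alg) Ψ x = u1
  generalize moyal lP (∂_{((1, 0) : ℝ × ℝ)} (a 1) : Alg) Ψ x = u2
  generalize moyal lP (∂_{((0, 1) : ℝ × ℝ)} (a 0) : Alg) Ψ x = u3
  generalize moyal lP (∂_{((0, 1) : ℝ × ℝ)} (a 1) : Alg) Ψ x = u4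
  ext ⟨s, i⟩
  simp only [PiLp.sub_apply, PiLp.add_apply, map_add, map_sub]
  fin_cases s <;> fin_cases i <;>
    simp [internalComm_apply, cliffordOn_apply, clifford_apply, inclCLM_apply, sheetCLM_apply,
      internal_apply, grading, diracI] <;> ring

end Moyal

namespace Moyal
open scoped LineDeriv

/-! ### Matrix elements between eigenstates -/

variable (lP : ℝ)

/-- The matrix element `⟨j| π_S(f) |m⟩`. -/
noncomputable def matElem (hlP : 0 < lP) (j m : ℕ) (f : Alg) : ℂ :=
  ∫ k, fourierHat lP f k * weylElem lP (eigenS lP hlP j) (eigenS lP hlP m) k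

theorem eigenstate_eq (hlP : 0 < lP) (m : ℕ) (f : Alg) :
    eigenstate lP m f = matElem lP hlP m m f := by
  rw [eigenstate, ← coe_eigenS lP hlP, vectorState_eq lP hlP.ne', matElem]

/-- The translate `f(· + κ)`. -/
noncomputable abbrev shift (κ : ℝ × ℝ) (f : Alg) : Alg := f.compSubConstCLM ℂ (-κ)

theorem shift_apply (κ : ℝ × ℝ) (f : Alg) (x : ℝ × ℝ) : shift κ f x = f (x + κ) := by
  simp [shift]

theorem translate_apply (κ : ℂ) (φ : Alg → ℂ) (f : Alg) :
    translate κ φ f = φ (shift (κ.re, κ.im) f) := rfl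

theorem moyal_comp_sub {E : Type*} [NormedAddCommGroup E] [NormedSpace ℂ E] (f : Alg)
    (Ψ : ℝ × ℝ → E) (κ x : ℝ × ℝ) :
    moyal lP f (fun y => Ψ (y - κ)) x = moyal lP (shift κ f) Ψ (x - κ) := by
  have h2 : ∀ u : ℝ × ℝ, x - κ + u = x + u - κ := fun u => by abel
  simp only [moyal, shift_apply, h2, sub_add_cancel]

theorem norm_moyal_le {E : Type*} [NormedAddCommGroup E] [NormedSpace ℂ E] [CompleteSpace E]
    (hlP : lP ≠ 0) (f : Alg) (Ψ : 𝓢(ℝ × ℝ, E)) (x : ℝ × ℝ) :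
    ‖moyal lP f Ψ x‖ ≤ (∫ k, ‖fourierHat lP f k‖) * SchwartzMap.seminorm ℝ 0 0 Ψ := by
  rw [moyal_eq lP hlP f (Ψ.integrable (μ := volume)), ← integral_mul_const]
  refine norm_integral_le_of_norm_le ((integrable_fourierHat lP hlP f).norm.mul_const _)
    (Eventually.of_forall fun k => ?_)
  rw [norm_smul, norm_mul, norm_wave, mul_one]
  gcongr
  exact SchwartzMap.norm_le_seminorm ℝ Ψ _

theorem integrable_conj_schwartz (Φ : Alg) : Integrable fun x => conj (Φ x) := by
  refine (Φ.integrable (μ := volume)).norm.mono' (by fun_prop) (Eventually.of_forall fun x => ?_)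
  rw [RCLike.norm_conj]

theorem integrable_conj_mul_moyal (hlP : lP ≠ 0) (f Φ Ψ : Alg) :
    Integrable fun x => conj (Φ x) * moyal lP f Ψ x :=
  (integrable_conj_schwartz Φ).mul_bdd (c := (∫ k, ‖fourierHat lP f k‖) * SchwartzMap.seminorm ℝ 0 0 Ψ)
    (continuous_moyal lP hlP f Ψ).aestronglyMeasurable
    (Eventually.of_forall fun x => norm_moyal_le lP hlP f Ψ x)

/-- The Schrödinger matrix elements are matrix elements of the Moyal action between the
functions `landau`. -/
theorem matElem_eq (hlP : 0 < lP) (j m : ℕ) (f : Alg) :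
    matElem lP hlP j m f =
      ∫ x, conj (landau lP hlP j x) * moyal lP f (landau lP hlP m) x := by
  set Φ := landau lP hlP j
  set Ψ := landau lP hlP m
  have hc := continuous_fourierHat lP hlP.ne' f
  have hint : Integrable (Function.uncurry fun (k x : ℝ × ℝ) => fourierHat lP f k *
      (conj (Φ x) * (wave lP k x * Ψ (x + halfRot k)))) (volume.prod volume) := by
    have h0 := (integrable_fourierHat lP hlP.ne' f).mul_prod (integrable_conj_schwartz Φ)
    refine (h0.mul_bdd (c := SchwartzMap.seminorm ℝ 0 0 Ψ)
      (g := fun p => wave lP p.1 p.2 * Ψ (p.2 + halfRot p.1))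
      (Continuous.aestronglyMeasurable (by fun_prop)) (Eventually.of_forall fun p => ?_)).congr
      (Eventually.of_forall fun p => ?_)
    · rw [norm_mul, norm_wave, one_mul]; exact SchwartzMap.norm_le_seminorm ℝ Ψ _
    · simp only [Function.uncurry]; ring
  rw [matElem]
  simp_rw [weylElem_eigenS, ← integral_const_mul]
  rw [integral_integral_swap hint]
  refine integral_congr_ae (Eventually.of_forall fun x => ?_)
  simp only
  rw [moyal_eq lP hlP.ne' f (Ψ.integrable (μ := volume)), ← integral_const_mul]
  refine integral_congr_ae (Eventually.of_forall fun k => ?_)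
  simp only [smul_eq_mul]
  ring

theorem matElem_shift_eq (hlP : 0 < lP) (j m : ℕ) (f : Alg) (κ : ℝ × ℝ) :
    matElem lP hlP j m (shift κ f) = ∫ x, conj (landau lP hlP j (x - κ)) *
      moyal lP f (fun y => landau lP hlP m (y - κ)) x := by
  rw [matElem_eq]
  simp_rw [moyal_comp_sub]
  exact (integral_sub_right_eq_self (μ := volume) (fun x => conj (landau lP hlP j x) *
    moyal lP (shift κ f) (landau lP hlP m) x) κ).symm

theorem eLpNorm_landau_comp_sub (hlP : 0 < lP) (m : ℕ) (κ : ℝ × ℝ) :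
    eLpNorm (fun x => landau lP hlP m (x - κ)) 2 volume = 1 := by
  have h1 : eLpNorm (fun x => landau lP hlP m (x - κ)) 2 volume = eLpNorm (landau lP hlP m) 2 volume :=
    eLpNorm_comp_measurePreserving (g := landau lP hlP m)
      ((landau lP hlP m).continuous.aestronglyMeasurable) (measurePreserving_sub_right volume κ)
  rw [h1, ((landau lP hlP m).memLp 2 volume).eLpNorm_eq_integral_rpow_norm (by norm_num) (by norm_num)]
  simp [integral_norm_landau_sq]

/-- Cauchy–Schwarz for a scalar and a vector-valued function. -/
theorem enorm_integral_smul_le {E : Type*} [NormedAddCommGroup E] [NormedSpace ℂ E]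
    {g : ℝ × ℝ → ℂ} {Φ : ℝ × ℝ → E} (hg : AEStronglyMeasurable g) (hΦ : AEStronglyMeasurable Φ) :
    ‖∫ x, g x • Φ x‖ₑ ≤ eLpNorm g 2 volume * eLpNorm Φ 2 volume := by
  refine (enorm_integral_le_lintegral_enorm _).trans ?_
  rw [← eLpNorm_one_eq_lintegral_enorm]
  exact eLpNorm_smul_le_mul_eLpNorm (p := 2) (q := 2) (r := 1) hΦ hg

/-- If the operator `∑ C_l (g_l ⋆ ·)` has norm at most `1`, then so has every matrix
`∑ ⟨j|g_l(· + κ)|m⟩ C_l`. -/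
theorem norm_sum_matElem_smul_le {E ι : Type*} [NormedAddCommGroup E] [NormedSpace ℂ E]
    [CompleteSpace E] [Fintype ι] (hlP : 0 < lP) {T : (ℝ × ℝ → E) → (ℝ × ℝ → E)} (C : ι → E →L[ℂ] E) (g : ι → Alg)
    (hT : ∀ (Ψ : 𝓢(ℝ × ℝ, E)) x, T Ψ x = ∑ l, C l (moyal lP (g l) Ψ x)) (hn : opNorm T ≤ 1)
    (j m : ℕ) (κ : ℝ × ℝ) {u : E} (hu : ‖u‖ ≤ 1) :
    ‖∑ l, matElem lP hlP j m (shift κ (g l)) • C l u‖ ≤ 1 := by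
  set ξ : Alg := shift (-κ) (landau lP hlP m)
  have hξ : ∀ x, ξ x = landau lP hlP m (x - κ) := fun x => by
    rw [shift_apply, ← sub_eq_add_neg]
  have hξ' : ⇑ξ = fun x => landau lP hlP m (x - κ) := funext hξ
  set Lu : ℂ →L[ℂ] E := ContinuousLinearMap.toSpanSingleton ℂ u
  set Ψ : 𝓢(ℝ × ℝ, E) := ξ.postcompCLM Lu with hΨ
  have hΨx : ∀ x, Ψ x = landau lP hlP m (x - κ) • u := fun x => by
    rw [hΨ, SchwartzMap.postcompCLM_apply, hξ]; rfl
  have h1 : eLpNorm Ψ 2 volume ≤ 1 := by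
    rw [← eLpNorm_landau_comp_sub lP hlP m κ]
    refine eLpNorm_mono fun x => ?_
    rw [hΨx, norm_smul]
    exact mul_le_of_le_one_right (norm_nonneg _) hu
  have h2 : eLpNorm (T Ψ) 2 volume ≤ 1 :=
    (le_iSup₂ (f := fun (Ψ : 𝓢(ℝ × ℝ, E)) (_ : eLpNorm (⇑Ψ) 2 volume ≤ 1) =>
      eLpNorm (T Ψ) 2 volume) Ψ h1).trans hn
  have h3 : ∀ x, T Ψ x = ∑ l, moyal lP (g l) ξ x • C l u := by
    intro x
    rw [hT]
    refine Finset.sum_congr rfl fun l _ => ?_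
    have : moyal lP (g l) Ψ x = Lu (moyal lP (g l) ξ x) := moyal_clm lP hlP.ne' (g l) Lu ξ x
    rw [this, ContinuousLinearMap.toSpanSingleton_apply, map_smul]
  have h4 : Continuous (T Ψ) := by
    have : T Ψ = fun x => ∑ l, moyal lP (g l) ξ x • C l u := funext h3
    rw [this]
    have := fun l => continuous_moyal lP hlP.ne' (g l) ξ
    fun_prop
  have hcont : Continuous fun x => conj (landau lP hlP j (x - κ)) := by fun_prop
  have h5 : ∫ x, conj (landau lP hlP j (x - κ)) • T Ψ x =
      ∑ l, matElem lP hlP j m (shift κ (g l)) • C l u := by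
    simp_rw [h3, Finset.smul_sum, smul_smul]
    rw [integral_finsetSum]
    · refine Finset.sum_congr rfl fun l _ => ?_
      rw [integral_smul_const, matElem_shift_eq, hξ']
    · intro l _
      have := integrable_conj_mul_moyal lP hlP.ne' (g l) (shift (-κ) (landau lP hlP j)) ξ
      simp only [shift_apply, ← sub_eq_add_neg] at this
      exact this.smul_const _
  have h6 := enorm_integral_smul_le hcont.aestronglyMeasurable h4.aestronglyMeasurable
  have h7 : eLpNorm (fun x => conj (landau lP hlP j (x - κ))) 2 volume = 1 := by
    rw [← eLpNorm_landau_comp_sub lP hlP j κ]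
    exact eLpNorm_congr_norm_ae (Eventually.of_forall fun x => RCLike.norm_conj _)
  rw [h5, h7, one_mul] at h6
  have h8 := h6.trans h2
  rw [← ofReal_norm] at h8
  exact ENNReal.ofReal_le_one.1 h8

/-! ### Matrix elements along translations -/

theorem integrable_fourierHat_mul_weylElem (hlP : lP ≠ 0) (φ ψ : 𝓢(ℝ, ℂ)) (f : Alg) :
    Integrable fun k => fourierHat lP f k * weylElem lP φ ψ k :=
  (integrable_fourierHat lP hlP f).mul_bdd (continuous_weylElem lP φ ψ).aestronglyMeasurable
    (Eventually.of_forall fun k => norm_weylElem_le lP φ ψ k)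

theorem matElem_add (hlP : 0 < lP) (j m : ℕ) (f g : Alg) :
    matElem lP hlP j m (f + g) = matElem lP hlP j m f + matElem lP hlP j m g := by
  simp only [matElem]
  rw [← integral_add (integrable_fourierHat_mul_weylElem lP hlP.ne' _ _ f)
    (integrable_fourierHat_mul_weylElem lP hlP.ne' _ _ g)]
  simp_rw [fourierHat_add lP hlP.ne', add_mul]

theorem matElem_smul (hlP : 0 < lP) (j m : ℕ) (c : ℂ) (f : Alg) :
    matElem lP hlP j m (c • f) = c * matElem lP hlP j m f := by
  simp only [matElem]
  rw [← integral_const_mul]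
  simp_rw [fourierHat_smul lP hlP.ne', mul_assoc]

theorem matElem_sub (hlP : 0 < lP) (j m : ℕ) (f g : Alg) :
    matElem lP hlP j m (f - g) = matElem lP hlP j m f - matElem lP hlP j m g := by
  have h : f - g = f + (-1 : ℂ) • g := by rw [neg_one_smul, sub_eq_add_neg]
  rw [h, matElem_add, matElem_smul]; ring

theorem matElem_shift (hlP : 0 < lP) (j m : ℕ) (κ : ℝ × ℝ) (f : Alg) :
    matElem lP hlP j m (shift κ f) = ∫ k, wave lP k κ * (fourierHat lP f k *
      weylElem lP (eigenS lP hlP j) (eigenS lP hlP m) k) := by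
  simp only [matElem, shift, fourierHat_shift, mul_assoc]

/-- Differentiation under the integral over plane waves. -/
theorem hasDerivAt_matElem_shift (hlP : 0 < lP) (j m : ℕ) (f : Alg) (κ v : ℝ × ℝ) (t : ℝ) :
    HasDerivAt (fun t : ℝ => matElem lP hlP j m (shift (κ + t • v) f))
      (matElem lP hlP j m (shift (κ + t • v) (∂_{v} f : Alg))) t := by
  set M := weylElem lP (eigenS lP hlP j) (eigenS lP hlP m)
  have hM : Continuous M := continuous_weylElem lP _ _
  have hc := continuous_fourierHat lP hlP.ne' f
  have hc' := continuous_fourierHat lP hlP.ne' (∂_{v} f : Alg)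
  simp_rw [matElem_shift]
  have h1 : ∀ k (t : ℝ), HasDerivAt (fun t : ℝ => wave lP k (κ + t • v) * (fourierHat lP f k * M k))
      (wave lP k (κ + t • v) * (fourierHat lP (∂_{v} f : Alg) k * M k)) t := by
    intro k t
    have h2 : HasDerivAt (fun t : ℝ => κ + t • v) v t := by
      have := ((hasDerivAt_id t).smul_const v).const_add κ
      simpa using this
    have h3 := (hasFDerivAt_wave lP k (κ + t • v)).comp_hasDerivAt t h2
    refine (h3.mul_const _).congr_deriv ?_
    rw [FunLike.coe_smul, Pi.smul_apply, waveCLM_apply, fourierHat_lineDeriv lP hlP.ne', smul_eq_mul]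
    ring
  refine (hasDerivAt_integral_of_dominated_loc_of_deriv_le (s := Set.univ)
    (bound := fun k => ‖fourierHat lP (∂_{v} f : Alg) k * M k‖) univ_mem
    (Eventually.of_forall fun s => ?_) ?_ ?_ (Eventually.of_forall fun k s _ => ?_)
    (integrable_fourierHat_mul_weylElem lP hlP.ne' _ _ _).norm
    (Eventually.of_forall fun k s _ => h1 k s)).2
  · exact Continuous.aestronglyMeasurable (by fun_prop)
  · refine (integrable_fourierHat_mul_weylElem lP hlP.ne' (eigenS lP hlP j) (eigenS lP hlP m) f).norm.mono'
      (Continuous.aestronglyMeasurable (by fun_prop)) (Eventually.of_forall fun k => ?_)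
    rw [norm_mul, norm_wave, one_mul]
  · exact Continuous.aestronglyMeasurable (by fun_prop)
  · rw [norm_mul, norm_wave, one_mul]

/-- The mean value inequality along the segment from `(f₀, κ)` to `(f₁, κ + v)`: the derivative of
`t ↦ ⟨m|((1 - t) f₀ + t f₁)(· + κ + t v)|m⟩` consists of a difference of the two functions and a
convex combination of their derivatives in the direction `v`. -/
theorem norm_matElem_shift_sub_le (hlP : 0 < lP) (m : ℕ) (f₀ f₁ : Alg) (κ v : ℝ × ℝ) {B : ℝ}
    (h₀ : ∀ κ, ‖matElem lP hlP m m (shift κ (f₁ - f₀))‖ +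
      ‖matElem lP hlP m m (shift κ (∂_{v} f₀ : Alg))‖ ≤ B)
    (h₁ : ∀ κ, ‖matElem lP hlP m m (shift κ (f₁ - f₀))‖ +
      ‖matElem lP hlP m m (shift κ (∂_{v} f₁ : Alg))‖ ≤ B) :
    ‖matElem lP hlP m m (shift (κ + v) f₁) - matElem lP hlP m m (shift κ f₀)‖ ≤ B := by
  set G : Alg → ℝ → ℂ := fun f t => matElem lP hlP m m (shift (κ + t • v) f) with hG
  have hd : ∀ f t, HasDerivAt (G f) (G (∂_{v} f : Alg) t) t := fun f t =>
    hasDerivAt_matElem_shift lP hlP m m f κ v t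
  have hsub : ∀ t, G (f₁ - f₀) t = G f₁ t - G f₀ t := fun t => by
    simp only [hG, shift, map_sub, matElem_sub]
  have hF : ∀ t : ℝ, HasDerivAt (fun t : ℝ => (1 - (t : ℂ)) * G f₀ t + (t : ℂ) * G f₁ t)
      (G (f₁ - f₀) t + ((1 - (t : ℂ)) * G (∂_{v} f₀ : Alg) t + (t : ℂ) * G (∂_{v} f₁ : Alg) t)) t := by
    intro t
    have ht : HasDerivAt (fun t : ℝ => (t : ℂ)) 1 t := Complex.ofRealCLM.hasDerivAt
    refine (((ht.const_sub 1).mul (hd f₀ t)).add (ht.mul (hd f₁ t))).congr_deriv ?_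
    rw [hsub]; ring
  have h := norm_image_sub_le_of_norm_deriv_le_segment_01' (C := B)
    (fun t _ => (hF t).hasDerivWithinAt) (fun t ht => ?_)
  · simpa [hG] using h
  · have ht1 : ‖(1 - (t : ℂ))‖ = 1 - t := by
      rw [← Complex.ofReal_one, ← Complex.ofReal_sub, Complex.norm_real, Real.norm_of_nonneg]
      linarith [ht.2]
    have ht2 : ‖(t : ℂ)‖ = t := by rw [Complex.norm_real, Real.norm_of_nonneg ht.1]
    refine (norm_add_le _ _).trans ((add_le_add_right (norm_add_le _ _) _).trans ?_)
    rw [norm_mul, norm_mul, ht1, ht2]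
    have e0 := h₀ (κ + t • v)
    have e1 := h₁ (κ + t • v)
    change ‖G (f₁ - f₀) t‖ + ‖G (∂_{v} f₀ : Alg) t‖ ≤ B at e0
    change ‖G (f₁ - f₀) t‖ + ‖G (∂_{v} f₁ : Alg) t‖ ≤ B at e1
    nlinarith [mul_le_mul_of_nonneg_left e0 (by linarith [ht.2] : 0 ≤ 1 - t),
      mul_le_mul_of_nonneg_left e1 ht.1]

end Moyal

namespace Moyal
open scoped LineDeriv

/-! ### Upper bounds for the spectral distances -/

variable (lP : ℝ)

theorem matElem_lineDeriv (hlP : 0 < lP) (j m : ℕ) (κ v : ℝ × ℝ) (f : Alg) :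
    matElem lP hlP j m (shift κ (∂_{v} f : Alg)) =
      v.1 * matElem lP hlP j m (shift κ (∂_{((1, 0) : ℝ × ℝ)} f : Alg)) +
      v.2 * matElem lP hlP j m (shift κ (∂_{((0, 1) : ℝ × ℝ)} f : Alg)) := by
  rw [← matElem_smul, ← matElem_smul, ← matElem_add]
  congr 1
  ext x
  simp only [shift_apply, SchwartzMap.lineDerivOp_apply_eq_fderiv, add_apply, _root_.smul_apply, smul_eq_mul]
  have h : v = v.1 • ((1, 0) : ℝ × ℝ) + v.2 • ((0, 1) : ℝ × ℝ) := by ext <;> simp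
  have h2 := congrArg (fderiv ℝ f (x + κ)) h
  rw [map_add, map_smul, map_smul, Complex.real_smul, Complex.real_smul] at h2
  exact h2

/-- A derivative `∂_v = v₁ ∂₁ + v₂ ∂₂` is controlled by `∂₁ ± i ∂₂` and the Euclidean length of
`v`. -/
theorem norm_add_mul_le (v : ℝ × ℝ) {a b : ℂ} {r : ℝ} (h₁ : ‖a + Complex.I * b‖ ≤ r)
    (h₂ : ‖a - Complex.I * b‖ ≤ r) : ‖v.1 * a + v.2 * b‖ ≤ Real.sqrt (v.1 ^ 2 + v.2 ^ 2) * r := by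
  set z : ℂ := ⟨v.1, v.2⟩
  have hz : ‖z‖ = Real.sqrt (v.1 ^ 2 + v.2 ^ 2) := by
    rw [Complex.norm_def, Complex.normSq_apply]; ring_nf; rfl
  have hz1 : z = v.1 + Complex.I * v.2 := by
    refine (Complex.mk_eq_add_mul_I v.1 v.2).trans ?_; ring
  have hz2 : conj z = v.1 - Complex.I * v.2 := by
    rw [hz1]; simp; ring
  have h : v.1 * a + v.2 * b = 1 / 2 * (z * (a - Complex.I * b)) + 1 / 2 * (conj z * (a + Complex.I * b)) := by
    rw [hz2, hz1]; ring_nf; rw [Complex.I_sq]; ring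
  rw [h]
  refine (norm_add_le _ _).trans ?_
  rw [norm_mul, norm_mul, norm_mul, norm_mul, RCLike.norm_conj, hz]
  have : ‖(1 / 2 : ℂ)‖ = 1 / 2 := by norm_num
  rw [this]
  have h0 := Real.sqrt_nonneg (v.1 ^ 2 + v.2 ^ 2)
  nlinarith [mul_le_mul_of_nonneg_left h₁ h0, mul_le_mul_of_nonneg_left h₂ h0]

/-- The entries of the matrix `[D, f]` off the diagonal are multiples of `(∂₁ ± i ∂₂) f`, so a
bound of its norm bounds the matrix elements of both. -/
theorem norm_matElem_le_of_commutator (hlP : 0 < lP) {f : Alg}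
    (hf : opNorm (commutator dirac (rep lP f)) ≤ 1) (j m : ℕ) (κ : ℝ × ℝ) :
    ‖matElem lP hlP j m (shift κ (∂_{((1, 0) : ℝ × ℝ)} f : Alg)) +
      Complex.I * matElem lP hlP j m (shift κ (∂_{((0, 1) : ℝ × ℝ)} f : Alg))‖ ≤ 1 ∧
    ‖matElem lP hlP j m (shift κ (∂_{((1, 0) : ℝ × ℝ)} f : Alg)) -
      Complex.I * matElem lP hlP j m (shift κ (∂_{((0, 1) : ℝ × ℝ)} f : Alg))‖ ≤ 1 := by
  have h := fun (u : Spin) => norm_sum_matElem_smul_le (E := Spin) (ι := Fin 2) lP hlP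
    (T := commutator dirac (rep lP f)) ![clifford 1 0, clifford 0 1]
    ![(∂_{((1, 0) : ℝ × ℝ)} f : Alg), (∂_{((0, 1) : ℝ × ℝ)} f : Alg)]
    (fun Ψ x => by rw [commutator_dirac lP hlP.ne', Fin.sum_univ_two]; rfl) hf j m κ (u := u)
  simp only [Fin.sum_univ_two, Matrix.cons_val_zero, Matrix.cons_val_one, smul_clifford_add] at h
  constructor
  · have h1 := h (EuclideanSpace.single 1 1) (by simp)
    simpa [clifford_apply, EuclideanSpace.norm_eq] using h1
  · have h1 := h (EuclideanSpace.single 0 1) (by simp)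
    simpa [clifford_apply, EuclideanSpace.norm_eq] using h1

/-- In the doubled model each column of `[D', a]` contains, besides the derivative `(∂₁ ± i ∂₂) a_i` of
one component, the entry `Λ (a₂ - a₁)` up to a phase and conjugation; the length of the column is
at most `1`. -/
theorem norm_sq_matElem_le_of_commutator' (hlP : 0 < lP) {Λ : ℂ} {a : Fin 2 → Alg}
    (ha : opNorm (commutator (dirac' Λ) (rep' lP a)) ≤ 1) (m : ℕ) (κ : ℝ × ℝ) (i : Fin 2) :
    ‖matElem lP hlP m m (shift κ (∂_{((1, 0) : ℝ × ℝ)} (a i) : Alg)) +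
      Complex.I * matElem lP hlP m m (shift κ (∂_{((0, 1) : ℝ × ℝ)} (a i) : Alg))‖ ^ 2 +
      ‖Λ‖ ^ 2 * ‖matElem lP hlP m m (shift κ (a 1 - a 0))‖ ^ 2 ≤ 1 ∧
    ‖matElem lP hlP m m (shift κ (∂_{((1, 0) : ℝ × ℝ)} (a i) : Alg)) -
      Complex.I * matElem lP hlP m m (shift κ (∂_{((0, 1) : ℝ × ℝ)} (a i) : Alg))‖ ^ 2 +
      ‖Λ‖ ^ 2 * ‖matElem lP hlP m m (shift κ (a 1 - a 0))‖ ^ 2 ≤ 1 := by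
  have h := fun (u : Spin') => norm_sum_matElem_smul_le (E := Spin') (ι := Fin 5) lP hlP
    (T := commutator (dirac' Λ) (rep' lP a))
    ![cliffordOn 0 1 0, cliffordOn 0 0 1, cliffordOn 1 1 0, cliffordOn 1 0 1, internalComm Λ]
    ![(∂_{((1, 0) : ℝ × ℝ)} (a 0) : Alg), (∂_{((0, 1) : ℝ × ℝ)} (a 0) : Alg),
      (∂_{((1, 0) : ℝ × ℝ)} (a 1) : Alg), (∂_{((0, 1) : ℝ × ℝ)} (a 1) : Alg), a 1 - a 0]
    (fun Ψ x => by
      rw [commutator_dirac' lP hlP.ne', Fin.sum_univ_five, Fin.sum_univ_two]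
      simp only [Matrix.cons_val]
      abel) ha m m κ (u := u)
  simp only [Fin.sum_univ_five, Matrix.cons_val] at h
  generalize matElem lP hlP m m (shift κ (a 1 - a 0)) = g at h ⊢
  replace h : ∀ u : Spin', ‖u‖ ≤ 1 → ‖∑ i, cliffordOn i
      (matElem lP hlP m m (shift κ (∂_{((1, 0) : ℝ × ℝ)} (a i) : Alg)))
      (matElem lP hlP m m (shift κ (∂_{((0, 1) : ℝ × ℝ)} (a i) : Alg))) u + g • internalComm Λ u‖ ≤ 1 := by
    intro u hu
    rw [Fin.sum_univ_two, ← smul_cliffordOn_add 0, ← smul_cliffordOn_add 1, ← add_assoc]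
    exact h u hu
  have hnorm : ∀ w : Spin', ‖w‖ ≤ 1 → ‖w (0, 0)‖ ^ 2 + ‖w (0, 1)‖ ^ 2 + (‖w (1, 0)‖ ^ 2 + ‖w (1, 1)‖ ^ 2) ≤ 1 := by
    intro w hw
    have := EuclideanSpace.norm_sq_eq w
    rw [Fintype.sum_prod_type] at this
    simp only [Fin.sum_univ_two] at this
    rw [← this]
    exact pow_le_one₀ (norm_nonneg _) hw
  have h0 := fun s => hnorm _ (h (EuclideanSpace.single (s, i) 1) (by simp))
  generalize matElem lP hlP m m (shift κ (∂_{((1, 0) : ℝ × ℝ)} (a 0) : Alg)) = p₀ at h0 ⊢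
  constructor
  · have h1 := h0 1
    fin_cases i <;>
    simpa [cliffordOn_apply, clifford_apply, inclCLM_apply, sheetCLM_apply, internalComm_apply,
      grading, mul_pow, mul_comm] using h1
  · have h1 := h0 0
    fin_cases i <;>
    simpa [cliffordOn_apply, clifford_apply, inclCLM_apply, sheetCLM_apply, internalComm_apply,
      grading, mul_pow, mul_comm, add_comm] using h1

/-- The distance of two translates of the same state is at most the length of the translation. -/
theorem distD_translate_le (hlP : 0 < lP) (m : ℕ) (κ κ' : ℂ) :
    distD lP (translate κ (eigenstate lP m)) (translate κ' (eigenstate lP m)) ≤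
      ENNReal.ofReal ‖κ - κ'‖ := by
  refine iSup₂_le fun f hf => ?_
  rw [← ofReal_norm]
  refine ENNReal.ofReal_le_ofReal ?_
  rw [translate_apply, translate_apply, eigenstate_eq lP hlP, eigenstate_eq lP hlP]
  set v : ℝ × ℝ := ((κ - κ').re, (κ - κ').im) with hv
  have h0 : ((κ.re, κ.im) : ℝ × ℝ) = (κ'.re, κ'.im) + v := by
    ext <;> simp [hv]
  have hb : ∀ ρ, ‖matElem lP hlP m m (shift ρ (f - f))‖ +
      ‖matElem lP hlP m m (shift ρ (∂_{v} f : Alg))‖ ≤ ‖κ - κ'‖ := by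
    intro ρ
    obtain ⟨h1, h2⟩ := norm_matElem_le_of_commutator lP hlP hf m m ρ
    have h3 := norm_add_mul_le v h1 h2
    have h4 : matElem lP hlP m m (shift ρ (f - f)) = 0 := by
      rw [shift, map_sub, matElem_sub, sub_self]
    rw [h4, norm_zero, zero_add, matElem_lineDeriv]
    refine h3.trans (le_of_eq ?_)
    rw [mul_one, Complex.norm_def, Complex.normSq_apply, hv]
    ring_nf
  rw [h0]
  exact norm_matElem_shift_sub_le lP hlP m f f _ v hb hb

/-- Consecutive eigenstates: by the commutation relation of the creation operator, the difference
of `ω_{m+1}` and `ω_m` is a matrix element of `∂₁ - i ∂₂`. -/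
theorem norm_matElem_succ_sub_le (hlP : 0 < lP) {f : Alg}
    (hf : opNorm (commutator dirac (rep lP f)) ≤ 1) (m : ℕ) (κ : ℝ × ℝ) :
    ‖matElem lP hlP (m + 1) (m + 1) (shift κ f) - matElem lP hlP m m (shift κ f)‖ ≤
      Real.sqrt 2 * lP * (Real.sqrt (m + 1 : ℕ) - Real.sqrt m) := by
  have hl : (lP : ℂ) ≠ 0 := by exact_mod_cast hlP.ne'
  have h1 : ((Real.sqrt 2 * lP * Real.sqrt (m + 1 : ℕ) : ℝ) : ℂ) *
      (matElem lP hlP (m + 1) (m + 1) (shift κ f) - matElem lP hlP m m (shift κ f)) =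
      (lP : ℂ) ^ 2 * (matElem lP hlP (m + 1) m (shift κ (∂_{((1, 0) : ℝ × ℝ)} f : Alg)) -
      Complex.I * matElem lP hlP (m + 1) m (shift κ (∂_{((0, 1) : ℝ × ℝ)} f : Alg))) := by
    have i1 := integrable_fourierHat_mul_weylElem lP hlP.ne' (eigenS lP hlP (m + 1)) (eigenS lP hlP (m + 1)) (shift κ f)
    have i2 := integrable_fourierHat_mul_weylElem lP hlP.ne' (eigenS lP hlP m) (eigenS lP hlP m) (shift κ f)
    have h2 : matElem lP hlP (m + 1) m (shift κ (∂_{((1, 0) : ℝ × ℝ)} f : Alg)) -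
      Complex.I * matElem lP hlP (m + 1) m (shift κ (∂_{((0, 1) : ℝ × ℝ)} f : Alg)) =
      matElem lP hlP (m + 1) m (shift κ ((∂_{((1, 0) : ℝ × ℝ)} f : Alg) -
        Complex.I • (∂_{((0, 1) : ℝ × ℝ)} f : Alg))) := by
      simp only [shift, map_sub, map_smul, matElem_sub, matElem_smul]
    rw [h2]
    simp only [matElem]
    rw [← integral_sub i1 i2, ← integral_const_mul, ← integral_const_mul]
    refine integral_congr_ae (Eventually.of_forall fun k => ?_)
    have h3 := weylElem_succ_sub lP hlP m k
    have h4 : fourierHat lP (shift κ ((∂_{((1, 0) : ℝ × ℝ)} f : Alg) -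
        Complex.I • (∂_{((0, 1) : ℝ × ℝ)} f : Alg))) k =
        (k.2 + Complex.I * k.1) / (lP : ℂ) ^ 2 * fourierHat lP (shift κ f) k := by
      have h5 : (∂_{((1, 0) : ℝ × ℝ)} f : Alg) - Complex.I • (∂_{((0, 1) : ℝ × ℝ)} f : Alg) =
        (∂_{((1, 0) : ℝ × ℝ)} f : Alg) + (-Complex.I) • (∂_{((0, 1) : ℝ × ℝ)} f : Alg) := by
        rw [neg_smul, sub_eq_add_neg]
      rw [fourierHat_shift, fourierHat_shift, h5, fourierHat_add lP hlP.ne', fourierHat_smul lP hlP.ne',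
        fourierHat_lineDeriv lP hlP.ne', fourierHat_lineDeriv lP hlP.ne']
      field_simp
      push_cast
      ring_nf
      rw [Complex.I_sq]
      ring
    simp only
    rw [h4]
    field_simp
    push_cast at h3 ⊢
    linear_combination (fourierHat lP (shift κ f) k) * h3
  obtain ⟨-, h2⟩ := norm_matElem_le_of_commutator lP hlP hf (m + 1) m κ
  have h3 := congrArg norm h1
  have hs : 0 < Real.sqrt (m + 1 : ℕ) := Real.sqrt_pos.2 (by positivity)
  have hs2 : 0 < Real.sqrt 2 := by positivity
  rw [norm_mul, norm_mul, Complex.norm_real, Real.norm_of_nonneg (by positivity), norm_pow, Complex.norm_real,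
    Real.norm_of_nonneg hlP.le] at h3
  set A := ‖matElem lP hlP (m + 1) (m + 1) (shift κ f) - matElem lP hlP m m (shift κ f)‖
  have h4 : Real.sqrt 2 * lP * Real.sqrt (m + 1 : ℕ) * A ≤ lP ^ 2 := by
    rw [h3]; exact mul_le_of_le_one_right (by positivity) h2
  have h5 : Real.sqrt 2 * Real.sqrt (m + 1 : ℕ) * A ≤ lP := by
    have : lP * (Real.sqrt 2 * Real.sqrt (m + 1 : ℕ) * A) ≤ lP * lP := by linarith
    exact le_of_mul_le_mul_left this hlP
  -- `1 / (2 √(m+1)) ≤ √(m+1) - √m`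
  have hs3 : Real.sqrt 2 * Real.sqrt 2 = 2 := Real.mul_self_sqrt (by norm_num)
  have hm1 : Real.sqrt (m + 1 : ℕ) * Real.sqrt (m + 1 : ℕ) = m + 1 := by
    rw [Real.mul_self_sqrt (by positivity)]; push_cast; rfl
  have hm0 : Real.sqrt m * Real.sqrt m = m := Real.mul_self_sqrt (by positivity)
  have h6 : 1 ≤ 2 * Real.sqrt (m + 1 : ℕ) * (Real.sqrt (m + 1 : ℕ) - Real.sqrt m) := by
    nlinarith [sq_nonneg (Real.sqrt (m + 1 : ℕ) - Real.sqrt m)]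
  have h7 : Real.sqrt 2 * Real.sqrt (m + 1 : ℕ) * A ≤ Real.sqrt 2 * Real.sqrt (m + 1 : ℕ) *
      (Real.sqrt 2 * lP * (Real.sqrt (m + 1 : ℕ) - Real.sqrt m)) := by
    refine h5.trans ?_
    have : Real.sqrt 2 * Real.sqrt (m + 1 : ℕ) *
      (Real.sqrt 2 * lP * (Real.sqrt (m + 1 : ℕ) - Real.sqrt m)) = lP *
      (2 * Real.sqrt (m + 1 : ℕ) * (Real.sqrt (m + 1 : ℕ) - Real.sqrt m)) := by
      linear_combination (Real.sqrt (m + 1 : ℕ) * lP * (Real.sqrt (m + 1 : ℕ) - Real.sqrt m)) * hs3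
    rw [this]
    nlinarith
  exact le_of_mul_le_mul_left h7 (by positivity)

/-- The distance of two eigenstates, translated by the same vector. -/
theorem distD_eigenstate_le (hlP : 0 < lP) (m n : ℕ) (hmn : m ≤ n) (κ : ℂ) :
    distD lP (translate κ (eigenstate lP m)) (translate κ (eigenstate lP n)) ≤
      ENNReal.ofReal (Real.sqrt 2 * lP * (Real.sqrt n - Real.sqrt m)) := by
  refine iSup₂_le fun f hf => ?_
  rw [← ofReal_norm]
  refine ENNReal.ofReal_le_ofReal ?_
  rw [translate_apply, translate_apply, eigenstate_eq lP hlP, eigenstate_eq lP hlP, norm_sub_rev]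
  induction n, hmn using Nat.le_induction with
  | base => simp
  | succ n _ ih =>
    have h := norm_matElem_succ_sub_le lP hlP hf n (κ.re, κ.im)
    refine (norm_sub_le_norm_sub_add_norm_sub _ (matElem lP hlP n n (shift (κ.re, κ.im) f)) _).trans ?_
    linarith

/-- The upper bound of the distance on the two-sheet model: Pythagoras for the length of the
translation and the distance `1 / |Λ|` of the sheets. -/
theorem distD'_le (hlP : 0 < lP) {Λ : ℂ} (hΛ : Λ ≠ 0) (m : ℕ) (κ κ' : ℂ) :
    distD' lP Λ (onSheet (translate κ (eigenstate lP m)) 0)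
      (onSheet (translate κ' (eigenstate lP m)) 1) ≤
      ENNReal.ofReal (Real.sqrt (‖κ - κ'‖ ^ 2 + (‖Λ‖ ^ 2)⁻¹)) := by
  refine iSup₂_le fun a ha => ?_
  rw [← ofReal_norm]
  refine ENNReal.ofReal_le_ofReal ?_
  simp only [onSheet]
  rw [translate_apply, translate_apply, eigenstate_eq lP hlP, eigenstate_eq lP hlP, norm_sub_rev,
    norm_sub_rev κ]
  have hL : 0 < ‖Λ‖ := norm_pos_iff.2 hΛ
  set v : ℝ × ℝ := ((κ' - κ).re, (κ' - κ).im) with hv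
  have h0 : ((κ'.re, κ'.im) : ℝ × ℝ) = (κ.re, κ.im) + v := by
    ext <;> simp [hv]
  have hvn : Real.sqrt (v.1 ^ 2 + v.2 ^ 2) = ‖κ' - κ‖ := by
    rw [Complex.norm_def, Complex.normSq_apply, hv]
    ring_nf
  have hb : ∀ ρ i, ‖matElem lP hlP m m (shift ρ (a 1 - a 0))‖ +
      ‖matElem lP hlP m m (shift ρ (∂_{v} (a i) : Alg))‖ ≤
      Real.sqrt (‖κ' - κ‖ ^ 2 + (‖Λ‖ ^ 2)⁻¹) := by
    intro ρ i
    obtain ⟨h1, h2⟩ := norm_sq_matElem_le_of_commutator' lP hlP ha m ρ i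
    set g := ‖matElem lP hlP m m (shift ρ (a 1 - a 0))‖
    have hr : 0 ≤ 1 - ‖Λ‖ ^ 2 * g ^ 2 := le_trans (sq_nonneg _) (by linarith)
    have h3 := norm_add_mul_le v (r := Real.sqrt (1 - ‖Λ‖ ^ 2 * g ^ 2))
      (Real.le_sqrt_of_sq_le (by linarith)) (Real.le_sqrt_of_sq_le (by linarith))
    rw [matElem_lineDeriv]
    refine (add_le_add_right h3 _).trans (Real.le_sqrt_of_sq_le ?_)
    rw [hvn]
    set r := Real.sqrt (1 - ‖Λ‖ ^ 2 * g ^ 2)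
    have hr2 : r ^ 2 = 1 - ‖Λ‖ ^ 2 * g ^ 2 := Real.sq_sqrt hr
    set d := ‖κ' - κ‖
    -- Cauchy–Schwarz for the vectors `(1 / |Λ|, d)` and `(|Λ| g, r)`
    have h4 : g + d * r = ‖Λ‖⁻¹ * (‖Λ‖ * g) + d * r := by field_simp
    rw [h4, ← inv_pow]
    have h5 : (d ^ 2 + ‖Λ‖⁻¹ ^ 2) * ((‖Λ‖ * g) ^ 2 + r ^ 2) = d ^ 2 + ‖Λ‖⁻¹ ^ 2 := by
      rw [hr2]; ring
    rw [← h5]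
    nlinarith [sq_nonneg (‖Λ‖⁻¹ * r - d * (‖Λ‖ * g))]
  rw [h0]
  exact norm_matElem_shift_sub_le lP hlP m (a 0) (a 1) _ v (fun ρ => hb ρ 0) (fun ρ => hb ρ 1)

end Moyal

namespace Moyal

/-! ### Coherent state projections on the plane -/

variable (lP : ℝ)

/-- The Gaussian `exp(-|x|²/θ)`. -/
noncomputable def planeGaussFun (x : ℝ × ℝ) : ℝ := Real.exp (-(1 / lP ^ 2) * (x.1 ^ 2 + x.2 ^ 2))

/-- The integral kernel of the projection, in `L²(ℝ²)`, on the coherent states at `z`: the left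
Moyal multiplication by the Gaussian `2 exp(-|x - z|²/θ)` centred at `z`. -/
noncomputable def cohKernel (z x y : ℝ × ℝ) : ℂ :=
  ((2 / (Real.pi * lP ^ 2) * planeGaussFun lP (y - x) : ℝ) : ℂ) *
    wave lP (-2 * (y.2 - x.2), 2 * (y.1 - x.1)) (x - z)

theorem planeGaussFun_nonneg (x : ℝ × ℝ) : 0 ≤ planeGaussFun lP x := (Real.exp_pos _).le

theorem planeGaussFun_le_one (x : ℝ × ℝ) : planeGaussFun lP x ≤ 1 := by
  rw [planeGaussFun, Real.exp_le_one_iff, neg_mul, neg_nonpos]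
  positivity

theorem planeGaussFun_sub_comm (x y : ℝ × ℝ) : planeGaussFun lP (x - y) = planeGaussFun lP (y - x) := by
  rw [planeGaussFun, planeGaussFun]
  simp only [Prod.fst_sub, Prod.snd_sub]
  ring_nf

@[fun_prop]
theorem continuous_planeGaussFun : Continuous (planeGaussFun lP) := by
  unfold planeGaussFun; fun_prop

theorem integrable_planeGaussFun (hlP : 0 < lP) : Integrable (planeGaussFun lP) := by
  have h := ((planeGauss (b := 1 / lP ^ 2) (by positivity)).integrable (μ := volume)).norm
  refine h.congr (Eventually.of_forall fun x => ?_)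
  simp only [planeGauss_apply, Complex.norm_real, planeGaussFun]
  rw [Real.norm_of_nonneg (Real.exp_pos _).le]

theorem integral_planeGaussFun_sq (hlP : 0 < lP) (y : ℝ × ℝ) :
    ∫ x, planeGaussFun lP (y - x) ^ 2 = Real.pi * lP ^ 2 / 2 := by
  rw [integral_sub_left_eq_self (fun x => planeGaussFun lP x ^ 2)]
  have h := integral_pow_mul_exp (c := lP ^ 2 / 2) (by positivity) 0
  simp only [pow_zero, one_mul, Nat.factorial_zero, Nat.cast_one, mul_one] at h
  rw [mul_div_assoc, ← h]
  refine integral_congr_ae (Eventually.of_forall fun x => ?_)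
  simp only [planeGaussFun]
  rw [← Real.exp_nat_mul]
  congr 1
  push_cast
  field_simp

theorem continuous_cohKernel {X : Type*} [TopologicalSpace X] {a b c : X → ℝ × ℝ}
    (ha : Continuous a) (hb : Continuous b) (hc : Continuous c) :
    Continuous fun t => cohKernel lP (a t) (b t) (c t) := by
  unfold cohKernel; fun_prop

theorem norm_cohKernel (z x y : ℝ × ℝ) :
    ‖cohKernel lP z x y‖ = 2 / (Real.pi * lP ^ 2) * planeGaussFun lP (y - x) := by
  have hpi := Real.pi_pos
  have := planeGaussFun_nonneg lP (y - x)
  rw [cohKernel, norm_mul, norm_wave, mul_one, Complex.norm_real, Real.norm_of_nonneg (by positivity)]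

theorem norm_cohKernel_le (z x y : ℝ × ℝ) : ‖cohKernel lP z x y‖ ≤ 2 / (Real.pi * lP ^ 2) := by
  have hpi := Real.pi_pos
  rw [norm_cohKernel]
  exact mul_le_of_le_one_right (by positivity) (planeGaussFun_le_one lP _)

theorem cohKernel_eq (z x y : ℝ × ℝ) : cohKernel lP z x y = (2 / (Real.pi * lP ^ 2) : ℂ) *
    Complex.exp ((-(((y.1 - x.1) ^ 2 + (y.2 - x.2) ^ 2 : ℂ)) + 2 * Complex.I *
      ((y.1 - x.1) * (x.2 - z.2) - (y.2 - x.2) * (x.1 - z.1))) / (lP : ℂ) ^ 2) := by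
  rw [cohKernel, planeGaussFun, wave]
  push_cast
  rw [mul_assoc, ← Complex.exp_add]
  congr 2
  simp only [Prod.fst_sub, Prod.snd_sub]
  push_cast
  ring

theorem conj_cohKernel (z x y : ℝ × ℝ) : conj (cohKernel lP z x y) = cohKernel lP z y x := by
  rw [cohKernel_eq, cohKernel_eq, map_mul, ← Complex.exp_conj]
  simp only [map_div₀, map_mul, map_sub, map_add, map_neg, map_pow, Complex.conj_ofReal, Complex.conj_I,
    map_ofNat]
  congr 2
  ring

/-- The kernel is that of a projection. -/
theorem integral_cohKernel_mul_cohKernel (hlP : 0 < lP) (z x y : ℝ × ℝ) :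
    ∫ w, cohKernel lP z x w * cohKernel lP z w y = cohKernel lP z x y := by
  have hl : (lP : ℂ) ≠ 0 := by exact_mod_cast hlP.ne'
  have hpi : (Real.pi : ℂ) ≠ 0 := by exact_mod_cast Real.pi_ne_zero
  -- In both coordinates of `w` the integral is a one-dimensional Gaussian.
  set b₁ : ℂ := 2 * (x.1 + y.1 + Complex.I * (x.2 - y.2)) / (lP : ℂ) ^ 2
  set b₂ : ℂ := 2 * (x.2 + y.2 + Complex.I * (y.1 - x.1)) / (lP : ℂ) ^ 2
  set c₀ : ℂ := (-((x.1 : ℂ) ^ 2 + x.2 ^ 2 + y.1 ^ 2 + y.2 ^ 2) + 2 * Complex.I *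
    (z.1 * (y.2 - x.2) - z.2 * (y.1 - x.1))) / (lP : ℂ) ^ 2 with hc₀
  have h1 : ∀ w : ℝ × ℝ, cohKernel lP z x w * cohKernel lP z w y =
      ((2 / (Real.pi * lP ^ 2) : ℂ) ^ 2 * Complex.exp c₀) *
      (Complex.exp (-(2 / (lP : ℂ) ^ 2) * (w.1 : ℂ) ^ 2 + b₁ * w.1 + 0) *
        Complex.exp (-(2 / (lP : ℂ) ^ 2) * (w.2 : ℂ) ^ 2 + b₂ * w.2 + 0)) := by
    intro w
    have h2 : ∀ (p a b c d e : ℂ), a + b = c + (d + e) → p * Complex.exp a * (p * Complex.exp b) =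
        p ^ 2 * Complex.exp c * (Complex.exp d * Complex.exp e) := by
      intro p a b c d e h
      have h3 : Complex.exp a * Complex.exp b = Complex.exp c * (Complex.exp d * Complex.exp e) := by
        rw [← Complex.exp_add, ← Complex.exp_add, ← Complex.exp_add, h]
      linear_combination p ^ 2 * h3
    rw [cohKernel_eq, cohKernel_eq]
    apply h2
    simp only [hc₀, b₁, b₂]
    field_simp
    ring
  have hre : (-(2 / (lP : ℂ) ^ 2)).re < 0 := by
    have : (-(2 / (lP : ℂ) ^ 2)) = ((-(2 / lP ^ 2) : ℝ) : ℂ) := by push_cast; rfl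
    rw [this, Complex.ofReal_re]
    have : 0 < 2 / lP ^ 2 := by positivity
    linarith
  simp_rw [h1]
  rw [integral_const_mul, Measure.volume_eq_prod, integral_prod_mul
    (fun s : ℝ => Complex.exp (-(2 / (lP : ℂ) ^ 2) * (s : ℂ) ^ 2 + b₁ * s + 0))
    (fun s : ℝ => Complex.exp (-(2 / (lP : ℂ) ^ 2) * (s : ℂ) ^ 2 + b₂ * s + 0)),
    integral_cexp_quadratic hre, integral_cexp_quadratic hre, cohKernel_eq]
  have h4 : ((Real.pi : ℂ) / - -(2 / (lP : ℂ) ^ 2)) ^ (1 / 2 : ℂ) *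
      ((Real.pi : ℂ) / - -(2 / (lP : ℂ) ^ 2)) ^ (1 / 2 : ℂ) = Real.pi * (lP : ℂ) ^ 2 / 2 := by
    rw [← Complex.cpow_add _ _ (by simp [hpi, hl])]
    norm_num
    field_simp
  have h5 : ∀ p q r a b c d : ℂ, q * q = r → a + b + c = d →
      p ^ 2 * Complex.exp a * (q * Complex.exp b * (q * Complex.exp c)) = p ^ 2 * r * Complex.exp d := by
    intro p q r a b c d h h'
    have h3 : Complex.exp a * Complex.exp b * Complex.exp c = Complex.exp d := by
      rw [← Complex.exp_add, ← Complex.exp_add, h']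
    rw [← h, ← h3]; ring
  rw [h5 _ _ _ _ _ _ ((-(((y.1 - x.1) ^ 2 + (y.2 - x.2) ^ 2 : ℂ)) + 2 * Complex.I *
      ((y.1 - x.1) * (x.2 - z.2) - (y.2 - x.2) * (x.1 - z.1))) / (lP : ℂ) ^ 2) h4]
  · congr 1
    field_simp
  · simp only [hc₀, b₁, b₂]
    field_simp
    ring_nf
    rw [Complex.I_sq]
    ring

section
variable {E : Type*} [NormedAddCommGroup E] [InnerProductSpace ℂ E]

/-- The projection on the coherent states at `z`. -/
noncomputable def cohProj (z : ℝ × ℝ) (Ψ : ℝ × ℝ → E) (x : ℝ × ℝ) : E :=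
  ∫ y, cohKernel lP z x y • Ψ y

/-- The projection as a superposition of twisted translations, which makes it comparable with
`moyal_eq`. -/
theorem cohProj_eq (z : ℝ × ℝ) (Ψ : ℝ × ℝ → E) (x : ℝ × ℝ) :
    cohProj lP z Ψ x = (1 / (2 * Real.pi * lP ^ 2) : ℂ) •
      ∫ k, (Complex.exp (-((1 / (4 * lP ^ 2) : ℝ) : ℂ) * ((k.1 : ℂ) ^ 2 + (k.2 : ℂ) ^ 2)) *
        wave lP k (x - z)) • Ψ (x + halfRot k) := by
  have h1 : ∀ k : ℝ × ℝ, (Complex.exp (-((1 / (4 * lP ^ 2) : ℝ) : ℂ) * ((k.1 : ℂ) ^ 2 + (k.2 : ℂ) ^ 2)) *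
        wave lP k (x - z)) • Ψ (x + halfRot k) =
      (fun v : ℝ × ℝ => (planeGaussFun lP v * wave lP (-2 * v.2, 2 * v.1) (x - z)) • Ψ (x + v))
        (halfRot k) := by
    intro k
    have h2 : ((-2 * (halfRot k).2, 2 * (halfRot k).1) : ℝ × ℝ) = k := by
      ext <;> simp [halfRot] <;> ring
    simp only [h2, planeGaussFun]
    push_cast
    congr 3
    simp only [halfRot]
    push_cast
    ring
  rw [integral_congr_ae (Eventually.of_forall h1), integral_comp_halfRot
    (fun v : ℝ × ℝ => (planeGaussFun lP v * wave lP (-2 * v.2, 2 * v.1) (x - z)) • Ψ (x + v)),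
    cohProj, ← integral_add_left_eq_self (μ := volume) _ x, ← Complex.coe_smul, smul_smul, ← integral_smul]
  refine integral_congr_ae (Eventually.of_forall fun v => ?_)
  simp only [cohKernel, Prod.fst_add, Prod.snd_add, add_sub_cancel_left, smul_smul]
  congr 1
  push_cast
  rw [← mul_assoc]
  congr 2
  ring

theorem integrable_cohKernel_smul (z x : ℝ × ℝ) {Ψ : ℝ × ℝ → E} (hΨ : Integrable Ψ) :
    Integrable fun y => cohKernel lP z x y • Ψ y :=
  hΨ.bdd_smul (2 / (Real.pi * lP ^ 2))
    (continuous_cohKernel lP continuous_const continuous_const continuous_id).aestronglyMeasurable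
    (Eventually.of_forall fun y => norm_cohKernel_le lP z x y)

theorem norm_cohProj_le (z x : ℝ × ℝ) {Ψ : ℝ × ℝ → E} (hΨ : Integrable Ψ) :
    ‖cohProj lP z Ψ x‖ ≤ 2 / (Real.pi * lP ^ 2) * ∫ y, ‖Ψ y‖ := by
  rw [← integral_const_mul]
  refine norm_integral_le_of_norm_le (hΨ.norm.const_mul _) (Eventually.of_forall fun y => ?_)
  rw [norm_smul]
  gcongr
  exact norm_cohKernel_le lP z x y

theorem continuous_cohProj {Ψ : ℝ × ℝ → E} (hΨ : Integrable Ψ) :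
    Continuous fun p : (ℝ × ℝ) × (ℝ × ℝ) => cohProj lP p.1 Ψ p.2 := by
  refine continuous_of_dominated (bound := fun y => 2 / (Real.pi * lP ^ 2) * ‖Ψ y‖)
    (fun p => (integrable_cohKernel_smul lP _ _ hΨ).aestronglyMeasurable)
    (fun p => Eventually.of_forall fun y => ?_) (hΨ.norm.const_mul _)
    (Eventually.of_forall fun y => ?_)
  · rw [norm_smul]
    gcongr
    exact norm_cohKernel_le lP _ _ y
  · exact (continuous_cohKernel lP continuous_fst continuous_snd continuous_const).smul continuous_const

theorem integrable_cohProj (hlP : 0 < lP) (z : ℝ × ℝ) {Ψ : ℝ × ℝ → E} (hΨ : Integrable Ψ) :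
    Integrable fun x => cohProj lP z Ψ x := by
  have h := Integrable.convolution_integrand (ContinuousLinearMap.lsmul ℝ ℝ).flip hΨ
    ((integrable_planeGaussFun lP hlP).const_mul (2 / (Real.pi * lP ^ 2)))
  refine Integrable.integral_prod_left (f := fun p : (ℝ × ℝ) × (ℝ × ℝ) => cohKernel lP z p.1 p.2 • Ψ p.2)
    (h.mono ?_ (Eventually.of_forall fun p => ?_))
  · have h1 : Continuous fun p : (ℝ × ℝ) × (ℝ × ℝ) => cohKernel lP z p.1 p.2 :=
      continuous_cohKernel lP continuous_const continuous_fst continuous_snd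
    exact h1.aestronglyMeasurable.smul hΨ.aestronglyMeasurable.comp_snd
  · have hpi := Real.pi_pos
    have h2 := planeGaussFun_nonneg lP (p.1 - p.2)
    rw [norm_smul, norm_cohKernel, ContinuousLinearMap.flip_apply, ContinuousLinearMap.lsmul_apply,
      norm_smul, planeGaussFun_sub_comm, Real.norm_of_nonneg (by positivity)]

theorem cohProj_cohProj [CompleteSpace E] (hlP : 0 < lP) (z x : ℝ × ℝ) {Ψ : ℝ × ℝ → E} (hΨ : Integrable Ψ) :
    cohProj lP z (cohProj lP z Ψ) x = cohProj lP z Ψ x := by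
  have hc : Continuous fun w => cohKernel lP z x w :=
    continuous_cohKernel lP continuous_const continuous_const continuous_id
  have hint : Integrable (Function.uncurry fun w y : ℝ × ℝ => cohKernel lP z x w • cohKernel lP z w y • Ψ y)
      (volume.prod volume) := by
    have hk : Integrable fun w => cohKernel lP z x w := by
      refine ((integrable_planeGaussFun lP hlP).comp_sub_right x).const_mul (2 / (Real.pi * lP ^ 2)) |>.mono'
        hc.aestronglyMeasurable (Eventually.of_forall fun w => ?_)
      rw [norm_cohKernel]
    have h0 := hk.smul_prod hΨ
    refine (h0.bdd_smul (2 / (Real.pi * lP ^ 2))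
      (continuous_cohKernel lP continuous_const continuous_fst continuous_snd).aestronglyMeasurable
      (Eventually.of_forall fun p => norm_cohKernel_le lP z p.1 p.2)).congr (Eventually.of_forall fun p => ?_)
    simp only [Function.uncurry, Pi.smul_apply', smul_smul, mul_comm]
  have h1 : ∀ w, cohKernel lP z x w • cohProj lP z Ψ w =
      ∫ y, cohKernel lP z x w • cohKernel lP z w y • Ψ y := by
    intro w; rw [integral_smul]; rfl
  rw [cohProj]
  simp_rw [h1]
  rw [integral_integral_swap hint, cohProj]
  refine integral_congr_ae (Eventually.of_forall fun y => ?_)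
  simp only [smul_smul]
  rw [integral_smul_const, integral_cohKernel_mul_cohKernel lP hlP]

/-- The operators `cohProj` are symmetric and idempotent. -/
theorem integral_inner_cohProj [CompleteSpace E] (hlP : 0 < lP) (z : ℝ × ℝ) {Φ Ψ : ℝ × ℝ → E} (hΦ : Integrable Φ)
    (hΨ : Integrable Ψ) :
    ∫ x, inner ℂ (Φ x) (cohProj lP z Ψ x) = ∫ x, inner ℂ (cohProj lP z Φ x) (cohProj lP z Ψ x) := by
  have hΘ := integrable_cohProj lP hlP z hΨ
  set Θ := cohProj lP z Ψ with hΘdef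
  have h1 : ∀ x, inner ℂ (Φ x) (Θ x) = ∫ y, cohKernel lP z x y * inner ℂ (Φ x) (Θ y) := by
    intro x
    rw [hΘdef, ← cohProj_cohProj lP hlP z x hΨ, ← hΘdef, cohProj,
      ← integral_inner (integrable_cohKernel_smul lP z x hΘ)]
    simp_rw [inner_smul_right]
  have h2 : ∀ y, inner ℂ (cohProj lP z Φ y) (Θ y) = ∫ x, cohKernel lP z x y * inner ℂ (Φ x) (Θ y) := by
    intro y
    rw [← inner_conj_symm, cohProj, ← integral_inner (integrable_cohKernel_smul lP z y hΦ), ← integral_conj]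
    refine integral_congr_ae (Eventually.of_forall fun x => ?_)
    simp only [inner_smul_right, map_mul, conj_cohKernel, inner_conj_symm]
  simp_rw [h1, h2]
  refine integral_integral_swap ?_
  have h0 := hΦ.norm.mul_prod hΘ.norm
  refine (h0.const_mul (2 / (Real.pi * lP ^ 2))).mono' ?_ (Eventually.of_forall fun p => ?_)
  · have hc : Continuous fun p : (ℝ × ℝ) × (ℝ × ℝ) => cohKernel lP z p.1 p.2 :=
      continuous_cohKernel lP continuous_const continuous_fst continuous_snd
    exact hc.aestronglyMeasurable.mul
      (hΦ.aestronglyMeasurable.comp_fst.inner hΘ.aestronglyMeasurable.comp_snd)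
  · simp only [Function.uncurry]
    rw [norm_mul]
    gcongr
    · exact norm_cohKernel_le lP z _ _
    · exact norm_inner_le_norm _ _

end

end Moyal

namespace Moyal

/-! ### Quantization of symbols by coherent states -/

variable (lP : ℝ)

section
variable {E : Type*} [NormedAddCommGroup E] [InnerProductSpace ℂ E]

/-- If `ĝ = exp(-|k|²/(4θ)) ĥ`, then Moyal multiplication by `g` is the superposition, with
weight `h`, of the coherent state projections. -/
theorem moyal_eq_integral_cohProj [CompleteSpace E] (hlP : 0 < lP) {g h : Alg}
    (hg : ∀ k : ℝ × ℝ, fourierHat lP g k =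
      Complex.exp (-((1 / (4 * lP ^ 2) : ℝ) : ℂ) * ((k.1 : ℂ) ^ 2 + (k.2 : ℂ) ^ 2)) * fourierHat lP h k)
    (Ψ : 𝓢(ℝ × ℝ, E)) (x : ℝ × ℝ) :
    moyal lP g Ψ x = (1 / (2 * Real.pi * lP ^ 2) : ℂ) • ∫ z, h z • cohProj lP z Ψ x := by
  set G : Alg := planeGauss (b := 1 / (4 * lP ^ 2)) (by positivity) with hG
  have hGx : ∀ k, Complex.exp (-((1 / (4 * lP ^ 2) : ℝ) : ℂ) * ((k.1 : ℂ) ^ 2 + (k.2 : ℂ) ^ 2)) = G k := by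
    intro k; rw [hG, planeGauss_apply]; push_cast; rfl
  set c : ℂ := 1 / (2 * Real.pi * lP ^ 2)
  have hint : Integrable (Function.uncurry fun k z : ℝ × ℝ =>
      (c ^ 2) • (h z * (G k * wave lP k (x - z))) • Ψ (x + halfRot k)) (volume.prod volume) := by
    have h0 := (G.integrable (μ := volume)).mul_prod (h.integrable (μ := volume))
    have hw : Continuous fun p : (ℝ × ℝ) × (ℝ × ℝ) => wave lP p.1 (x - p.2) := by fun_prop
    have h1 := h0.bdd_smul 1 hw.aestronglyMeasurable
      (Eventually.of_forall fun p => (norm_wave lP _ _).le)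
    have hΨ : Continuous fun p : (ℝ × ℝ) × (ℝ × ℝ) => Ψ (x + halfRot p.1) := by fun_prop
    have h2 := h1.smul_bdd (SchwartzMap.seminorm ℝ 0 0 Ψ) hΨ.aestronglyMeasurable
      (Eventually.of_forall fun p => SchwartzMap.norm_le_seminorm ℝ Ψ _)
    refine (h2.smul (c ^ 2)).congr (Eventually.of_forall fun p => ?_)
    simp only [Function.uncurry, Pi.smul_apply, Pi.smul_apply', smul_eq_mul, Pi.mul_apply]
    congr 2
    ring
  have h1 : ∀ k, (fourierHat lP g k * wave lP k x) • Ψ (x + halfRot k) =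
      ∫ z, (c ^ 2) • (h z * (G k * wave lP k (x - z))) • Ψ (x + halfRot k) := by
    intro k
    rw [integral_smul, integral_smul_const, hg, hGx, fourierHat, smul_smul]
    congr 1
    have h2 : ∀ z : ℝ × ℝ, h z * (G k * wave lP k (x - z)) = (G k * wave lP k x) * (h z *
      Complex.exp (-(Complex.I / (lP : ℂ) ^ 2) * ((k.1 : ℂ) * (z.1 : ℂ) + (k.2 : ℂ) * (z.2 : ℂ)))) := by
      intro z
      have h3 : wave lP k (x - z) = wave lP k x *
          Complex.exp (-(Complex.I / (lP : ℂ) ^ 2) * ((k.1 : ℂ) * (z.1 : ℂ) + (k.2 : ℂ) * (z.2 : ℂ))) := by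
        rw [wave, wave, ← Complex.exp_add]
        simp only [Prod.fst_sub, Prod.snd_sub]
        push_cast
        congr 1
        ring
      rw [h3]; ring
    simp_rw [h2]
    rw [integral_const_mul]
    ring
  rw [moyal_eq lP hlP.ne' g (Ψ.integrable (μ := volume)), integral_congr_ae (Eventually.of_forall h1),
    integral_integral_swap hint, ← integral_smul]
  refine integral_congr_ae (Eventually.of_forall fun z => ?_)
  simp only [cohProj_eq, hGx]
  rw [integral_smul, smul_comm (h z), smul_smul c c, ← pow_two]
  congr 1
  rw [← integral_smul]
  simp only [smul_smul]

theorem lintegral_enorm_sq (u : 𝓢(ℝ × ℝ, E)) :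
    ∫⁻ x, ‖u x‖ₑ ^ 2 = ENNReal.ofReal (∫ x, ‖u x‖ ^ 2) := by
  rw [ofReal_integral_eq_lintegral_ofReal]
  · refine lintegral_congr fun x => ?_
    rw [ENNReal.ofReal_pow (norm_nonneg _), ofReal_norm]
  · exact (u.memLp 2 volume).integrable_norm_pow (by norm_num)
  · exact Eventually.of_forall fun x => by positivity

/-- Plancherel's theorem in the position `z` of the coherent states. -/
theorem lintegral_cohProj_sq [CompleteSpace E] (hlP : 0 < lP) (Ψ : 𝓢(ℝ × ℝ, E)) (x : ℝ × ℝ) :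
    ∫⁻ z, ‖cohProj lP z Ψ x‖ₑ ^ 2 =
      ∫⁻ y, ENNReal.ofReal (4 * planeGaussFun lP (y - x) ^ 2) * ‖Ψ y‖ₑ ^ 2 := by
  have hpi := Real.pi_pos
  have hpiC : (Real.pi : ℂ) ≠ 0 := by exact_mod_cast hpi.ne'
  have hl : (lP : ℂ) ≠ 0 := by exact_mod_cast hlP.ne'
  set γ : Alg := shift (-x) (((2 / (Real.pi * lP ^ 2) : ℝ) : ℂ) • planeGauss (b := 1 / lP ^ 2) (by positivity))
  have hγ : ∀ y, γ y = ((2 / (Real.pi * lP ^ 2) * planeGaussFun lP (y - x) : ℝ) : ℂ) := by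
    intro y
    rw [shift_apply, _root_.smul_apply, planeGauss_apply, ← sub_eq_add_neg, smul_eq_mul, planeGaussFun]
    push_cast; rfl
  set G : 𝓢(ℝ × ℝ, E) := SchwartzMap.smulLeftCLM E γ Ψ with hG
  have hGx : ∀ y, G y = γ y • Ψ y := fun y =>
    SchwartzMap.smulLeftCLM_apply_apply (SchwartzMap.hasTemperateGrowth γ) Ψ y
  set G' : 𝓢(ℂ, E) := SchwartzMap.compCLMOfContinuousLinearEquiv ℂ Complex.equivRealProdCLM G
  set S : 𝓢(ℂ, E) := FourierTransform.fourier G' with hS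
  set L : (ℝ × ℝ) ≃L[ℝ] ℂ := Complex.equivRealProdCLM.symm.trans
    (ContinuousLinearEquiv.smulLeft (Units.mk0 ((Real.pi * lP ^ 2)⁻¹ : ℝ) (by positivity)))
  have hL : ∀ p, L p = ((Real.pi * lP ^ 2)⁻¹ : ℝ) • Complex.equivRealProdCLM.symm p := fun p => rfl
  set S' : 𝓢(ℝ × ℝ, E) := SchwartzMap.compCLMOfContinuousLinearEquiv ℂ L S
  have hS' : ∀ p, S' p = S (L p) := fun p => rfl
  have h1 : ∀ z, ‖cohProj lP z Ψ x‖ = ‖S' (rot (z - x))‖ := by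
    intro z
    have h2 : cohProj lP z Ψ x = wave lP (2 * x.2, -2 * x.1) (x - z) • S' (rot (z - x)) := by
      rw [hS', hS, SchwartzMap.fourier_coe, Real.fourier_eq', cohProj, ← integral_smul,
        ← Complex.volume_preserving_equiv_real_prod.integral_comp' (g := fun y => cohKernel lP z x y • Ψ y)]
      refine integral_congr_ae (Eventually.of_forall fun y => ?_)
      have h3 : G' y = γ (y.re, y.im) • Ψ (y.re, y.im) := hGx (y.re, y.im)
      have h4 : (inner ℝ y (L (rot (z - x))) : ℝ) =
          (Real.pi * lP ^ 2)⁻¹ * ((z.2 - x.2) * y.re - (z.1 - x.1) * y.im) := by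
        rw [hL, inner_smul_right]
        congr 1
        have h5 : Complex.equivRealProdCLM.symm (rot (z - x)) = ⟨z.2 - x.2, -(z.1 - x.1)⟩ := by
          rw [ContinuousLinearEquiv.symm_apply_eq]; rfl
        rw [h5, Complex.inner]
        simp
        ring
      simp only [Complex.measurableEquivRealProd_apply]
      rw [h3, h4, hγ, cohKernel, smul_smul, smul_smul, mul_comm]
      congr 1
      rw [← mul_assoc]
      congr 1
      rw [wave, wave, ← Complex.exp_add]
      congr 1
      simp only [Prod.fst_sub, Prod.snd_sub]
      push_cast
      field_simp
      ring
    rw [h2, norm_smul, norm_wave, one_mul]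
  have h2 : ∀ z, ‖cohProj lP z Ψ x‖ₑ = ‖S' (rot (z - x))‖ₑ := fun z => by
    rw [← ofReal_norm, h1, ofReal_norm]
  simp_rw [h2]
  rw [lintegral_sub_right_eq_self (μ := volume) (fun z => ‖S' (rot z)‖ₑ ^ 2) x,
    measurePreserving_rot.lintegral_comp_emb rot.measurableEmbedding (fun p => ‖S' p‖ₑ ^ 2),
    lintegral_enorm_sq]
  have h3 : ∫ p, ‖S' p‖ ^ 2 = (Real.pi * lP ^ 2) ^ 2 * ∫ y, ‖G y‖ ^ 2 := by
    rw [← Complex.volume_preserving_equiv_real_prod.integral_comp' (g := fun p => ‖S' p‖ ^ 2),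
      ← Complex.volume_preserving_equiv_real_prod.integral_comp' (g := fun p => ‖G p‖ ^ 2)]
    have h4 : ∀ y : ℂ, ‖S' (Complex.measurableEquivRealProd y)‖ ^ 2 =
        (fun w => ‖S w‖ ^ 2) ((Real.pi * lP ^ 2)⁻¹ • y) := by
      intro y
      rw [hS', hL]
      have : Complex.equivRealProdCLM.symm (Complex.measurableEquivRealProd y) = y :=
        Complex.equivRealProdCLM.symm_apply_apply y
      rw [this]
    simp_rw [h4]
    rw [Measure.integral_comp_smul volume (fun w => ‖S w‖ ^ 2), hS, SchwartzMap.integral_norm_sq_fourier, Complex.finrank_real_complex,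
      inv_pow, inv_inv, abs_of_pos (by positivity), smul_eq_mul]
    rfl
  rw [h3, ENNReal.ofReal_mul (by positivity), ← lintegral_enorm_sq,
    ← lintegral_const_mul _ (G.continuous.enorm.measurable.pow_const 2)]
  refine lintegral_congr fun y => ?_
  have h5 : ‖G y‖ₑ = ENNReal.ofReal (2 / (Real.pi * lP ^ 2) * planeGaussFun lP (y - x)) * ‖Ψ y‖ₑ := by
    have := planeGaussFun_nonneg lP (y - x)
    rw [hGx, hγ, enorm_smul]
    congr 1
    rw [← ofReal_norm, Complex.norm_real, Real.norm_of_nonneg (by positivity)]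
  have := planeGaussFun_nonneg lP (y - x)
  rw [h5, mul_pow (ENNReal.ofReal _), ← mul_assoc, ← ENNReal.ofReal_pow (by positivity), ← ENNReal.ofReal_mul (by positivity)]
  congr 2
  field_simp
  ring

/-- The resolution of the identity: `∫ ‖P_z Ψ‖² dz = 2πθ ‖Ψ‖²`. -/
theorem lintegral_lintegral_cohProj_sq [CompleteSpace E] (hlP : 0 < lP) (Ψ : 𝓢(ℝ × ℝ, E)) :
    ∫⁻ x, ∫⁻ z, ‖cohProj lP z Ψ x‖ₑ ^ 2 = ENNReal.ofReal (2 * Real.pi * lP ^ 2) * ∫⁻ y, ‖Ψ y‖ₑ ^ 2 := by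
  have hpi := Real.pi_pos
  have hc := continuous_planeGaussFun lP
  have hΨ := Ψ.continuous
  simp_rw [lintegral_cohProj_sq lP hlP]
  have h1 : Measurable fun p : (ℝ × ℝ) × (ℝ × ℝ) =>
      ENNReal.ofReal (4 * planeGaussFun lP (p.2 - p.1) ^ 2) * ‖Ψ p.2‖ₑ ^ 2 := by
    have hc1 : Continuous fun p : (ℝ × ℝ) × (ℝ × ℝ) => 4 * planeGaussFun lP (p.2 - p.1) ^ 2 := by fun_prop
    exact hc1.measurable.ennreal_ofReal.mul ((hΨ.comp continuous_snd).enorm.measurable.pow_const 2)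
  rw [lintegral_lintegral_swap h1.aemeasurable, ← lintegral_const_mul _ (hΨ.enorm.measurable.pow_const 2)]
  refine lintegral_congr fun y => ?_
  have hc2 : Continuous fun x => 4 * planeGaussFun lP (y - x) ^ 2 := by fun_prop
  rw [lintegral_mul_const _ hc2.measurable.ennreal_ofReal]
  congr 1
  rw [← ofReal_integral_eq_lintegral_ofReal, integral_const_mul, integral_planeGaussFun_sq lP hlP]
  · congr 1; ring
  · refine Integrable.const_mul ?_ _
    refine ((integrable_planeGaussFun lP hlP).comp_sub_left y).mono'
      (Continuous.aestronglyMeasurable (by fun_prop)) (Eventually.of_forall fun x => ?_)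
    have h2 := planeGaussFun_nonneg lP (y - x)
    have h3 := planeGaussFun_le_one lP (y - x)
    rw [Real.norm_of_nonneg (by positivity)]
    nlinarith
  · exact Eventually.of_forall fun x => by positivity

theorem eLpNorm_two_sq {X F : Type*} [MeasurableSpace X] {μ : Measure X} [NormedAddCommGroup F]
    (u : X → F) : eLpNorm u 2 μ ^ 2 = ∫⁻ x, ‖u x‖ₑ ^ 2 ∂μ := by
  have h := eLpNorm_nnreal_pow_eq_lintegral (f := u) (μ := μ) (p := 2) (by norm_num)
  simpa using h

/-- Cauchy–Schwarz in the superposition `moyal_eq_integral_cohProj`. -/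
theorem memLp_moyal [CompleteSpace E] (hlP : 0 < lP) {g h : Alg}
    (hg : ∀ k : ℝ × ℝ, fourierHat lP g k =
      Complex.exp (-((1 / (4 * lP ^ 2) : ℝ) : ℂ) * ((k.1 : ℂ) ^ 2 + (k.2 : ℂ) ^ 2)) * fourierHat lP h k)
    (Ψ : 𝓢(ℝ × ℝ, E)) : MemLp (moyal lP g Ψ) 2 volume := by
  refine ⟨(continuous_moyal lP hlP.ne' g Ψ).aestronglyMeasurable, ?_⟩
  have hcont := continuous_cohProj lP (Ψ.integrable (μ := volume))
  have h1 : ∀ x, ‖moyal lP g Ψ x‖ₑ ^ 2 ≤ (‖(1 / (2 * Real.pi * lP ^ 2) : ℂ)‖ₑ * eLpNorm h 2 volume) ^ 2 *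
      ∫⁻ z, ‖cohProj lP z Ψ x‖ₑ ^ 2 := by
    intro x
    rw [moyal_eq_integral_cohProj lP hlP hg, ← eLpNorm_two_sq, ← mul_pow, enorm_smul, mul_assoc ‖_‖ₑ]
    refine pow_le_pow_left' (mul_le_mul_right ?_ ‖_‖ₑ) 2
    exact enorm_integral_smul_le (Φ := fun z => cohProj lP z Ψ x) h.continuous.aestronglyMeasurable
      (hcont.comp (continuous_id.prodMk continuous_const)).aestronglyMeasurable
  have h2 : eLpNorm (moyal lP g Ψ) 2 volume ^ 2 < ⊤ := by
    rw [eLpNorm_two_sq]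
    refine (lintegral_mono h1).trans_lt ?_
    have hfin : (‖(1 / (2 * Real.pi * lP ^ 2) : ℂ)‖ₑ * eLpNorm h 2 volume) ^ 2 ≠ ⊤ :=
      ENNReal.pow_ne_top (ENNReal.mul_ne_top enorm_ne_top (h.memLp 2 volume).eLpNorm_ne_top)
    rw [lintegral_const_mul' _ _ hfin, lintegral_lintegral_cohProj_sq lP hlP, ← eLpNorm_two_sq]
    exact (ENNReal.mul_ne_top hfin (ENNReal.mul_ne_top ENNReal.ofReal_ne_top
      (ENNReal.pow_ne_top (Ψ.memLp 2 volume).eLpNorm_ne_top))).lt_top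
  exact (ENNReal.pow_lt_top_iff).1 h2 |>.resolve_right (by norm_num)

end

end Moyal

namespace Moyal

/-! ### Quantization by coherent states is contractive -/

variable (lP : ℝ)

section
variable {E ι : Type*} [NormedAddCommGroup E] [InnerProductSpace ℂ E] [Fintype ι]

theorem continuous_cohProj_comp {X : Type*} [TopologicalSpace X] {Ψ : ℝ × ℝ → E} (hΨ : Integrable Ψ)
    {a b : X → ℝ × ℝ} (ha : Continuous a) (hb : Continuous b) :
    Continuous fun t => cohProj lP (a t) Ψ (b t) := by
  have h := continuous_cohProj lP hΨ
  rw [continuous_iff_continuousAt] at h ⊢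
  exact fun t => (h (a t, b t)).comp₂ ha.continuousAt hb.continuousAt

/-- Cauchy–Schwarz on the product of the planes of `z` and `x`. -/
theorem lintegral_lintegral_cohProj_mul_le [CompleteSpace E] (hlP : 0 < lP) (Φ Ψ : 𝓢(ℝ × ℝ, E)) :
    ∫⁻ z, ∫⁻ x, ‖cohProj lP z Φ x‖ₑ * ‖cohProj lP z Ψ x‖ₑ ≤
      ENNReal.ofReal (2 * Real.pi * lP ^ 2) * (eLpNorm Φ 2 volume * eLpNorm Ψ 2 volume) := by
  have hm : ∀ Φ : 𝓢(ℝ × ℝ, E), Measurable fun p : (ℝ × ℝ) × (ℝ × ℝ) => ‖cohProj lP p.1 Φ p.2‖ₑ :=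
    fun Φ => (continuous_cohProj lP (Φ.integrable (μ := volume))).enorm.measurable
  have h1 : ∀ Φ : 𝓢(ℝ × ℝ, E), ∫⁻ p : (ℝ × ℝ) × (ℝ × ℝ), ‖cohProj lP p.1 Φ p.2‖ₑ ^ (2 : ℝ)
      ∂(volume.prod volume) = ENNReal.ofReal (2 * Real.pi * lP ^ 2) * eLpNorm Φ 2 volume ^ 2 := by
    intro Φ
    simp_rw [ENNReal.rpow_two]
    rw [lintegral_prod_symm _ ((hm Φ).pow_const 2).aemeasurable,
      lintegral_lintegral_cohProj_sq lP hlP, eLpNorm_two_sq]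
  have h2 := ENNReal.lintegral_mul_le_Lp_mul_Lq (volume.prod volume) Real.HolderConjugate.two_two
    (hm Φ).aemeasurable (hm Ψ).aemeasurable
  rw [h1, h1, ← ENNReal.mul_rpow_of_nonneg _ _ (by norm_num : (0 : ℝ) ≤ 1 / 2),
    lintegral_prod _ ((hm Φ).mul (hm Ψ)).aemeasurable] at h2
  refine h2.trans (le_of_eq ?_)
  rw [mul_mul_mul_comm, ← pow_two, ← mul_pow, ← mul_pow, ← ENNReal.rpow_natCast, ← ENNReal.rpow_mul]
  norm_num

theorem integral_inner_cohProj_swap (Φ Ψ : 𝓢(ℝ × ℝ, E)) {M : ℝ × ℝ → E →L[ℂ] E} (hMc : Continuous M)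
    (hMi : Integrable M) : ∫ x, ∫ z, inner ℂ (Φ x) (M z (cohProj lP z Ψ x)) =
      ∫ z, ∫ x, inner ℂ (Φ x) (M z (cohProj lP z Ψ x)) := by
  have hpi := Real.pi_pos
  have hΨi := Ψ.integrable (μ := volume)
  have h0 : Continuous fun p : (ℝ × ℝ) × (ℝ × ℝ) => cohProj lP p.2 Ψ p.1 :=
    continuous_cohProj_comp lP hΨi continuous_snd continuous_fst
  have h1 : Continuous fun p : (ℝ × ℝ) × (ℝ × ℝ) => M p.2 := hMc.comp continuous_snd
  have h2 : Continuous fun p : (ℝ × ℝ) × (ℝ × ℝ) => Φ p.1 := Φ.continuous.comp continuous_fst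
  have h4 : Continuous fun p : (ℝ × ℝ) × (ℝ × ℝ) => inner ℂ (Φ p.1) (M p.2 (cohProj lP p.2 Ψ p.1)) :=
    h2.inner (h1.clm_apply h0)
  refine integral_integral_swap ((((Φ.integrable (μ := volume)).norm.mul_prod hMi.norm).mul_const
    (2 / (Real.pi * lP ^ 2) * ∫ y, ‖Ψ y‖)).mono' h4.aestronglyMeasurable
    (Eventually.of_forall fun p => ?_))
  refine (norm_inner_le_norm _ _).trans ?_
  rw [mul_assoc]
  refine mul_le_mul_of_nonneg_left (((M p.2).le_opNorm _).trans ?_) (norm_nonneg _)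
  exact mul_le_mul_of_nonneg_left (norm_cohProj_le lP _ _ hΨi) (norm_nonneg _)

/-- If the symbols `h_l` satisfy `‖∑ h_l(z) C_l‖ ≤ 1` for all `z`, then the operator
`∑ C_l (g_l ⋆ ·)` is a contraction, in the weak sense: up to a constant it is the integral over `z`
of the compressions of the matrices `∑ h_l(z) C_l` by the projections `P_z`, which resolve the identity. -/
theorem enorm_integral_inner_antiWick_le [CompleteSpace E] (hlP : 0 < lP) (C : ι → E →L[ℂ] E) (g h : ι → Alg)
    (hg : ∀ l, ∀ k : ℝ × ℝ, fourierHat lP (g l) k =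
      Complex.exp (-((1 / (4 * lP ^ 2) : ℝ) : ℂ) * ((k.1 : ℂ) ^ 2 + (k.2 : ℂ) ^ 2)) * fourierHat lP (h l) k)
    (hM : ∀ z u, ‖∑ l, h l z • C l u‖ ≤ ‖u‖) (Φ Ψ : 𝓢(ℝ × ℝ, E)) :
    ‖∫ x, inner ℂ (Φ x) (∑ l, C l (moyal lP (g l) Ψ x))‖ₑ ≤
      eLpNorm Φ 2 volume * eLpNorm Ψ 2 volume := by
  have hpi := Real.pi_pos
  have hΦi := Φ.integrable (μ := volume)
  have hΨi := Ψ.integrable (μ := volume)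
  have hcont : ∀ x, Continuous fun z => cohProj lP z Ψ x := fun x =>
    continuous_cohProj_comp lP hΨi continuous_id continuous_const
  set M : ℝ × ℝ → E →L[ℂ] E := fun z => ∑ l, h l z • C l with hMdef
  have hMx : ∀ z u, M z u = ∑ l, h l z • C l u := fun z u => by
    simp [hMdef]
  have hMc : Continuous M := by
    have := fun l => (h l).continuous
    simp only [hMdef]; fun_prop
  have hMi : Integrable M := by
    refine integrable_finsetSum _ fun l _ => ?_
    exact ((h l).integrable (μ := volume)).smul_const _
  set c : ℂ := 1 / (2 * Real.pi * lP ^ 2) with hc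
  have hMB : ∀ x, Integrable fun z => M z (cohProj lP z Ψ x) := by
    intro x
    refine (hMi.norm.mul_const (2 / (Real.pi * lP ^ 2) * ∫ y, ‖Ψ y‖)).mono'
      (hMc.clm_apply (hcont x)).aestronglyMeasurable
      (Eventually.of_forall fun z => ((M z).le_opNorm _).trans ?_)
    gcongr
    exact norm_cohProj_le lP z x hΨi
  have h1 : ∀ x, ∑ l, C l (moyal lP (g l) Ψ x) = c • ∫ z, M z (cohProj lP z Ψ x) := by
    intro x
    have hi : ∀ l, Integrable fun z => h l z • cohProj lP z Ψ x := fun l =>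
      ((h l).integrable (μ := volume)).smul_bdd (2 / (Real.pi * lP ^ 2) * ∫ y, ‖Ψ y‖)
        (hcont x).aestronglyMeasurable
        (Eventually.of_forall fun z => norm_cohProj_le lP z x hΨi)
    simp_rw [hMx]
    rw [integral_finsetSum _ fun l _ => ?_, Finset.smul_sum]
    · refine Finset.sum_congr rfl fun l _ => ?_
      rw [moyal_eq_integral_cohProj lP hlP (hg l), map_smul, ← (C l).integral_comp_comm (hi l)]
      simp_rw [map_smul, hc]
    · have := (C l).integrable_comp (hi l)
      simpa using this
  have h2 : ∫ x, inner ℂ (Φ x) (∑ l, C l (moyal lP (g l) Ψ x)) =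
      c * ∫ z, ∫ x, inner ℂ (Φ x) (M z (cohProj lP z Ψ x)) := by
    have hin : ∀ x, inner ℂ (Φ x) (∑ l, C l (moyal lP (g l) Ψ x)) =
        c * ∫ z, inner ℂ (Φ x) (M z (cohProj lP z Ψ x)) := fun x => by
      rw [h1, inner_smul_right, integral_inner (hMB x)]
    simp_rw [hin]
    rw [integral_const_mul, integral_inner_cohProj_swap lP Φ Ψ hMc hMi]
  have h3 : ∀ z, ‖∫ x, inner ℂ (Φ x) (M z (cohProj lP z Ψ x))‖ₑ ≤
      ∫⁻ x, ‖cohProj lP z Φ x‖ₑ * ‖cohProj lP z Ψ x‖ₑ := by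
    intro z
    -- The matrix `M z` acts on the fibre and commutes with the projection.
    have h4 : ∀ x, M z (cohProj lP z Ψ x) = cohProj lP z (fun y => M z (Ψ y)) x := by
      intro x
      rw [cohProj, cohProj, ← (M z).integral_comp_comm (integrable_cohKernel_smul lP z x hΨi)]
      simp_rw [map_smul]
    have h5 : ∫ x, inner ℂ (Φ x) (M z (cohProj lP z Ψ x)) =
        ∫ x, inner ℂ (cohProj lP z Φ x) (M z (cohProj lP z Ψ x)) := by
      simp_rw [h4]
      exact integral_inner_cohProj lP hlP z hΦi ((M z).integrable_comp hΨi)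
    rw [h5]
    refine (enorm_integral_le_lintegral_enorm _).trans (lintegral_mono fun x => ?_)
    rw [← ofReal_norm, ← ofReal_norm, ← ofReal_norm, ← ENNReal.ofReal_mul (norm_nonneg _)]
    refine ENNReal.ofReal_le_ofReal ((norm_inner_le_norm _ _).trans ?_)
    gcongr
    rw [hMx]
    exact hM z _
  rw [h2, enorm_mul]
  have h6 : ‖c‖ₑ = ENNReal.ofReal (1 / (2 * Real.pi * lP ^ 2)) := by
    have : c = ((1 / (2 * Real.pi * lP ^ 2) : ℝ) : ℂ) := by rw [hc]; push_cast; rfl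
    rw [this, ← ofReal_norm, Complex.norm_real, Real.norm_of_nonneg (by positivity)]
  calc _ ≤ ‖c‖ₑ * ∫⁻ z, ∫⁻ x, ‖cohProj lP z Φ x‖ₑ * ‖cohProj lP z Ψ x‖ₑ := by
        gcongr
        exact (enorm_integral_le_lintegral_enorm _).trans (lintegral_mono h3)
    _ ≤ ‖c‖ₑ * (ENNReal.ofReal (2 * Real.pi * lP ^ 2) * (eLpNorm Φ 2 volume * eLpNorm Ψ 2 volume)) := by
        gcongr
        exact lintegral_lintegral_cohProj_mul_le lP hlP Φ Ψ
    _ = _ := by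
        rw [h6, ← mul_assoc, ← ENNReal.ofReal_mul (by positivity), one_div_mul_cancel (by positivity),
          ENNReal.ofReal_one, one_mul]

/-- A square-integrable function is bounded in norm by its pairings with Schwartz functions. -/
theorem eLpNorm_le_of_forall_inner_le {U : ℝ × ℝ → E} (hU : MemLp U 2 volume) {K : ℝ≥0∞} (hK : K ≠ ⊤)
    (h : ∀ Φ : 𝓢(ℝ × ℝ, E), ‖∫ x, inner ℂ (Φ x) (U x)‖ₑ ≤ eLpNorm Φ 2 volume * K) :
    eLpNorm U 2 volume ≤ K := by
  set u := hU.toLp U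
  have h1 : ∀ v : Lp E 2 (volume : Measure (ℝ × ℝ)), ‖inner ℂ v u‖ ≤ ‖v‖ * K.toReal := by
    intro v
    refine (SchwartzMap.denseRange_toLpCLM (E := ℝ × ℝ) (F := E) (p := 2) (μ := volume)
      ENNReal.ofNat_ne_top).induction_on (p := fun v => ‖inner ℂ v u‖ ≤ ‖v‖ * K.toReal) v ?_ fun Φ => ?_
    · exact isClosed_le (by fun_prop) (by fun_prop)
    · rw [SchwartzMap.toLpCLM_apply, SchwartzMap.norm_toLp, ← ENNReal.toReal_mul, L2.inner_def]
      have h2 : ∫ x, inner ℂ (Φ.toLp 2 volume x) (u x) = ∫ x, inner ℂ (Φ x) (U x) := by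
        refine integral_congr_ae ?_
        filter_upwards [Φ.coeFn_toLp 2 volume, hU.coeFn_toLp] with x hx hx'
        rw [hx, hx']
      rw [h2, ← toReal_enorm]
      exact ENNReal.toReal_mono (ENNReal.mul_ne_top (Φ.memLp 2 volume).eLpNorm_ne_top hK) (h Φ)
  have h2 := h1 u
  rw [inner_self_eq_norm_sq_to_K, norm_pow, RCLike.norm_ofReal, abs_norm, pow_two] at h2
  have h3 : ‖u‖ ≤ K.toReal := by
    rcases (norm_nonneg u).eq_or_lt with h0 | h0
    · rw [← h0]; exact ENNReal.toReal_nonneg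
    · exact le_of_mul_le_mul_left h2 h0
  rw [Lp.norm_toLp] at h3
  exact (ENNReal.toReal_le_toReal hU.eLpNorm_ne_top hK).1 h3

/-- Quantization by coherent states is contractive: if the symbols `h_l` satisfy
`‖∑ h_l(z) C_l‖ ≤ 1` for all `z`, then `∑ C_l (g_l ⋆ ·)` has norm at most `1`. -/
theorem opNorm_antiWick_le [CompleteSpace E] (hlP : 0 < lP) {T : (ℝ × ℝ → E) → (ℝ × ℝ → E)} (C : ι → E →L[ℂ] E)
    (g h : ι → Alg)
    (hT : ∀ (Ψ : 𝓢(ℝ × ℝ, E)) x, T Ψ x = ∑ l, C l (moyal lP (g l) Ψ x))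
    (hg : ∀ l, ∀ k : ℝ × ℝ, fourierHat lP (g l) k =
      Complex.exp (-((1 / (4 * lP ^ 2) : ℝ) : ℂ) * ((k.1 : ℂ) ^ 2 + (k.2 : ℂ) ^ 2)) * fourierHat lP (h l) k)
    (hM : ∀ z u, ‖∑ l, h l z • C l u‖ ≤ ‖u‖) : opNorm T ≤ 1 := by
  refine iSup₂_le fun Ψ hΨ => ?_
  have h1 : T Ψ = fun x => ∑ l, C l (moyal lP (g l) Ψ x) := funext (hT Ψ)
  rw [h1]
  refine (eLpNorm_le_of_forall_inner_le ?_ (Ψ.memLp 2 volume).eLpNorm_ne_top fun Φ =>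
    enorm_integral_inner_antiWick_le lP hlP C g h hg hM Φ Ψ).trans hΨ
  exact memLp_finsetSum _ fun l _ => (C l).comp_memLp' (memLp_moyal lP hlP (hg l) Ψ)

end

end Moyal

namespace Moyal
open scoped LineDeriv

/-! ### Husimi densities of the eigenstates -/

variable (lP : ℝ)

/-- The Bargmann transform turns `|m⟩` into the monomial of degree `m`, up to a Gaussian factor. -/
theorem bargmann_eigenfunction (hlP : 0 < lP) (m : ℕ) (q : ℂ) :
    bargmann lP (eigenfunction lP m) q = eigenConst lP m * ((lP / Real.sqrt 2 : ℝ) *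
      ((q / (Real.sqrt 2 * lP)) ^ m * (Real.sqrt (2 * Real.pi) * Complex.exp (q ^ 2 / (4 * (lP : ℂ) ^ 2))))) := by
  have hl : (lP : ℂ) ≠ 0 := by exact_mod_cast hlP.ne'
  have h2 : ((Real.sqrt 2 : ℝ) : ℂ) ^ 2 = 2 := by
    rw [← Complex.ofReal_pow, Real.sq_sqrt (by norm_num)]; norm_num
  have h20 : ((Real.sqrt 2 : ℝ) : ℂ) ≠ 0 := by
    intro h; rw [h] at h2; norm_num at h2
  have h := integral_hermite_mul_cexp m (q / (Real.sqrt 2 * lP))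
  have hs := Measure.integral_comp_mul_left (fun t : ℝ =>
    ((Polynomial.aeval t (Polynomial.hermite m) : ℝ) : ℂ) *
      Complex.exp (-(1 / 2 : ℝ) * (t : ℂ) ^ 2 + q / (Real.sqrt 2 * lP) * t)) (Real.sqrt 2 / lP)
  rw [h, abs_of_pos (by positivity), inv_div] at hs
  have h3 : (q / (Real.sqrt 2 * lP)) ^ 2 / 2 = q ^ 2 / (4 * (lP : ℂ) ^ 2) := by
    rw [div_pow, mul_pow, h2]; field_simp; norm_num
  rw [h3, Complex.real_smul] at hs
  rw [bargmann, ← hs, ← integral_const_mul]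
  refine integral_congr_ae (Eventually.of_forall fun y => ?_)
  simp only
  rw [eigenfunction_eq, mul_assoc, mul_assoc, ← Complex.exp_add]
  congr 3
  push_cast
  rw [mul_pow, div_pow, h2]
  field_simp
  ring

/-- The Husimi density `z ↦ |⟨z|m⟩|² / (2πθ)` of the eigenstate `|m⟩`. -/
noncomputable def husimi (m : ℕ) (z : ℝ × ℝ) : ℝ :=
  (2 * Real.pi * lP ^ 2)⁻¹ * (((z.1 ^ 2 + z.2 ^ 2) / (2 * lP ^ 2)) ^ m / m.factorial *
    Real.exp (-((z.1 ^ 2 + z.2 ^ 2) / (2 * lP ^ 2))))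

theorem husimi_nonneg (m : ℕ) (z : ℝ × ℝ) : 0 ≤ husimi lP m z := by
  have := Real.pi_pos
  unfold husimi; positivity

theorem husimi_neg (m : ℕ) (z : ℝ × ℝ) : husimi lP m (-z) = husimi lP m z := by
  simp [husimi]

@[fun_prop]
theorem continuous_husimi (m : ℕ) : Continuous (husimi lP m) := by
  unfold husimi; fun_prop

/-- The Husimi density is the Fourier transform of the matrix elements of Weyl operators, damped by
a Gaussian; it is the square of a value of the Bargmann transform of `|m⟩`. -/
theorem integral_gauss_mul_wave_mul_weylElem (hlP : 0 < lP) (m : ℕ) (w : ℝ × ℝ) :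
    ∫ k : ℝ × ℝ, Complex.exp (-((1 / (4 * lP ^ 2) : ℝ) : ℂ) * ((k.1 : ℂ) ^ 2 + (k.2 : ℂ) ^ 2)) *
      wave lP k w * weylElem lP (eigenS lP hlP m) (eigenS lP hlP m) k =
      (((2 * Real.pi * lP ^ 2) ^ 2 * husimi lP m w : ℝ) : ℂ) := by
  have hl : (lP : ℂ) ≠ 0 := by exact_mod_cast hlP.ne'
  have hpi := Real.pi_pos
  set q : ℂ := -w.1 + Complex.I * w.2 with hq
  set p : ℂ := -w.1 - Complex.I * w.2 with hp
  have hpq : conj p = q := by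
    rw [hp, hq]; simp
  have h1 : ∀ k : ℝ × ℝ, Complex.exp (-((1 / (4 * lP ^ 2) : ℝ) : ℂ) * ((k.1 : ℂ) ^ 2 + (k.2 : ℂ) ^ 2)) *
      wave lP k w = Complex.exp (gaussExponent lP p q k) := by
    intro k
    rw [wave, ← Complex.exp_add, gaussExponent, hp, hq]
    congr 2
    field_simp
    ring
  simp_rw [h1]
  rw [integral_gauss_mul_weylElem lP hlP, hpq, Complex.conj_mul', coe_eigenS, bargmann_eigenfunction lP hlP]
  have hn : ‖q‖ ^ 2 = w.1 ^ 2 + w.2 ^ 2 := by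
    rw [Complex.sq_norm, Complex.normSq_apply, hq]; simp; ring
  have he : ‖Complex.exp (q ^ 2 / (4 * (lP : ℂ) ^ 2))‖ = Real.exp ((w.1 ^ 2 - w.2 ^ 2) / (4 * lP ^ 2)) := by
    rw [Complex.norm_exp]
    congr 1
    have : q ^ 2 / (4 * (lP : ℂ) ^ 2) = (((w.1 ^ 2 - w.2 ^ 2) / (4 * lP ^ 2) : ℝ) : ℂ) +
        ((-2 * w.1 * w.2 / (4 * lP ^ 2) : ℝ) : ℂ) * Complex.I := by
      rw [hq]; push_cast; field_simp; ring_nf; rw [Complex.I_sq]; ring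
    rw [this, Complex.add_re, Complex.ofReal_re, Complex.re_ofReal_mul, Complex.I_re, mul_zero, add_zero]
  have hpq2 : -(p + q) ^ 2 / (4 * (lP : ℂ) ^ 2) = ((-(w.1 ^ 2 / lP ^ 2) : ℝ) : ℂ) := by
    rw [hp, hq]; push_cast; field_simp; ring
  have hqn : ‖q / (Real.sqrt 2 * lP)‖ ^ 2 = (w.1 ^ 2 + w.2 ^ 2) / (2 * lP ^ 2) := by
    rw [norm_div, div_pow, hn, norm_mul, mul_pow, Complex.norm_real, Complex.norm_real,
      Real.norm_eq_abs, Real.norm_eq_abs, sq_abs, sq_abs, Real.sq_sqrt (by norm_num)]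
  have hN : ‖(eigenConst lP m : ℂ) * ((lP / Real.sqrt 2 : ℝ) *
      ((q / (Real.sqrt 2 * lP)) ^ m * (Real.sqrt (2 * Real.pi) * Complex.exp (q ^ 2 / (4 * (lP : ℂ) ^ 2)))))‖ ^ 2 =
      (Real.sqrt (Real.pi * lP ^ 2))⁻¹ / m.factorial * (lP ^ 2 / 2 *
        (((w.1 ^ 2 + w.2 ^ 2) / (2 * lP ^ 2)) ^ m * (2 * Real.pi *
          Real.exp ((w.1 ^ 2 - w.2 ^ 2) / (2 * lP ^ 2))))) := by
    rw [norm_mul, norm_mul, norm_mul, norm_mul, norm_pow, he, mul_pow, mul_pow, mul_pow, mul_pow,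
      ← pow_mul, mul_comm m 2, pow_mul, hqn, Complex.norm_real, Complex.norm_real, Complex.norm_real,
      Real.norm_eq_abs, Real.norm_eq_abs, Real.norm_eq_abs, sq_abs, sq_abs, sq_abs,
      Real.sq_sqrt (by positivity), div_pow, Real.sq_sqrt (by norm_num), eigenConst, div_pow,
      Real.sq_sqrt (by positivity), ← Real.exp_nat_mul, pow_two (_ ^ (-(1 / 4) : ℝ)),
      rpow_quarter_sq (by positivity)]
    congr 5
    push_cast; field_simp; norm_num; ring
  rw [← Complex.ofReal_pow ‖(eigenConst lP m : ℂ) * _‖, hN, hpq2, ← Complex.ofReal_exp, ← Complex.ofReal_mul, ← Complex.ofReal_mul]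
  congr 1
  have h4 : Real.sqrt (4 * Real.pi * lP ^ 2) = 2 * Real.sqrt (Real.pi * lP ^ 2) := by
    rw [mul_assoc, Real.sqrt_mul (by norm_num), show (4 : ℝ) = 2 ^ 2 by norm_num,
      Real.sqrt_sq (by norm_num)]
  have h5 : Real.exp (-((w.1 ^ 2 + w.2 ^ 2) / (2 * lP ^ 2))) =
      Real.exp (-(w.1 ^ 2 / lP ^ 2)) * Real.exp ((w.1 ^ 2 - w.2 ^ 2) / (2 * lP ^ 2)) := by
    rw [← Real.exp_add]; congr 1; field_simp; ring
  have h6 : Real.sqrt (Real.pi * lP ^ 2) ≠ 0 := by positivity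
  rw [h4, husimi, h5]
  have h7 : (m.factorial : ℝ) ≠ 0 := by positivity
  generalize Real.exp (-(w.1 ^ 2 / lP ^ 2)) = A
  generalize Real.exp ((w.1 ^ 2 - w.2 ^ 2) / (2 * lP ^ 2)) = B
  generalize ((w.1 ^ 2 + w.2 ^ 2) / (2 * lP ^ 2)) ^ m = C
  generalize Real.sqrt (Real.pi * lP ^ 2) = D at *
  field_simp

/-- The diagonal matrix elements of the quantization of `h` by coherent states are the means of `h`
for the Husimi densities. -/
theorem matElem_antiWick (hlP : 0 < lP) (m : ℕ) {g h : Alg}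
    (hg : ∀ k : ℝ × ℝ, fourierHat lP g k =
      Complex.exp (-((1 / (4 * lP ^ 2) : ℝ) : ℂ) * ((k.1 : ℂ) ^ 2 + (k.2 : ℂ) ^ 2)) * fourierHat lP h k)
    (κ : ℝ × ℝ) :
    matElem lP hlP m m (shift κ g) = ∫ z, h (z + κ) * husimi lP m z := by
  have hpi := Real.pi_pos
  have hpiC : (Real.pi : ℂ) ≠ 0 := by exact_mod_cast hpi.ne'
  have hl : (lP : ℂ) ≠ 0 := by exact_mod_cast hlP.ne'
  set W := weylElem lP (eigenS lP hlP m) (eigenS lP hlP m) with hW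
  set G : Alg := planeGauss (b := 1 / (4 * lP ^ 2)) (by positivity) with hG
  have hGx : ∀ k, Complex.exp (-((1 / (4 * lP ^ 2) : ℝ) : ℂ) * ((k.1 : ℂ) ^ 2 + (k.2 : ℂ) ^ 2)) = G k := by
    intro k; rw [hG, planeGauss_apply]; push_cast; rfl
  set c : ℂ := 1 / (2 * Real.pi * lP ^ 2) with hc
  have hWc : Continuous W := continuous_weylElem lP _ _
  have hint : Integrable (Function.uncurry fun k z : ℝ × ℝ =>
      c ^ 2 * h z * (G k * wave lP k (κ - z) * W k)) (volume.prod volume) := by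
    have h0 := (G.integrable (μ := volume)).mul_prod (h.integrable (μ := volume))
    have hw : Continuous fun p : (ℝ × ℝ) × (ℝ × ℝ) => wave lP p.1 (κ - p.2) * W p.1 := by fun_prop
    have h1 := h0.bdd_mul (c := (∫ x, ‖eigenS lP hlP m x‖) * SchwartzMap.seminorm ℝ 0 0 (eigenS lP hlP m))
      hw.aestronglyMeasurable (Eventually.of_forall fun p => by
        rw [norm_mul, norm_wave, one_mul]; exact norm_weylElem_le lP _ _ _)
    refine (h1.const_mul (c ^ 2)).congr (Eventually.of_forall fun p => ?_)
    simp only [Function.uncurry]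
    ring
  rw [matElem_shift]
  have h1 : ∀ k, wave lP k κ * (fourierHat lP g k * W k) =
      ∫ z, c ^ 2 * h z * (G k * wave lP k (κ - z) * W k) := by
    intro k
    rw [hg, hGx, fourierHat]
    have h2 : ∀ z : ℝ × ℝ, c ^ 2 * h z * (G k * wave lP k (κ - z) * W k) =
        (c ^ 2 * wave lP k κ * G k * W k) * (h z *
      Complex.exp (-(Complex.I / (lP : ℂ) ^ 2) * ((k.1 : ℂ) * (z.1 : ℂ) + (k.2 : ℂ) * (z.2 : ℂ)))) := by
      intro z
      have h3 : wave lP k (κ - z) = wave lP k κ *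
          Complex.exp (-(Complex.I / (lP : ℂ) ^ 2) * ((k.1 : ℂ) * (z.1 : ℂ) + (k.2 : ℂ) * (z.2 : ℂ))) := by
        rw [wave, wave, ← Complex.exp_add]
        simp only [Prod.fst_sub, Prod.snd_sub]
        push_cast
        congr 1
        ring
      rw [h3]; ring
    simp_rw [h2]
    rw [integral_const_mul]
    ring
  rw [integral_congr_ae (Eventually.of_forall h1), integral_integral_swap hint]
  have h3 : ∀ z, ∫ k, c ^ 2 * h z * (G k * wave lP k (κ - z) * W k) = h z * husimi lP m (z - κ) := by
    intro z
    rw [integral_const_mul]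
    simp_rw [← hGx]
    rw [integral_gauss_mul_wave_mul_weylElem lP hlP m (κ - z), ← neg_sub z κ, husimi_neg, hc]
    push_cast
    field_simp
  simp_rw [h3]
  rw [← integral_add_right_eq_self (μ := volume) _ κ]
  simp

/-- Every Schwartz function `h` is the coherent-state symbol of some `g`. -/
theorem exists_antiWick (hlP : 0 < lP) (h : Alg) : ∃ g : Alg, ∀ k : ℝ × ℝ, fourierHat lP g k =
    Complex.exp (-((1 / (4 * lP ^ 2) : ℝ) : ℂ) * ((k.1 : ℂ) ^ 2 + (k.2 : ℂ) ^ 2)) * fourierHat lP h k := by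
  set G : Alg := planeGauss (b := 1 / (4 * lP ^ 2)) (by positivity) with hG
  have hGx : ∀ k, Complex.exp (-((1 / (4 * lP ^ 2) : ℝ) : ℂ) * ((k.1 : ℂ) ^ 2 + (k.2 : ℂ) ^ 2)) = G k := by
    intro k; rw [hG, planeGauss_apply]; push_cast; rfl
  obtain ⟨g, hg⟩ := exists_fourierHat_eq lP hlP.ne' (SchwartzMap.smulLeftCLM ℂ G (hatS lP hlP.ne' h))
  refine ⟨g, fun k => ?_⟩
  rw [hg, SchwartzMap.smulLeftCLM_apply_apply (SchwartzMap.hasTemperateGrowth G), hatS_apply, hGx, smul_eq_mul]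

theorem fourierHat_antiWick_lineDeriv (hlP : lP ≠ 0) {g h : Alg}
    (hg : ∀ k : ℝ × ℝ, fourierHat lP g k =
      Complex.exp (-((1 / (4 * lP ^ 2) : ℝ) : ℂ) * ((k.1 : ℂ) ^ 2 + (k.2 : ℂ) ^ 2)) * fourierHat lP h k)
    (v k : ℝ × ℝ) : fourierHat lP (∂_{v} g : Alg) k =
      Complex.exp (-((1 / (4 * lP ^ 2) : ℝ) : ℂ) * ((k.1 : ℂ) ^ 2 + (k.2 : ℂ) ^ 2)) *
        fourierHat lP (∂_{v} h : Alg) k := by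
  rw [fourierHat_lineDeriv lP hlP, fourierHat_lineDeriv lP hlP, hg]
  ring

/-- The lower bound for the spectral distance of the plane given by a symbol `h` with gradient
of norm at most `1`. -/
theorem le_distD (hlP : 0 < lP) (m n : ℕ) (κ κ' : ℂ) (h : Alg)
    (hh : ∀ z u, ‖clifford ((∂_{((1, 0) : ℝ × ℝ)} h : Alg) z) ((∂_{((0, 1) : ℝ × ℝ)} h : Alg) z) u‖ ≤ ‖u‖) :
    ‖(∫ z, h (z + (κ.re, κ.im)) * husimi lP m z) - ∫ z, h (z + (κ'.re, κ'.im)) * husimi lP n z‖ₑ ≤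
      distD lP (translate κ (eigenstate lP m)) (translate κ' (eigenstate lP n)) := by
  obtain ⟨g, hg⟩ := exists_antiWick lP hlP h
  have h1 : opNorm (commutator dirac (rep lP g)) ≤ 1 := by
    refine opNorm_antiWick_le (ι := Fin 2) lP hlP ![clifford 1 0, clifford 0 1]
      ![(∂_{((1, 0) : ℝ × ℝ)} g : Alg), (∂_{((0, 1) : ℝ × ℝ)} g : Alg)]
      ![(∂_{((1, 0) : ℝ × ℝ)} h : Alg), (∂_{((0, 1) : ℝ × ℝ)} h : Alg)] ?_ ?_ ?_
    · intro Ψ x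
      rw [commutator_dirac lP hlP.ne', Fin.sum_univ_two]
      rfl
    · intro l k
      fin_cases l
      · exact fourierHat_antiWick_lineDeriv lP hlP.ne' hg _ k
      · exact fourierHat_antiWick_lineDeriv lP hlP.ne' hg _ k
    · intro z u
      have := hh z u
      rw [← smul_clifford_add] at this
      simpa [Fin.sum_univ_two] using this
  rw [← matElem_antiWick lP hlP m hg, ← matElem_antiWick lP hlP n hg, ← eigenstate_eq, ← eigenstate_eq]
  exact le_iSup₂ (f := fun (a : Alg) (_ : opNorm (commutator dirac (rep lP a)) ≤ 1) =>
    ‖translate κ (eigenstate lP m) a - translate κ' (eigenstate lP n) a‖ₑ) g h1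

/-- The lower bound for the spectral distance of the two-sheet model given by a pair of symbols. -/
theorem le_distD' (hlP : 0 < lP) (Λ : ℂ) (m n : ℕ) (κ κ' : ℂ) (h : Fin 2 → Alg)
    (hh : ∀ z u, ‖∑ i, cliffordOn i ((∂_{((1, 0) : ℝ × ℝ)} (h i) : Alg) z)
      ((∂_{((0, 1) : ℝ × ℝ)} (h i) : Alg) z) u + (h 1 z - h 0 z) • internalComm Λ u‖ ≤ ‖u‖) :
    ‖(∫ z, h 0 (z + (κ.re, κ.im)) * husimi lP m z) - ∫ z, h 1 (z + (κ'.re, κ'.im)) * husimi lP n z‖ₑ ≤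
      distD' lP Λ (onSheet (translate κ (eigenstate lP m)) 0) (onSheet (translate κ' (eigenstate lP n)) 1) := by
  have hex := fun i => exists_antiWick lP hlP (h i)
  choose g hg using hex
  have h1 : opNorm (commutator (dirac' Λ) (rep' lP g)) ≤ 1 := by
    refine opNorm_antiWick_le (ι := Fin 5) lP hlP
      ![cliffordOn 0 1 0, cliffordOn 0 0 1, cliffordOn 1 1 0, cliffordOn 1 0 1, internalComm Λ]
      ![(∂_{((1, 0) : ℝ × ℝ)} (g 0) : Alg), (∂_{((0, 1) : ℝ × ℝ)} (g 0) : Alg),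
        (∂_{((1, 0) : ℝ × ℝ)} (g 1) : Alg), (∂_{((0, 1) : ℝ × ℝ)} (g 1) : Alg), g 1 - g 0]
      ![(∂_{((1, 0) : ℝ × ℝ)} (h 0) : Alg), (∂_{((0, 1) : ℝ × ℝ)} (h 0) : Alg),
        (∂_{((1, 0) : ℝ × ℝ)} (h 1) : Alg), (∂_{((0, 1) : ℝ × ℝ)} (h 1) : Alg), h 1 - h 0] ?_ ?_ ?_
    · intro Ψ x
      rw [commutator_dirac' lP hlP.ne', Fin.sum_univ_five, Fin.sum_univ_two]
      simp only [← add_assoc]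
      rfl
    · intro l k
      fin_cases l
      · exact fourierHat_antiWick_lineDeriv lP hlP.ne' (hg 0) _ k
      · exact fourierHat_antiWick_lineDeriv lP hlP.ne' (hg 0) _ k
      · exact fourierHat_antiWick_lineDeriv lP hlP.ne' (hg 1) _ k
      · exact fourierHat_antiWick_lineDeriv lP hlP.ne' (hg 1) _ k
      · have hsub : ∀ a b : Alg, fourierHat lP (⇑(a - b)) k = fourierHat lP a k - fourierHat lP b k := by
          intro a b
          rw [sub_eq_add_neg, ← neg_one_smul ℂ b, fourierHat_add lP hlP.ne', fourierHat_smul lP hlP.ne']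
          ring
        change fourierHat lP (⇑(g 1 - g 0)) k = _ * fourierHat lP (⇑(h 1 - h 0)) k
        rw [hsub, hsub, hg, hg]
        ring
    · intro z u
      have := hh z u
      rw [Fin.sum_univ_two, ← smul_cliffordOn_add 0, ← smul_cliffordOn_add 1] at this
      rw [Fin.sum_univ_five]
      simp only [← add_assoc] at this ⊢
      exact this
  rw [← matElem_antiWick lP hlP m (hg 0), ← matElem_antiWick lP hlP n (hg 1), ← eigenstate_eq, ← eigenstate_eq]
  exact le_iSup₂ (f := fun (a : Fin 2 → Alg) (_ : opNorm (commutator (dirac' Λ) (rep' lP a)) ≤ 1) =>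
    ‖onSheet (translate κ (eigenstate lP m)) 0 a - onSheet (translate κ' (eigenstate lP n)) 1 a‖ₑ) g h1

end Moyal

namespace Moyal
open scoped LineDeriv

/-! ### Test functions for the lower bounds -/

theorem norm_clifford_sq (c d : ℝ) (u : Spin) : ‖clifford c d u‖ ^ 2 = (c ^ 2 + d ^ 2) * ‖u‖ ^ 2 := by
  rw [EuclideanSpace.norm_sq_eq, EuclideanSpace.norm_sq_eq, clifford_apply]
  simp only [Fin.sum_univ_two, Complex.sq_norm, Complex.normSq_apply]
  simp
  ring

/-- The cross terms between Clifford multiplication and the internal part cancel. -/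
theorem norm_cliffordOn_add_internalComm_sq (c d b : ℝ) (Λ : ℂ) (u : Spin') :
    ‖∑ i, cliffordOn i c d u + (b : ℂ) • internalComm Λ u‖ ^ 2 =
      (c ^ 2 + d ^ 2 + ‖Λ‖ ^ 2 * b ^ 2) * ‖u‖ ^ 2 := by
  rw [EuclideanSpace.norm_sq_eq, EuclideanSpace.norm_sq_eq, Fintype.sum_prod_type, Fintype.sum_prod_type]
  simp only [Fin.sum_univ_two, Complex.sq_norm, Complex.normSq_apply, PiLp.add_apply, PiLp.smul_apply,
    cliffordOn_apply, inclCLM_apply, clifford_apply, sheetCLM_apply, internalComm_apply, grading]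
  simp
  ring

theorem norm_cliffordOn_sq_le (i : Fin 2) (c d : ℝ) (u : Spin') :
    ‖cliffordOn i c d u‖ ^ 2 ≤ (c ^ 2 + d ^ 2) * ‖u‖ ^ 2 := by
  rw [EuclideanSpace.norm_sq_eq, EuclideanSpace.norm_sq_eq, Fintype.sum_prod_type, Fintype.sum_prod_type]
  have h : ∀ s, ‖u (0, s)‖ ^ 2 + ‖u (1, s)‖ ^ 2 ≤ ∑ x, ‖u (0, x)‖ ^ 2 + ∑ x, ‖u (1, x)‖ ^ 2 := by
    intro s
    rw [Fin.sum_univ_two, Fin.sum_univ_two]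
    fin_cases s <;> simp <;> nlinarith [sq_nonneg ‖u (0, 0)‖, sq_nonneg ‖u (0, 1)‖,
      sq_nonneg ‖u (1, 0)‖, sq_nonneg ‖u (1, 1)‖]
  rw [Fin.sum_univ_two (f := fun x => ∑ y, ‖u (x, y)‖ ^ 2)]
  refine le_trans (le_of_eq ?_) (mul_le_mul_of_nonneg_left (h i) (by positivity))
  fin_cases i <;>
  · simp only [Fin.sum_univ_two, Complex.sq_norm, Complex.normSq_apply,
      cliffordOn_apply, inclCLM_apply, clifford_apply, sheetCLM_apply]
    simp
    ring

theorem lineDeriv_ofReal {h : Alg} {φ : ℝ × ℝ → ℝ} {φ' : ℝ × ℝ →L[ℝ] ℝ} {x : ℝ × ℝ}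
    (hφ : ∀ x, h x = φ x) (hd : HasFDerivAt φ φ' x) (v : ℝ × ℝ) : (∂_{v} h : Alg) x = φ' v := by
  rw [SchwartzMap.lineDerivOp_apply_eq_fderiv]
  have h1 : ⇑h = fun x => (φ x : ℂ) := funext hφ
  have h2 : HasFDerivAt h (Complex.ofRealCLM ∘L φ') x := by
    rw [h1]; exact Complex.ofRealCLM.hasFDerivAt.comp x hd
  rw [h2.fderiv]
  rfl

variable (lP : ℝ)

theorem integral_ofReal_mul_husimi {h : Alg} {φ : ℝ × ℝ → ℝ} (hφ : ∀ x, h x = φ x) (m : ℕ) (κ : ℝ × ℝ) :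
    ∫ z, h (z + κ) * husimi lP m z = ((∫ z, φ (z + κ) * husimi lP m z : ℝ) : ℂ) := by
  rw [← integral_complex_ofReal]
  simp [hφ]

/-- A real test function whose gradient has length at most `1` gives a lower bound of the distance. -/
theorem le_distD_of_real (hlP : 0 < lP) (m n : ℕ) (κ κ' : ℂ) {h : Alg} {φ : ℝ × ℝ → ℝ}
    {φ' : ℝ × ℝ → ℝ × ℝ →L[ℝ] ℝ} (hφ : ∀ x, h x = φ x) (hd : ∀ x, HasFDerivAt φ (φ' x) x)
    (hle : ∀ x, φ' x (1, 0) ^ 2 + φ' x (0, 1) ^ 2 ≤ 1) :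
    ENNReal.ofReal ((∫ z, φ (z + (κ.re, κ.im)) * husimi lP m z) -
      ∫ z, φ (z + (κ'.re, κ'.im)) * husimi lP n z) ≤
      distD lP (translate κ (eigenstate lP m)) (translate κ' (eigenstate lP n)) := by
  refine le_trans ?_ (le_distD lP hlP m n κ κ' h fun z u => ?_)
  · rw [integral_ofReal_mul_husimi lP hφ, integral_ofReal_mul_husimi lP hφ, ← Complex.ofReal_sub,
      ← ofReal_norm, Complex.norm_real]
    exact ENNReal.ofReal_le_ofReal (le_abs_self _)
  · rw [lineDeriv_ofReal hφ (hd z), lineDeriv_ofReal hφ (hd z)]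
    refine le_of_sq_le_sq ?_ (norm_nonneg _)
    rw [norm_clifford_sq]
    exact mul_le_of_le_one_left (by positivity) (hle z)

/-- Lower bound in the two-sheet model by real test functions `φ` on the first sheet and `φ + ψ` on the
second. For `ψ` without gradient the matrix symbol has norm `(|∇φ|² + |Λ|² ψ²)^{1/2}`; a gradient of
`ψ` of length at most `δ` is compensated by the factor `1 / (1 + δ)`. -/
theorem le_distD'_of_real (hlP : 0 < lP) (Λ : ℂ) (m n : ℕ) (κ κ' : ℂ) {h b : Alg} {φ ψ : ℝ × ℝ → ℝ}
    {φ' ψ' : ℝ × ℝ → ℝ × ℝ →L[ℝ] ℝ} (hφ : ∀ x, h x = φ x) (hψ : ∀ x, b x = ψ x)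
    (hd : ∀ x, HasFDerivAt φ (φ' x) x) (hdψ : ∀ x, HasFDerivAt ψ (ψ' x) x) {δ : ℝ} (hδ : 0 ≤ δ)
    (hle : ∀ x, φ' x (1, 0) ^ 2 + φ' x (0, 1) ^ 2 + ‖Λ‖ ^ 2 * ψ x ^ 2 ≤ 1)
    (hleψ : ∀ x, ψ' x (1, 0) ^ 2 + ψ' x (0, 1) ^ 2 ≤ δ ^ 2) :
    ENNReal.ofReal (1 / (1 + δ) * ((∫ z, φ (z + (κ.re, κ.im)) * husimi lP m z) -
      ∫ z, (φ (z + (κ'.re, κ'.im)) + ψ (z + (κ'.re, κ'.im))) * husimi lP n z)) ≤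
      distD' lP Λ (onSheet (translate κ (eigenstate lP m)) 0)
        (onSheet (translate κ' (eigenstate lP n)) 1) := by
  set a : ℝ := 1 / (1 + δ) with ha
  have ha0 : 0 ≤ a := by positivity
  have hφa : ∀ x, ((a : ℂ) • h : Alg) x = (a * φ x : ℝ) := fun x => by
    rw [_root_.smul_apply, hφ, smul_eq_mul, Complex.ofReal_mul]
  have hφψa : ∀ x, ((a : ℂ) • (h + b) : Alg) x = (a * (φ x + ψ x) : ℝ) := fun x => by
    rw [_root_.smul_apply, _root_.add_apply, hφ, hψ, smul_eq_mul, Complex.ofReal_mul, Complex.ofReal_add]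
  refine le_trans ?_ (le_distD' lP hlP Λ m n κ κ' ![(a : ℂ) • h, (a : ℂ) • (h + b)] fun z u => ?_)
  · change _ ≤ ‖(∫ z, ((a : ℂ) • h : Alg) (z + (κ.re, κ.im)) * husimi lP m z) -
      ∫ z, ((a : ℂ) • (h + b) : Alg) (z + (κ'.re, κ'.im)) * husimi lP n z‖ₑ
    rw [integral_ofReal_mul_husimi lP hφa, integral_ofReal_mul_husimi lP hφψa, ← Complex.ofReal_sub,
      ← ofReal_norm, Complex.norm_real]
    simp_rw [mul_assoc]
    rw [integral_const_mul, integral_const_mul, ← mul_sub]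
    exact ENNReal.ofReal_le_ofReal (le_abs_self _)
  · have h1 : ∀ v, (∂_{v} ((a : ℂ) • h : Alg) : Alg) z = (a * φ' z v : ℝ) := fun v =>
      lineDeriv_ofReal hφa ((hd z).const_mul a) v
    have h2 : ∀ v, (∂_{v} ((a : ℂ) • (h + b) : Alg) : Alg) z = (a * (φ' z v + ψ' z v) : ℝ) := fun v =>
      lineDeriv_ofReal hφψa (((hd z).add (hdψ z)).const_mul a) v
    have h3 : ∀ (i : Fin 2) (c d c' d' : ℝ), cliffordOn i ((a * (c + c') : ℝ) : ℂ) ((a * (d + d') : ℝ) : ℂ) u =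
        (a : ℂ) • (cliffordOn i c d u + cliffordOn i c' d' u) := by
      intro i c d c' d'
      rw [← smul_cliffordOn_add i ((a * (c + c') : ℝ) : ℂ), ← smul_cliffordOn_add i (c : ℂ),
        ← smul_cliffordOn_add i (c' : ℂ)]
      push_cast
      module
    have h4 : ∀ (i : Fin 2) (c d : ℝ), cliffordOn i ((a * c : ℝ) : ℂ) ((a * d : ℝ) : ℂ) u =
        (a : ℂ) • (cliffordOn i c d u) := by
      intro i c d
      rw [← smul_cliffordOn_add i ((a * c : ℝ) : ℂ), ← smul_cliffordOn_add i (c : ℂ)]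
      push_cast
      module
    rw [Fin.sum_univ_two]
    change ‖cliffordOn 0 ((∂_{((1, 0) : ℝ × ℝ)} ((a : ℂ) • h : Alg) : Alg) z)
        ((∂_{((0, 1) : ℝ × ℝ)} ((a : ℂ) • h : Alg) : Alg) z) u +
      cliffordOn 1 ((∂_{((1, 0) : ℝ × ℝ)} ((a : ℂ) • (h + b) : Alg) : Alg) z)
        ((∂_{((0, 1) : ℝ × ℝ)} ((a : ℂ) • (h + b) : Alg) : Alg) z) u +
      (((a : ℂ) • (h + b) : Alg) z - ((a : ℂ) • h : Alg) z) • internalComm Λ u‖ ≤ ‖u‖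
    rw [h1, h1, h2, h2, h3, h4, hφa, hφψa]
    have h5 : (a : ℂ) • cliffordOn 0 (φ' z (1, 0)) (φ' z (0, 1)) u +
        (a : ℂ) • (cliffordOn 1 (φ' z (1, 0)) (φ' z (0, 1)) u + cliffordOn 1 (ψ' z (1, 0)) (ψ' z (0, 1)) u) +
        (((a * (φ z + ψ z) : ℝ) : ℂ) - ((a * φ z : ℝ) : ℂ)) • internalComm Λ u =
        (a : ℂ) • ((∑ i, cliffordOn i (φ' z (1, 0)) (φ' z (0, 1)) u + (ψ z : ℂ) • internalComm Λ u) +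
          cliffordOn 1 (ψ' z (1, 0)) (ψ' z (0, 1)) u) := by
      rw [Fin.sum_univ_two]
      push_cast
      module
    rw [h5, norm_smul, Complex.norm_real, Real.norm_of_nonneg ha0]
    have h6 : ‖∑ i, cliffordOn i (φ' z (1, 0)) (φ' z (0, 1)) u + (ψ z : ℂ) • internalComm Λ u‖ ≤ ‖u‖ := by
      refine le_of_sq_le_sq ?_ (norm_nonneg _)
      rw [norm_cliffordOn_add_internalComm_sq]
      exact mul_le_of_le_one_left (by positivity) (hle z)
    have h7 : ‖cliffordOn 1 (ψ' z (1, 0)) (ψ' z (0, 1)) u‖ ≤ δ * ‖u‖ := by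
      refine le_of_sq_le_sq ((norm_cliffordOn_sq_le _ _ _ _).trans ?_) (by positivity)
      rw [mul_pow]
      gcongr
      exact hleψ z
    calc _ ≤ a * (‖u‖ + δ * ‖u‖) := by
          gcongr
          exact (norm_add_le _ _).trans (add_le_add h6 h7)
      _ = ‖u‖ := by rw [ha]; field_simp

end Moyal

namespace Moyal

/-! ### Moments of the Husimi densities and damped test functions -/

variable (lP : ℝ)

theorem integral_pow_mul_husimi (hlP : 0 < lP) (j m : ℕ) :
    ∫ z : ℝ × ℝ, ((z.1 ^ 2 + z.2 ^ 2) / (2 * lP ^ 2)) ^ j * husimi lP m z =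
      ((m + j).factorial / m.factorial : ℝ) := by
  have hpi := Real.pi_pos
  have h : ∀ z : ℝ × ℝ, ((z.1 ^ 2 + z.2 ^ 2) / (2 * lP ^ 2)) ^ j * husimi lP m z =
      (2 * Real.pi * lP ^ 2)⁻¹ / m.factorial * (((z.1 ^ 2 + z.2 ^ 2) / (2 * lP ^ 2)) ^ (m + j) *
        Real.exp (-((z.1 ^ 2 + z.2 ^ 2) / (2 * lP ^ 2)))) := by
    intro z; rw [husimi, pow_add]; ring
  simp_rw [h]
  rw [integral_const_mul, integral_pow_mul_exp (by positivity)]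
  have : (m.factorial : ℝ) ≠ 0 := by positivity
  field_simp

theorem integrable_pow_mul_husimi (hlP : 0 < lP) (j m : ℕ) :
    Integrable fun z : ℝ × ℝ => ((z.1 ^ 2 + z.2 ^ 2) / (2 * lP ^ 2)) ^ j * husimi lP m z := by
  refine not_imp_comm.1 integral_undef ?_
  rw [integral_pow_mul_husimi lP hlP]
  positivity

theorem integrable_husimi (hlP : 0 < lP) (m : ℕ) : Integrable (husimi lP m) := by
  simpa using integrable_pow_mul_husimi lP hlP 0 m

theorem integral_husimi (hlP : 0 < lP) (m : ℕ) : ∫ z, husimi lP m z = 1 := by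
  have := integral_pow_mul_husimi lP hlP 0 m
  have h0 : (m.factorial : ℝ) ≠ 0 := by positivity
  simpa [h0] using this

theorem integrable_mul_husimi (hlP : 0 < lP) (m : ℕ) {f : ℝ × ℝ → ℝ} (hf : Continuous f)
    (h : ∀ z, |f z| ≤ 1 + (z.1 ^ 2 + z.2 ^ 2)) : Integrable fun z => f z * husimi lP m z := by
  refine ((integrable_husimi lP hlP m).add
    ((integrable_pow_mul_husimi lP hlP 1 m).const_mul (2 * lP ^ 2))).mono'
    (by fun_prop) (Eventually.of_forall fun z => ?_)
  have hz := husimi_nonneg lP m z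
  rw [norm_mul, Real.norm_of_nonneg hz, Real.norm_eq_abs]
  refine (mul_le_mul_of_nonneg_right (h z) hz).trans (le_of_eq ?_)
  simp only [Pi.add_apply]
  field_simp

theorem integrable_fst_mul_husimi (hlP : 0 < lP) (m : ℕ) :
    Integrable fun z : ℝ × ℝ => z.1 * husimi lP m z :=
  integrable_mul_husimi lP hlP m (by fun_prop) fun z =>
    abs_le.2 ⟨by nlinarith [sq_nonneg (z.1 + 1), sq_nonneg z.2, sq_nonneg z.1],
      by nlinarith [sq_nonneg (z.1 - 1), sq_nonneg z.2, sq_nonneg z.1]⟩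

theorem integrable_snd_mul_husimi (hlP : 0 < lP) (m : ℕ) :
    Integrable fun z : ℝ × ℝ => z.2 * husimi lP m z :=
  integrable_mul_husimi lP hlP m (by fun_prop) fun z =>
    abs_le.2 ⟨by nlinarith [sq_nonneg (z.2 + 1), sq_nonneg z.2, sq_nonneg z.1],
      by nlinarith [sq_nonneg (z.2 - 1), sq_nonneg z.2, sq_nonneg z.1]⟩

theorem integral_fst_mul_husimi (m : ℕ) : ∫ z : ℝ × ℝ, z.1 * husimi lP m z = 0 := by
  have h := integral_neg_eq_self (μ := volume) (fun z : ℝ × ℝ => z.1 * husimi lP m z)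
  simp only [husimi_neg, Prod.fst_neg, neg_mul] at h
  rw [integral_neg] at h
  linarith

theorem integral_snd_mul_husimi (m : ℕ) : ∫ z : ℝ × ℝ, z.2 * husimi lP m z = 0 := by
  have h := integral_neg_eq_self (μ := volume) (fun z : ℝ × ℝ => z.2 * husimi lP m z)
  simp only [husimi_neg, Prod.snd_neg, neg_mul] at h
  rw [integral_neg] at h
  linarith

theorem affine_mul_husimi (m : ℕ) (w κ z : ℝ × ℝ) :
    (w.1 * (z + κ).1 + w.2 * (z + κ).2) * husimi lP m z = w.1 * (z.1 * husimi lP m z) +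
      w.2 * (z.2 * husimi lP m z) + (w.1 * κ.1 + w.2 * κ.2) * husimi lP m z := by
  simp only [Prod.fst_add, Prod.snd_add]; ring

theorem integrable_affine_mul_husimi (hlP : 0 < lP) (m : ℕ) (w κ : ℝ × ℝ) :
    Integrable fun z : ℝ × ℝ => (w.1 * (z + κ).1 + w.2 * (z + κ).2) * husimi lP m z := by
  simp_rw [affine_mul_husimi]
  exact (((integrable_fst_mul_husimi lP hlP m).const_mul _).add
    ((integrable_snd_mul_husimi lP hlP m).const_mul _)).add ((integrable_husimi lP hlP m).const_mul _)

theorem integral_affine_mul_husimi (hlP : 0 < lP) (m : ℕ) (w κ : ℝ × ℝ) :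
    ∫ z : ℝ × ℝ, (w.1 * (z + κ).1 + w.2 * (z + κ).2) * husimi lP m z = w.1 * κ.1 + w.2 * κ.2 := by
  have h1 := (integrable_fst_mul_husimi lP hlP m).const_mul w.1
  have h2 := (integrable_snd_mul_husimi lP hlP m).const_mul w.2
  have h3 := (integrable_husimi lP hlP m).const_mul (w.1 * κ.1 + w.2 * κ.2)
  have h12 : Integrable fun z : ℝ × ℝ =>
    w.1 * (z.1 * husimi lP m z) + w.2 * (z.2 * husimi lP m z) := h1.add h2
  simp_rw [affine_mul_husimi]
  rw [integral_add h12 h3, integral_add h1 h2, integral_const_mul, integral_const_mul,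
    integral_const_mul, integral_fst_mul_husimi, integral_snd_mul_husimi, integral_husimi lP hlP]
  ring

/-- Gaussian damping of an integrand disappears in the limit. -/
theorem tendsto_integral_damped {f : ℝ × ℝ → ℝ} (m : ℕ) (κ : ℝ × ℝ)
    (hfi : Integrable fun z => f (z + κ) * husimi lP m z) :
    Tendsto (fun ε : ℝ => ∫ z, f (z + κ) * Real.exp (-ε * ((z + κ).1 ^ 2 + (z + κ).2 ^ 2)) * husimi lP m z)
      (𝓝[>] 0) (𝓝 (∫ z, f (z + κ) * husimi lP m z)) := by
  refine tendsto_integral_filter_of_dominated_convergence _ (Eventually.of_forall fun ε => ?_)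
    ?_ hfi.norm (Eventually.of_forall fun z => ?_)
  · have h : (fun z : ℝ × ℝ => f (z + κ) * Real.exp (-ε * ((z + κ).1 ^ 2 + (z + κ).2 ^ 2)) * husimi lP m z) =
        fun z => Real.exp (-ε * ((z + κ).1 ^ 2 + (z + κ).2 ^ 2)) * (f (z + κ) * husimi lP m z) := by
      ext z; ring
    rw [h]
    exact (Continuous.aestronglyMeasurable (by fun_prop)).mul hfi.aestronglyMeasurable
  · filter_upwards [self_mem_nhdsWithin] with ε hε
    refine Eventually.of_forall fun z => ?_
    rw [mul_right_comm, norm_mul]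
    refine mul_le_of_le_one_right (norm_nonneg _) ?_
    rw [Real.norm_of_nonneg (Real.exp_pos _).le, Real.exp_le_one_iff]
    have : (0 : ℝ) < ε := hε
    nlinarith [mul_nonneg this.le (add_nonneg (sq_nonneg (z + κ).1) (sq_nonneg (z + κ).2))]
  · have h : Continuous fun ε : ℝ => f (z + κ) * Real.exp (-ε * ((z + κ).1 ^ 2 + (z + κ).2 ^ 2)) * husimi lP m z := by
      fun_prop
    have := (h.tendsto 0).mono_left (nhdsWithin_le_nhds (s := Set.Ioi 0))
    simpa using this

/-- The covector `v ↦ x · v`. -/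
noncomputable def dotCLM (x : ℝ × ℝ) : ℝ × ℝ →L[ℝ] ℝ :=
  x.1 • ContinuousLinearMap.fst ℝ ℝ ℝ + x.2 • ContinuousLinearMap.snd ℝ ℝ ℝ

theorem dotCLM_apply (x v : ℝ × ℝ) : dotCLM x v = x.1 * v.1 + x.2 * v.2 := by
  simp [dotCLM]

theorem hasFDerivAt_sq_add_sq (x : ℝ × ℝ) :
    HasFDerivAt (fun x : ℝ × ℝ => x.1 ^ 2 + x.2 ^ 2) ((2 : ℝ) • dotCLM x) x := by
  have h := ((hasFDerivAt_fst (𝕜 := ℝ) (p := x)).pow 2).add ((hasFDerivAt_snd (𝕜 := ℝ) (p := x)).pow 2)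
  refine h.congr_fderiv ?_
  ext <;> simp [dotCLM]

/-- The damped function `f(x) exp(-ε |x|²)` has gradient `exp(-ε |x|²) (∇f - 2 ε f x)`. -/
theorem hasFDerivAt_mul_gauss (ε : ℝ) {f : ℝ × ℝ → ℝ} {f' : ℝ × ℝ →L[ℝ] ℝ} {x : ℝ × ℝ}
    (hf : HasFDerivAt f f' x) :
    HasFDerivAt (fun x => f x * Real.exp (-ε * (x.1 ^ 2 + x.2 ^ 2)))
      (Real.exp (-ε * (x.1 ^ 2 + x.2 ^ 2)) • (f' - (2 * ε * f x) • dotCLM x)) x := by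
  have h := hf.mul ((hasFDerivAt_sq_add_sq x).const_mul (-ε)).exp
  refine h.congr_fderiv ?_
  module

/-- The elementary estimate behind the gradient bounds of damped functions. -/
theorem exp_neg_mul_one_sub_sq_le {s : ℝ} (hs : 0 ≤ s) : Real.exp (-s) * (1 - s) ^ 2 ≤ 1 := by
  have h1 := Real.quadratic_le_exp_of_nonneg (x := s / 2) (by positivity)
  have h2 : |1 - s| ≤ Real.exp (s / 2) :=
    abs_le.2 ⟨by nlinarith [sq_nonneg (s - 2)], by nlinarith [sq_nonneg s]⟩
  have h3 : (1 - s) ^ 2 ≤ Real.exp s := by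
    rw [← sq_abs]
    refine (pow_le_pow_left₀ (abs_nonneg _) h2 2).trans (le_of_eq ?_)
    rw [← Real.exp_nat_mul]; congr 1; push_cast; ring
  rw [Real.exp_neg, inv_mul_le_iff₀ (Real.exp_pos s), mul_one]
  exact h3

/-- With `|w|² + c ≤ 1`, the damped linear function `h(x) = (w · x) exp(-ε |x|²)` satisfies
`|∇h|² + c exp(-2 ε |x|²) ≤ 1`: damping with this profile never steepens the function. -/
theorem damped_affine_gradient_le {ε : ℝ} (hε : 0 < ε) {w : ℝ × ℝ} {c : ℝ}
    (hw : w.1 ^ 2 + w.2 ^ 2 + c ≤ 1) (hc : 0 ≤ c) (x : ℝ × ℝ) :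
    Real.exp (-ε * (x.1 ^ 2 + x.2 ^ 2)) ^ 2 *
      ((w.1 - 2 * ε * (w.1 * x.1 + w.2 * x.2) * x.1) ^ 2 +
        (w.2 - 2 * ε * (w.1 * x.1 + w.2 * x.2) * x.2) ^ 2 + c) ≤ 1 := by
  set R := x.1 ^ 2 + x.2 ^ 2 with hR
  set P := (w.1 * x.1 + w.2 * x.2) ^ 2 with hP
  have hR0 : 0 ≤ R := by positivity
  have hP0 : 0 ≤ P := by positivity
  have hPR : P ≤ R := by
    have : P ≤ (w.1 ^ 2 + w.2 ^ 2) * R := by nlinarith [sq_nonneg (w.1 * x.2 - w.2 * x.1)]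
    nlinarith
  have h1 : (w.1 - 2 * ε * (w.1 * x.1 + w.2 * x.2) * x.1) ^ 2 +
      (w.2 - 2 * ε * (w.1 * x.1 + w.2 * x.2) * x.2) ^ 2 + c =
      (w.1 ^ 2 + w.2 ^ 2 + c) + 4 * ε * P * (ε * R - 1) := by rw [hP, hR]; ring
  have h2 : Real.exp (-ε * R) ^ 2 = Real.exp (-(2 * ε * R)) := by
    rw [← Real.exp_nat_mul]; congr 1; push_cast; ring
  rw [h1, h2]
  have h3 := (Real.exp_pos (-(2 * ε * R))).le
  rcases le_total (ε * R) 1 with h | h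
  · have h4 : Real.exp (-(2 * ε * R)) ≤ 1 := by
      rw [Real.exp_le_one_iff]; nlinarith [mul_nonneg hε.le hR0]
    have h5 : 4 * ε * P * (ε * R - 1) ≤ 0 := mul_nonpos_of_nonneg_of_nonpos (by positivity) (by linarith)
    nlinarith
  · refine le_trans ?_ (exp_neg_mul_one_sub_sq_le (s := 2 * ε * R) (by positivity))
    refine mul_le_mul_of_nonneg_left ?_ h3
    have h5 : 4 * ε * P * (ε * R - 1) ≤ 4 * ε * R * (ε * R - 1) := by
      have : 0 ≤ ε * R - 1 := by linarith
      gcongr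
    nlinarith

theorem exists_damped_affine {ε : ℝ} (hε : 0 < ε) (w : ℝ × ℝ) : ∃ h : Alg, ∀ x,
    h x = ((w.1 * x.1 + w.2 * x.2) * Real.exp (-ε * (x.1 ^ 2 + x.2 ^ 2)) : ℝ) := by
  refine ⟨SchwartzMap.smulLeftCLM ℂ (fun x : ℝ × ℝ => (w.1 : ℂ) * x.1 + (w.2 : ℂ) * x.2) (planeGauss hε),
    fun x => ?_⟩
  rw [SchwartzMap.smulLeftCLM_apply_apply (by fun_prop), planeGauss_apply, smul_eq_mul]
  push_cast
  rfl

theorem hasFDerivAt_affine (w x : ℝ × ℝ) :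
    HasFDerivAt (fun x : ℝ × ℝ => w.1 * x.1 + w.2 * x.2) (dotCLM w) x := by
  have h : (fun x : ℝ × ℝ => w.1 * x.1 + w.2 * x.2) = dotCLM w := by ext x; rw [dotCLM_apply]
  rw [h]; exact (dotCLM w).hasFDerivAt

/-- A linear function, damped by a wide Gaussian, detects the distance of the translations. -/
theorem norm_sub_le_distD (hlP : 0 < lP) (m n : ℕ) (κ κ' : ℂ) :
    ENNReal.ofReal ‖κ - κ'‖ ≤ distD lP (translate κ (eigenstate lP m)) (translate κ' (eigenstate lP n)) := by
  rcases (norm_nonneg (κ - κ')).eq_or_lt with h0 | h0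
  · rw [← h0, ENNReal.ofReal_zero]; exact zero_le
  set d := ‖κ - κ'‖ with hd
  have hd2 : d ^ 2 = (κ.re - κ'.re) ^ 2 + (κ.im - κ'.im) ^ 2 := by
    rw [hd, Complex.sq_norm, Complex.normSq_apply]; simp; ring
  -- the unit vector in the direction of the translation
  set w : ℝ × ℝ := ((κ.re - κ'.re) / d, (κ.im - κ'.im) / d) with hw
  have hw1 : w.1 ^ 2 + w.2 ^ 2 + 0 ≤ 1 := by
    rw [hw]; simp only [div_pow]; rw [add_zero, ← add_div, ← hd2, div_self (by positivity)]
  have h1 := (tendsto_integral_damped lP (f := fun x => w.1 * x.1 + w.2 * x.2) m (κ.re, κ.im)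
    (integrable_affine_mul_husimi lP hlP m w _)).sub
    (tendsto_integral_damped lP (f := fun x => w.1 * x.1 + w.2 * x.2) n (κ'.re, κ'.im)
    (integrable_affine_mul_husimi lP hlP n w _))
  rw [integral_affine_mul_husimi lP hlP, integral_affine_mul_husimi lP hlP] at h1
  have h2 : w.1 * κ.re + w.2 * κ.im - (w.1 * κ'.re + w.2 * κ'.im) = d := by
    rw [hw]; simp only; field_simp; rw [hd2]; ring
  simp only [h2] at h1
  refine le_of_tendsto (ENNReal.tendsto_ofReal h1) ?_
  filter_upwards [self_mem_nhdsWithin] with ε hε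
  obtain ⟨h, hh⟩ := exists_damped_affine hε w
  refine le_distD_of_real lP hlP m n κ κ' hh
    (fun x => hasFDerivAt_mul_gauss ε (hasFDerivAt_affine w x)) fun x => ?_
  refine le_trans (le_of_eq ?_) (damped_affine_gradient_le hε hw1 le_rfl x)
  simp only [_root_.smul_apply, _root_.sub_apply, dotCLM_apply, smul_eq_mul]
  ring

/-- In the two-sheet model the test function is a linear function which has, on the second
sheet, an additional nearly constant summand. -/
theorem sqrt_le_distD' (hlP : 0 < lP) {Λ : ℂ} (hΛ : Λ ≠ 0) (m n : ℕ) (κ κ' : ℂ) :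
    ENNReal.ofReal (Real.sqrt (‖κ - κ'‖ ^ 2 + (‖Λ‖ ^ 2)⁻¹)) ≤
      distD' lP Λ (onSheet (translate κ (eigenstate lP m)) 0) (onSheet (translate κ' (eigenstate lP n)) 1) := by
  have hΛ0 : 0 < ‖Λ‖ ^ 2 := by positivity
  set d := Real.sqrt (‖κ - κ'‖ ^ 2 + (‖Λ‖ ^ 2)⁻¹) with hd
  have hd0 : 0 < d := Real.sqrt_pos.2 (by positivity)
  have hd2 : d ^ 2 = (κ.re - κ'.re) ^ 2 + (κ.im - κ'.im) ^ 2 + (‖Λ‖ ^ 2)⁻¹ := by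
    rw [hd, Real.sq_sqrt (by positivity), Complex.sq_norm, Complex.normSq_apply]; simp; ring
  -- `(w, |Λ| β)` is the unit vector in the direction of `(κ - κ', 1 / |Λ|)`
  set w : ℝ × ℝ := ((κ.re - κ'.re) / d, (κ.im - κ'.im) / d) with hw
  set β := (‖Λ‖ ^ 2)⁻¹ / d with hβ
  have hw1 : w.1 ^ 2 + w.2 ^ 2 + ‖Λ‖ ^ 2 * β ^ 2 ≤ 1 := by
    have : w.1 ^ 2 + w.2 ^ 2 + ‖Λ‖ ^ 2 * β ^ 2 =
        ((κ.re - κ'.re) ^ 2 + (κ.im - κ'.im) ^ 2 + (‖Λ‖ ^ 2)⁻¹) / d ^ 2 := by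
      rw [hw, hβ]; simp only; field_simp
    rw [this, ← hd2, div_self (by positivity)]
  have hint : ∀ z : ℝ × ℝ, (w.1 * (z + (κ'.re, κ'.im)).1 + w.2 * (z + (κ'.re, κ'.im)).2 + -β) * husimi lP n z =
      (w.1 * (z + (κ'.re, κ'.im)).1 + w.2 * (z + (κ'.re, κ'.im)).2) * husimi lP n z + -β * husimi lP n z :=
    fun z => by ring
  have hi1 := integrable_affine_mul_husimi lP hlP n w (κ'.re, κ'.im)
  have hi2 := (integrable_husimi lP hlP n).const_mul (-β)
  have h1 := (tendsto_integral_damped lP (f := fun x => w.1 * x.1 + w.2 * x.2) m (κ.re, κ.im)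
    (integrable_affine_mul_husimi lP hlP m w _)).sub
    (tendsto_integral_damped lP (f := fun x => w.1 * x.1 + w.2 * x.2 + -β) n (κ'.re, κ'.im)
    (by simp_rw [hint]; exact hi1.add hi2))
  simp_rw [hint] at h1
  rw [integral_add hi1 hi2, integral_const_mul, integral_husimi lP hlP, integral_affine_mul_husimi lP hlP,
    integral_affine_mul_husimi lP hlP] at h1
  have h2 : w.1 * κ.re + w.2 * κ.im - (w.1 * κ'.re + w.2 * κ'.im + -β * 1) = d := by
    have : w.1 * κ.re + w.2 * κ.im - (w.1 * κ'.re + w.2 * κ'.im + -β * 1) =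
        ((κ.re - κ'.re) ^ 2 + (κ.im - κ'.im) ^ 2 + (‖Λ‖ ^ 2)⁻¹) / d := by
      rw [hw, hβ]; simp only; field_simp; ring
    rw [this, ← hd2]; field_simp
  simp only [h2] at h1
  -- the damped constant `-β` has gradient of length at most `β √(2ε)`, which vanishes with `ε`
  have h3 : Tendsto (fun ε : ℝ => 1 / (1 + β * Real.sqrt (2 * ε))) (𝓝[>] 0) (𝓝 1) := by
    have hβ0 : 0 ≤ β := by positivity
    have hc : ContinuousAt (fun ε : ℝ => 1 / (1 + β * Real.sqrt (2 * ε))) 0 := by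
      refine ContinuousAt.div (by fun_prop) (by fun_prop) ?_
      simp
    have := hc.tendsto.mono_left (nhdsWithin_le_nhds (s := Set.Ioi 0))
    simpa using this
  have h4 := h3.mul h1
  rw [one_mul] at h4
  refine le_of_tendsto (ENNReal.tendsto_ofReal h4) ?_
  filter_upwards [self_mem_nhdsWithin] with ε hε
  have hε0 : (0 : ℝ) < ε := hε
  obtain ⟨h, hh⟩ := exists_damped_affine hε w
  have hbx : ∀ x, (((-β : ℝ) : ℂ) • planeGauss hε0 : Alg) x =
      (-β * Real.exp (-ε * (x.1 ^ 2 + x.2 ^ 2)) : ℝ) := fun x => by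
    rw [_root_.smul_apply, planeGauss_apply, smul_eq_mul, Complex.ofReal_mul]
  have h5 := le_distD'_of_real lP hlP Λ m n κ κ' hh hbx
    (fun x => hasFDerivAt_mul_gauss ε (hasFDerivAt_affine w x))
    (fun x => hasFDerivAt_mul_gauss ε (hasFDerivAt_const (-β) x)) (δ := β * Real.sqrt (2 * ε))
    (by positivity) (fun x => ?_) (fun x => ?_)
  · refine le_trans (le_of_eq ?_) h5
    simp_rw [← add_mul]
  · refine le_trans (le_of_eq ?_) (damped_affine_gradient_le hε hw1 (by positivity) x)
    simp only [_root_.smul_apply, _root_.sub_apply, dotCLM_apply, smul_eq_mul]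
    ring
  · have h6 : Real.exp (-ε * (x.1 ^ 2 + x.2 ^ 2)) ^ 2 * (2 * ε * (x.1 ^ 2 + x.2 ^ 2)) ≤ 1 := by
      have h7 : Real.exp (-ε * (x.1 ^ 2 + x.2 ^ 2)) ^ 2 = Real.exp (-(2 * ε * (x.1 ^ 2 + x.2 ^ 2))) := by
        rw [← Real.exp_nat_mul]; congr 1; push_cast; ring
      rw [h7, Real.exp_neg, inv_mul_le_iff₀ (Real.exp_pos _), mul_one]
      linarith [Real.add_one_le_exp (2 * ε * (x.1 ^ 2 + x.2 ^ 2))]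
    simp only [_root_.smul_apply, _root_.sub_apply, _root_.zero_apply, dotCLM_apply, smul_eq_mul]
    rw [mul_pow β, Real.sq_sqrt (by positivity)]
    have h8 : 0 ≤ 2 * ε * β ^ 2 := by positivity
    nlinarith [mul_le_mul_of_nonneg_left h6 h8]

end Moyal

namespace Moyal

/-! ### The distance between eigenstates for large energies -/

variable (lP : ℝ)

theorem exists_damped_radial {ε : ℝ} (hε : 0 < ε) : ∃ h : Alg, ∀ x : ℝ × ℝ, h x =
    (Real.exp (-ε) * (Real.sqrt (1 + (x.1 ^ 2 + x.2 ^ 2)) * Real.exp (-ε * (x.1 ^ 2 + x.2 ^ 2))) : ℝ) := by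
  have h1 : (fun x : ℝ × ℝ => ((Real.sqrt (1 + (x.1 ^ 2 + x.2 ^ 2)) : ℝ) : ℂ)).HasTemperateGrowth := by
    have h := Complex.ofRealCLM.hasTemperateGrowth.comp
      ((Function.hasTemperateGrowth_one_add_norm_sq_rpow ℂ (1 / 2)).comp
        (Complex.equivRealProdCLM.symm.toContinuousLinearMap).hasTemperateGrowth)
    refine cast (congrArg _ ?_) h
    ext x
    have h2 : ‖Complex.equivRealProdCLM.symm x‖ ^ 2 = x.1 ^ 2 + x.2 ^ 2 := by
      rw [Complex.sq_norm, Complex.normSq_apply, Complex.equivRealProdCLM_symm_apply_re,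
        Complex.equivRealProdCLM_symm_apply_im]; ring
    simp [h2, Real.sqrt_eq_rpow]
  refine ⟨((Real.exp (-ε) : ℝ) : ℂ) • SchwartzMap.smulLeftCLM ℂ
    (fun x : ℝ × ℝ => ((Real.sqrt (1 + (x.1 ^ 2 + x.2 ^ 2)) : ℝ) : ℂ)) (planeGauss hε), fun x => ?_⟩
  rw [_root_.smul_apply, SchwartzMap.smulLeftCLM_apply_apply h1, planeGauss_apply, smul_eq_mul, smul_eq_mul]
  push_cast
  rfl

theorem hasFDerivAt_sqrt_one_add (x : ℝ × ℝ) :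
    HasFDerivAt (fun x : ℝ × ℝ => Real.sqrt (1 + (x.1 ^ 2 + x.2 ^ 2)))
      ((Real.sqrt (1 + (x.1 ^ 2 + x.2 ^ 2)))⁻¹ • dotCLM x) x := by
  have h := ((hasFDerivAt_sq_add_sq x).const_add 1).sqrt (by positivity)
  refine h.congr_fderiv ?_
  rw [smul_smul]
  congr 1
  field_simp

/-- The damped function `√(1 + |x|²) exp(-ε (1 + |x|²))` has gradient of length at most `1`. -/
theorem damped_radial_gradient_le {ε : ℝ} (hε : 0 < ε) (x : ℝ × ℝ) :
    (Real.exp (-ε) * (Real.exp (-ε * (x.1 ^ 2 + x.2 ^ 2)) * ((Real.sqrt (1 + (x.1 ^ 2 + x.2 ^ 2)))⁻¹ -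
      2 * ε * Real.sqrt (1 + (x.1 ^ 2 + x.2 ^ 2))))) ^ 2 * (x.1 ^ 2 + x.2 ^ 2) ≤ 1 := by
  set R := x.1 ^ 2 + x.2 ^ 2
  have hR : 0 ≤ R := by positivity
  set t := Real.sqrt (1 + R)
  have ht : t ^ 2 = 1 + R := Real.sq_sqrt (by positivity)
  have ht0 : 0 < t := Real.sqrt_pos.2 (by positivity)
  have h1 : (Real.exp (-ε) * (Real.exp (-ε * R) * (t⁻¹ - 2 * ε * t))) ^ 2 * R =
      Real.exp (-(2 * ε * t ^ 2)) * (1 - 2 * ε * t ^ 2) ^ 2 * (R / t ^ 2) := by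
    have h2 : Real.exp (-(2 * ε * t ^ 2)) = Real.exp (-ε) ^ 2 * Real.exp (-ε * R) ^ 2 := by
      rw [← Real.exp_nat_mul, ← Real.exp_nat_mul, ← Real.exp_add, ht]; congr 1; push_cast; ring
    rw [h2]; field_simp
  rw [h1]
  refine mul_le_one₀ (exp_neg_mul_one_sub_sq_le (by positivity)) (by positivity) ?_
  rw [div_le_one (by positivity), ht]
  linarith

theorem integrable_radial_mul_husimi (hlP : 0 < lP) (m : ℕ) :
    Integrable fun z : ℝ × ℝ => Real.sqrt (1 + (z.1 ^ 2 + z.2 ^ 2)) * husimi lP m z :=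
  integrable_mul_husimi lP hlP m (by fun_prop) fun z => by
    rw [abs_of_nonneg (Real.sqrt_nonneg _)]
    exact Real.sqrt_le_iff.2 ⟨by positivity, by nlinarith [sq_nonneg z.1, sq_nonneg z.2]⟩

/-- The test function `√(1 + |x|²)`, damped by a wide Gaussian, detects differences of energy. -/
theorem integral_radial_sub_le_distD (hlP : 0 < lP) (m n : ℕ) :
    ENNReal.ofReal ((∫ z : ℝ × ℝ, Real.sqrt (1 + (z.1 ^ 2 + z.2 ^ 2)) * husimi lP m z) -
      ∫ z : ℝ × ℝ, Real.sqrt (1 + (z.1 ^ 2 + z.2 ^ 2)) * husimi lP n z) ≤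
      distD lP (translate 0 (eigenstate lP m)) (translate 0 (eigenstate lP n)) := by
  have h0 : ∀ z : ℝ × ℝ, z + ((0 : ℂ).re, (0 : ℂ).im) = z := fun z => by simp
  have ht := fun m => tendsto_integral_damped lP (f := fun x => Real.sqrt (1 + (x.1 ^ 2 + x.2 ^ 2)))
    m ((0 : ℂ).re, (0 : ℂ).im) (by simp_rw [h0]; exact integrable_radial_mul_husimi lP hlP m)
  have hexp : Tendsto (fun ε : ℝ => Real.exp (-ε)) (𝓝[>] 0) (𝓝 1) := by
    have hc : Continuous fun ε : ℝ => Real.exp (-ε) := by fun_prop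
    have := (hc.tendsto 0).mono_left (nhdsWithin_le_nhds (s := Set.Ioi 0))
    simpa using this
  have h1 := hexp.mul ((ht m).sub (ht n))
  rw [one_mul] at h1
  simp_rw [h0] at h1
  refine le_of_tendsto (ENNReal.tendsto_ofReal h1) ?_
  filter_upwards [self_mem_nhdsWithin] with ε hε
  obtain ⟨h, hh⟩ := exists_damped_radial hε
  refine le_trans (le_of_eq ?_) (le_distD_of_real lP hlP m n 0 0 hh
    (fun x => (hasFDerivAt_mul_gauss ε (hasFDerivAt_sqrt_one_add x)).const_mul (Real.exp (-ε))) fun x => ?_)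
  · simp_rw [h0, mul_assoc (Real.exp (-ε))]
    rw [integral_const_mul, integral_const_mul, mul_sub]
  · refine le_trans (le_of_eq ?_) (damped_radial_gradient_le hε x)
    simp only [_root_.smul_apply, _root_.sub_apply, dotCLM_apply, smul_eq_mul]
    ring

/-- The moments of order two and four of the Husimi density bound `∫ |z| Q_n(z) dz` from below,
since `y ≥ (3 y² - y⁴) / 2` for `y ≥ 0`. -/
theorem le_integral_radial (hlP : 0 < lP) {n : ℕ} (hn : 0 < n) :
    Real.sqrt 2 * lP * Real.sqrt n * (3 / 2 * ((n + 1) / n) - 1 / 2 * ((n + 1) * (n + 2) / n ^ 2)) ≤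
      ∫ z : ℝ × ℝ, Real.sqrt (1 + (z.1 ^ 2 + z.2 ^ 2)) * husimi lP n z := by
  have hn0 : (0 : ℝ) < n := by exact_mod_cast hn
  set c := Real.sqrt 2 * lP * Real.sqrt n with hc
  have hc0 : 0 < c := by positivity
  have hc2 : c ^ 2 = 2 * lP ^ 2 * n := by
    rw [hc, mul_pow, mul_pow, Real.sq_sqrt (by norm_num), Real.sq_sqrt hn0.le]
  have hm1 := integral_pow_mul_husimi lP hlP 1 n
  have hm2 := integral_pow_mul_husimi lP hlP 2 n
  have hf : (n.factorial : ℝ) ≠ 0 := by positivity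
  have hi1 := (integrable_pow_mul_husimi lP hlP 1 n).const_mul (c * (3 / 2 / n))
  have hi2 := (integrable_pow_mul_husimi lP hlP 2 n).const_mul (c * (1 / 2 / n ^ 2))
  have h1 : ∫ z : ℝ × ℝ, (c * (3 / 2 / n) * (((z.1 ^ 2 + z.2 ^ 2) / (2 * lP ^ 2)) ^ 1 * husimi lP n z) -
      c * (1 / 2 / n ^ 2) * (((z.1 ^ 2 + z.2 ^ 2) / (2 * lP ^ 2)) ^ 2 * husimi lP n z)) =
      c * (3 / 2 * ((n + 1) / n) - 1 / 2 * ((n + 1) * (n + 2) / n ^ 2)) := by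
    rw [integral_sub hi1 hi2, integral_const_mul, integral_const_mul, hm1, hm2, Nat.factorial_succ,
      Nat.factorial_succ, Nat.factorial_succ]
    push_cast
    field_simp
    ring
  rw [← h1]
  refine integral_mono (hi1.sub hi2) (integrable_radial_mul_husimi lP hlP n) fun z => ?_
  simp only
  set R := z.1 ^ 2 + z.2 ^ 2 with hR
  have hR0 : 0 ≤ R := by positivity
  set y := Real.sqrt R / c with hy
  have hy0 : 0 ≤ y := by positivity
  have hy2 : R / (2 * lP ^ 2) = n * y ^ 2 := by
    rw [hy, div_pow, Real.sq_sqrt hR0, hc2]; field_simp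
  have hs : c * y ≤ Real.sqrt (1 + R) := by
    rw [hy, mul_div_cancel₀ _ hc0.ne']
    exact Real.sqrt_le_sqrt (by linarith)
  have hpoly : 3 / 2 * y ^ 2 - 1 / 2 * y ^ 4 ≤ y := by
    nlinarith [mul_nonneg (mul_nonneg hy0 (sq_nonneg (y - 1))) (by linarith : 0 ≤ y + 2)]
  have hq := husimi_nonneg lP n z
  calc _ = c * (3 / 2 * y ^ 2 - 1 / 2 * y ^ 4) * husimi lP n z := by
        rw [hy2]; field_simp
    _ ≤ c * y * husimi lP n z := by gcongr
    _ ≤ _ := by gcongr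

end Moyal

namespace Moyal

/-! ### The quantum square-length of coherent states -/

variable (lP : ℝ)

/-- The position operator `ψ ↦ x ψ(x)` on Schwartz functions. -/
noncomputable def posS : 𝓢(ℝ, ℂ) →L[ℂ] 𝓢(ℝ, ℂ) := SchwartzMap.smulLeftCLM ℂ fun x : ℝ => (x : ℂ)

theorem posS_apply (ψ : 𝓢(ℝ, ℂ)) (x : ℝ) : posS ψ x = x * ψ x := by
  rw [posS, SchwartzMap.smulLeftCLM_apply_apply hasTemperateGrowth_coe, smul_eq_mul]

/-- Differentiation on Schwartz functions. -/
noncomputable def derS : 𝓢(ℝ, ℂ) →L[ℂ] 𝓢(ℝ, ℂ) := SchwartzMap.derivCLM ℂ ℂ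

theorem derS_apply (ψ : 𝓢(ℝ, ℂ)) (x : ℝ) : derS ψ x = deriv ψ x := rfl

theorem hasDerivAt_derS (ψ : 𝓢(ℝ, ℂ)) (x : ℝ) : HasDerivAt ψ (derS ψ x) x :=
  ψ.differentiableAt.hasDerivAt

/-- Twice the harmonic oscillator Hamiltonian, `q² + p² = x² - θ² ∂²`. -/
noncomputable def oscS : 𝓢(ℝ, ℂ) →L[ℂ] 𝓢(ℝ, ℂ) := posS ∘L posS - ((lP : ℂ) ^ 4) • (derS ∘L derS)

theorem oscS_apply (ψ : 𝓢(ℝ, ℂ)) : oscS lP ψ = posS (posS ψ) - ((lP : ℂ) ^ 4) • derS (derS ψ) := rfl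

/-- The scalar product `⟨ψ, φ⟩`. -/
noncomputable def braket (ψ φ : 𝓢(ℝ, ℂ)) : ℂ := ∫ x, conj (ψ x) * φ x

theorem integrable_braket (ψ φ : 𝓢(ℝ, ℂ)) : Integrable fun x => conj (ψ x) * φ x :=
  (integrable_conj ψ).mul_bdd φ.continuous.aestronglyMeasurable
    (Eventually.of_forall fun x => SchwartzMap.norm_le_seminorm ℝ φ x)

theorem braket_add (ψ φ χ : 𝓢(ℝ, ℂ)) : braket ψ (φ + χ) = braket ψ φ + braket ψ χ := by
  rw [braket, braket, braket, ← integral_add (integrable_braket ψ φ) (integrable_braket ψ χ)]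
  simp [mul_add]

theorem braket_smul (c : ℂ) (ψ φ : 𝓢(ℝ, ℂ)) : braket ψ (c • φ) = c * braket ψ φ := by
  rw [braket, braket, ← integral_const_mul]
  refine integral_congr_ae (Eventually.of_forall fun x => ?_)
  simp only [_root_.smul_apply, smul_eq_mul]
  ring

theorem braket_sub (ψ φ χ : 𝓢(ℝ, ℂ)) : braket ψ (φ - χ) = braket ψ φ - braket ψ χ := by
  rw [sub_eq_add_neg, ← neg_one_smul ℂ χ, braket_add, braket_smul]
  ring

theorem braket_smul_smul {c : ℂ} (hc : ‖c‖ = 1) (ψ φ : 𝓢(ℝ, ℂ)) : braket (c • ψ) (c • φ) = braket ψ φ := by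
  refine integral_congr_ae (Eventually.of_forall fun x => ?_)
  have : conj c * c = 1 := by rw [Complex.conj_mul', hc]; norm_num
  simp only [_root_.smul_apply, smul_eq_mul, map_mul]
  linear_combination (conj (ψ x) * φ x) * this

theorem lengthSq_apply (ψ φ : 𝓢(ℝ, ℂ)) (x y : ℝ) :
    lengthSq lP (fun x y => ψ x * φ y) x y = oscS lP ψ x * φ y + ψ x * oscS lP φ y -
      2 * (posS ψ x * posS φ y) + 2 * (lP : ℂ) ^ 4 * (derS ψ x * derS φ y) := by
  have h1 : dq₂ lP (fun x y => ψ x * φ y) =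
      fun x y => -Complex.I * (lP : ℂ) ^ 2 * (derS ψ x * φ y - ψ x * derS φ y) := by
    ext x y
    rw [dq₂, ((hasDerivAt_derS ψ x).mul_const (φ y)).deriv, ((hasDerivAt_derS φ y).const_mul (ψ x)).deriv]
  have h2 : dq₂ lP (dq₂ lP (fun x y => ψ x * φ y)) x y = -(lP : ℂ) ^ 4 *
      (derS (derS ψ) x * φ y - 2 * (derS ψ x * derS φ y) + ψ x * derS (derS φ) y) := by
    rw [h1, dq₂]
    have h3 := ((((hasDerivAt_derS (derS ψ) x).mul_const (φ y)).sub
      ((hasDerivAt_derS ψ x).mul_const (derS φ y))).const_mul (-Complex.I * (lP : ℂ) ^ 2)).deriv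
    have h4 := ((((hasDerivAt_derS φ y).const_mul (derS ψ x)).sub
      ((hasDerivAt_derS (derS φ) y).const_mul (ψ x))).const_mul (-Complex.I * (lP : ℂ) ^ 2)).deriv
    simp only [Pi.sub_apply] at h3 h4
    erw [h3, h4]
    ring_nf
    rw [Complex.I_sq]
    ring
  rw [lengthSq, Pi.add_apply, Pi.add_apply, h2, dq₁, dq₁, oscS_apply, oscS_apply]
  simp only [_root_.sub_apply, _root_.smul_apply, posS_apply, smul_eq_mul]
  ring

theorem integral_conj_mul_prod (ψ φ χ η : 𝓢(ℝ, ℂ)) :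
    Integrable (fun z : ℝ × ℝ => conj (ψ z.1 * φ z.2) * (χ z.1 * η z.2)) ∧
    ∫ z : ℝ × ℝ, conj (ψ z.1 * φ z.2) * (χ z.1 * η z.2) = braket ψ χ * braket φ η := by
  have h : (fun z : ℝ × ℝ => conj (ψ z.1 * φ z.2) * (χ z.1 * η z.2)) =
      fun z => (conj (ψ z.1) * χ z.1) * (conj (φ z.2) * η z.2) := by
    ext z; rw [map_mul]; ring
  rw [h]
  exact ⟨(integrable_braket ψ χ).mul_prod (integrable_braket φ η), integral_prod_mul (μ := volume) (ν := volume)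
    (fun x => conj (ψ x) * χ x) (fun y => conj (φ y) * η y)⟩

/-- The mean of `L²` in a product vector, in terms of the means of `q`, `p` and `q² + p²`. -/
theorem meanLengthSq_eq (ψ φ : 𝓢(ℝ, ℂ)) : meanLengthSq lP ψ φ =
    braket ψ (oscS lP ψ) * braket φ φ + braket ψ ψ * braket φ (oscS lP φ) -
      2 * (braket ψ (posS ψ) * braket φ (posS φ)) +
      2 * (lP : ℂ) ^ 4 * (braket ψ (derS ψ) * braket φ (derS φ)) := by
  have h := integral_conj_mul_prod ψ φ
  have h1 : ∀ z : ℝ × ℝ, conj (ψ z.1 * φ z.2) * lengthSq lP (fun x y => ψ x * φ y) z.1 z.2 =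
      conj (ψ z.1 * φ z.2) * (oscS lP ψ z.1 * φ z.2) + conj (ψ z.1 * φ z.2) * (ψ z.1 * oscS lP φ z.2) -
      2 * (conj (ψ z.1 * φ z.2) * (posS ψ z.1 * posS φ z.2)) +
      2 * (lP : ℂ) ^ 4 * (conj (ψ z.1 * φ z.2) * (derS ψ z.1 * derS φ z.2)) := by
    intro z; rw [lengthSq_apply]; ring
  rw [meanLengthSq]
  simp_rw [h1]
  have i1 := (h (oscS lP ψ) φ).1
  have i2 := (h ψ (oscS lP φ)).1
  have i3 := (h (posS ψ) (posS φ)).1.const_mul 2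
  have i4 := (h (derS ψ) (derS φ)).1.const_mul (2 * (lP : ℂ) ^ 4)
  have i12 : Integrable fun z : ℝ × ℝ => conj (ψ z.1 * φ z.2) * (oscS lP ψ z.1 * φ z.2) +
    conj (ψ z.1 * φ z.2) * (ψ z.1 * oscS lP φ z.2) := i1.add i2
  have i123 : Integrable fun z : ℝ × ℝ => conj (ψ z.1 * φ z.2) * (oscS lP ψ z.1 * φ z.2) +
    conj (ψ z.1 * φ z.2) * (ψ z.1 * oscS lP φ z.2) -
    2 * (conj (ψ z.1 * φ z.2) * (posS ψ z.1 * posS φ z.2)) := i12.sub i3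
  rw [integral_add i123 i4, integral_sub i12 i3, integral_add i1 i2, integral_const_mul,
    integral_const_mul, (h _ _).2, (h _ _).2, (h _ _).2, (h _ _).2]

/-- Independence of the choice of phases of the state vectors. -/
theorem meanLengthSq_smul {c d : ℂ} (hc : ‖c‖ = 1) (hd : ‖d‖ = 1) (ψ φ : 𝓢(ℝ, ℂ)) :
    meanLengthSq lP (⇑(c • ψ)) (⇑(d • φ)) = meanLengthSq lP ψ φ := by
  simp only [meanLengthSq_eq, map_smul, braket_smul_smul hc, braket_smul_smul hd]

/-! ### Means in translated vectors -/

theorem braket_weylS (k : ℝ × ℝ) (ψ φ : 𝓢(ℝ, ℂ)) :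
    braket (weylS lP k ψ) (weylS lP k φ) = braket ψ φ := by
  rw [braket, braket, ← integral_add_right_eq_self (μ := volume) (fun x => conj (ψ x) * φ x) k.2]
  refine integral_congr_ae (Eventually.of_forall fun x => ?_)
  have h : conj (weylPhase lP k x) * weylPhase lP k x = 1 := by
    rw [Complex.conj_mul', norm_weylPhase]; norm_num
  simp only [weylS_apply, weyl_apply, map_mul]
  linear_combination (conj (ψ (x + k.2)) * φ (x + k.2)) * h

theorem posS_weylS (k : ℝ × ℝ) (ψ : 𝓢(ℝ, ℂ)) :
    posS (weylS lP k ψ) = weylS lP k (posS ψ - (k.2 : ℂ) • ψ) := by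
  ext x
  simp only [posS_apply, weylS_apply, weyl_apply, _root_.sub_apply, _root_.smul_apply, smul_eq_mul]
  push_cast
  ring

theorem derS_weylS (k : ℝ × ℝ) (ψ : 𝓢(ℝ, ℂ)) :
    derS (weylS lP k ψ) = weylS lP k (derS ψ + (Complex.I * k.1 / (lP : ℂ) ^ 2) • ψ) := by
  ext x
  have h1 : HasDerivAt (weylPhase lP k) (weylPhase lP k x * (Complex.I * k.1 / (lP : ℂ) ^ 2)) x := by
    have h := (((((hasDerivAt_id x).ofReal_comp).add_const ((k.2 : ℂ) / 2)).const_mul (k.1 : ℂ)).const_mul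
      (Complex.I / (lP : ℂ) ^ 2)).cexp
    refine h.congr_deriv ?_
    simp only [weylPhase, id]
    push_cast
    ring
  have h2 : HasDerivAt (fun x => ψ (x + k.2)) (derS ψ (x + k.2)) x :=
    (hasDerivAt_derS ψ (x + k.2)).comp_add_const x k.2
  have h3 : HasDerivAt (weyl lP k ψ) (weylPhase lP k x * (Complex.I * k.1 / (lP : ℂ) ^ 2) * ψ (x + k.2) +
      weylPhase lP k x * derS ψ (x + k.2)) x := h1.mul h2
  rw [derS_apply, coe_weylS, h3.deriv]
  simp only [weylS_apply, weyl_apply, _root_.add_apply, _root_.smul_apply, smul_eq_mul]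
  ring

theorem eigenfunction_neg (hlP : 0 < lP) (m : ℕ) (x : ℝ) :
    eigenfunction lP m (-x) = (-1) ^ m * eigenfunction lP m x := by
  induction m generalizing x with
  | zero => simp [eigenfunction]
  | succ m ih =>
    have hl : (lP : ℂ) ≠ 0 := by exact_mod_cast hlP.ne'
    have h0 : ((Real.sqrt 2 * lP * Real.sqrt (m + 1) : ℝ) : ℂ) ≠ 0 := by
      have : Real.sqrt 2 * lP * Real.sqrt (m + 1) ≠ 0 := by positivity
      exact_mod_cast this
    have hd : deriv (eigenfunction lP m) (-x) = -((-1) ^ m * deriv (eigenfunction lP m) x) := by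
      have h1 : (fun y => eigenfunction lP m (-y)) = fun y => (-1) ^ m * eigenfunction lP m y := funext ih
      have h2 := congrArg (fun f => deriv f x) h1
      simp only [deriv_comp_neg, deriv_const_mul_field] at h2
      rw [← h2, neg_neg]
    have h1 := creation lP hlP m (-x)
    have h2 := creation lP hlP m x
    rw [ih, hd] at h1
    refine mul_left_cancel₀ h0 ?_
    rw [Complex.ofReal_neg] at h1
    rw [pow_succ]
    linear_combination -h1 - (-1) ^ m * h2

theorem eigenS_neg (hlP : 0 < lP) (m : ℕ) (x : ℝ) : eigenS lP hlP m (-x) = (-1) ^ m * eigenS lP hlP m x := by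
  rw [eigenS_apply, eigenS_apply, eigenfunction_neg lP hlP]

/-- The pairing of functions of opposite parity vanishes. -/
theorem braket_eq_zero {ψ φ : 𝓢(ℝ, ℂ)} {s : ℂ} (hs : conj s * s = 1) (hψ : ∀ x, ψ (-x) = s * ψ x)
    (hφ : ∀ x, φ (-x) = -(s * φ x)) : braket ψ φ = 0 := by
  have h := integral_neg_eq_self (μ := volume) (fun x => conj (ψ x) * φ x)
  have h1 : ∀ x, conj (ψ (-x)) * φ (-x) = -(conj (ψ x) * φ x) := by
    intro x
    rw [hψ, hφ, map_mul]
    linear_combination (-(conj (ψ x) * φ x)) * hs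
  simp_rw [h1] at h
  rw [integral_neg] at h
  rw [braket]
  linear_combination (-1 / 2 : ℂ) * h

theorem braket_posS_eigenS (hlP : 0 < lP) (m : ℕ) :
    braket (eigenS lP hlP m) (posS (eigenS lP hlP m)) = 0 := by
  refine braket_eq_zero (s := (-1) ^ m) (by simp [← mul_pow]) (eigenS_neg lP hlP m) fun x => ?_
  rw [posS_apply, posS_apply, eigenS_neg]
  push_cast
  ring

theorem braket_derS_eigenS (hlP : 0 < lP) (m : ℕ) :
    braket (eigenS lP hlP m) (derS (eigenS lP hlP m)) = 0 := by
  refine braket_eq_zero (s := (-1) ^ m) (by simp [← mul_pow]) (eigenS_neg lP hlP m) fun x => ?_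
  have h1 : (fun y => eigenS lP hlP m (-y)) = fun y => (-1) ^ m * eigenS lP hlP m y :=
    funext (eigenS_neg lP hlP m)
  have h2 := congrArg (fun f => deriv f x) h1
  simp only [deriv_comp_neg, deriv_const_mul_field] at h2
  rw [derS_apply, derS_apply, ← h2, neg_neg]

theorem braket_eigenS_self (hlP : 0 < lP) (m : ℕ) : braket (eigenS lP hlP m) (eigenS lP hlP m) = 1 := by
  have h := weylElem_eigenS lP hlP m m 0
  have h1 : ∀ x, weyl lP 0 (eigenS lP hlP m) x = eigenS lP hlP m x := fun x => by
    simp [weyl]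
  have h2 : ∀ x, conj (landau lP hlP m x) * (wave lP 0 x * landau lP hlP m (x + halfRot 0)) =
      ((‖landau lP hlP m x‖ ^ 2 : ℝ) : ℂ) := fun x => by
    have h3 : halfRot 0 = 0 := by simp [halfRot]
    have h4 : wave lP 0 x = 1 := by simp [wave]
    rw [h3, h4, add_zero, one_mul, Complex.conj_mul']
    push_cast; rfl
  rw [weylElem] at h
  simp_rw [h1, h2] at h
  rw [integral_complex_ofReal, integral_norm_landau_sq] at h
  rw [braket, h]
  norm_num

/-- The eigenvalue equation of the harmonic oscillator. -/
theorem oscS_eigenS (hlP : 0 < lP) (m : ℕ) :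
    oscS lP (eigenS lP hlP m) = ((lP : ℂ) ^ 2 * (2 * m + 1)) • eigenS lP hlP m := by
  set c : ℂ := ((Real.sqrt 2 * lP * Real.sqrt (m + 1) : ℝ) : ℂ) with hc
  have hc2 : c * c = 2 * (lP : ℂ) ^ 2 * (m + 1) := by
    rw [hc, ← Complex.ofReal_mul]
    have : Real.sqrt 2 * lP * Real.sqrt (m + 1) * (Real.sqrt 2 * lP * Real.sqrt (m + 1)) =
        2 * lP ^ 2 * (m + 1) := by
      rw [← pow_two, mul_pow, mul_pow, Real.sq_sqrt (by norm_num), Real.sq_sqrt (by positivity)]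
    rw [this]; push_cast; ring
  set h := eigenS lP hlP m with hh
  have h1 : posS h - ((lP : ℂ) ^ 2) • derS h = c • eigenS lP hlP (m + 1) := by
    ext x
    simp only [_root_.sub_apply, _root_.smul_apply, smul_eq_mul, posS_apply, derS_apply]
    rw [hh, eigenS_apply, eigenS_apply, coe_eigenS, creation lP hlP]
  have h2 : posS (eigenS lP hlP (m + 1)) + ((lP : ℂ) ^ 2) • derS (eigenS lP hlP (m + 1)) = c • h := by
    ext x
    simp only [_root_.add_apply, _root_.smul_apply, smul_eq_mul, posS_apply, derS_apply]
    rw [hh, eigenS_apply, eigenS_apply, coe_eigenS, annihilation lP hlP]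
  have h3 : derS (posS h) = h + posS (derS h) := by
    ext x
    have h4 : HasDerivAt (posS h) (1 * h x + x * derS h x) x := by
      have h5 : ⇑(posS h) = fun x : ℝ => (x : ℂ) * h x := funext (posS_apply h)
      rw [h5]
      exact ((hasDerivAt_id x).ofReal_comp).mul (hasDerivAt_derS h x)
    rw [derS_apply, h4.deriv, _root_.add_apply, posS_apply, one_mul]
  have h4 := congrArg (c • ·) h2
  simp only [smul_add, ← map_smul, smul_comm c, ← h1, smul_smul c c, hc2] at h4
  simp only [map_sub, map_smul, h3] at h4
  rw [oscS_apply]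
  have h5 : ((lP : ℂ) ^ 2 * (2 * m + 1)) • h = (2 * (lP : ℂ) ^ 2 * (m + 1)) • h - ((lP : ℂ) ^ 2) • h := by
    module
  rw [h5, ← h4]
  module

end Moyal

namespace Moyal

variable (lP : ℝ)

theorem braket_posS_weylS (hlP : 0 < lP) (m : ℕ) (k : ℝ × ℝ) :
    braket (weylS lP k (eigenS lP hlP m)) (posS (weylS lP k (eigenS lP hlP m))) = -k.2 := by
  rw [posS_weylS, braket_weylS, braket_sub, braket_smul, braket_posS_eigenS, braket_eigenS_self]
  ring

theorem braket_derS_weylS (hlP : 0 < lP) (m : ℕ) (k : ℝ × ℝ) :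
    braket (weylS lP k (eigenS lP hlP m)) (derS (weylS lP k (eigenS lP hlP m))) =
      Complex.I * k.1 / (lP : ℂ) ^ 2 := by
  rw [derS_weylS, braket_weylS, braket_add, braket_smul, braket_derS_eigenS, braket_eigenS_self]
  ring

theorem braket_oscS_weylS (hlP : 0 < lP) (m : ℕ) (k : ℝ × ℝ) :
    braket (weylS lP k (eigenS lP hlP m)) (oscS lP (weylS lP k (eigenS lP hlP m))) =
      (lP : ℂ) ^ 2 * (2 * m + 1) + k.1 ^ 2 + k.2 ^ 2 := by
  have hl : (lP : ℂ) ≠ 0 := by exact_mod_cast hlP.ne'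
  have h := congrArg (braket (eigenS lP hlP m)) (oscS_eigenS lP hlP m)
  rw [oscS_apply, braket_sub, braket_smul, braket_smul, braket_eigenS_self] at h
  rw [oscS_apply, braket_sub, braket_smul, posS_weylS, posS_weylS, derS_weylS, derS_weylS, braket_weylS,
    braket_weylS]
  simp only [map_sub, map_add, map_smul, braket_sub, braket_add, braket_smul, braket_posS_eigenS,
    braket_derS_eigenS, braket_eigenS_self]
  have hI : (lP : ℂ) ^ 4 * (Complex.I * k.1 / (lP : ℂ) ^ 2 * (Complex.I * k.1 / (lP : ℂ) ^ 2)) = -k.1 ^ 2 := by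
    field_simp
    rw [Complex.I_sq]; ring
  linear_combination h - hI

/-- The vector of the translated eigenstate. -/
theorem isStateVector_weylS (hlP : 0 < lP) (m : ℕ) (κ : ℂ) :
    IsStateVector lP (translate κ (eigenstate lP m)) (weylS lP (κ.im, -κ.re) (eigenS lP hlP m)) := by
  refine ⟨?_, fun f => ?_⟩
  · have h := braket_weylS lP (κ.im, -κ.re) (eigenS lP hlP m) (eigenS lP hlP m)
    rw [braket_eigenS_self, braket] at h
    simp_rw [Complex.conj_mul', ← Complex.ofReal_pow] at h
    rw [integral_complex_ofReal] at h
    exact_mod_cast h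
  · rw [vectorState_weylS lP hlP.ne', coe_eigenS, eigenstate]

theorem meanLengthSq_weylS (hlP : 0 < lP) (m n : ℕ) (κ κ' : ℂ) :
    meanLengthSq lP (weylS lP (κ.im, -κ.re) (eigenS lP hlP m))
      (weylS lP (κ'.im, -κ'.re) (eigenS lP hlP n)) =
      ((‖κ - κ'‖ ^ 2 + 2 * lP ^ 2 * (m + n + 1) : ℝ) : ℂ) := by
  have hl : (lP : ℂ) ≠ 0 := by exact_mod_cast hlP.ne'
  rw [meanLengthSq_eq, braket_oscS_weylS, braket_oscS_weylS, braket_posS_weylS, braket_posS_weylS,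
    braket_derS_weylS, braket_derS_weylS, braket_weylS, braket_weylS, braket_eigenS_self,
    braket_eigenS_self, Complex.sq_norm, Complex.normSq_apply]
  have hI : 2 * (lP : ℂ) ^ 4 * (Complex.I * κ.im / (lP : ℂ) ^ 2 * (Complex.I * κ'.im / (lP : ℂ) ^ 2)) =
      -2 * κ.im * κ'.im := by
    field_simp
    rw [Complex.I_sq]; ring
  simp only [Complex.sub_re, Complex.sub_im]
  rw [hI]
  push_cast
  ring

/-- `d_{L²}` on generalized coherent states. -/
theorem sqLength_translate (hlP : 0 < lP) (m n : ℕ) (κ κ' : ℂ) :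
    sqLength lP (translate κ (eigenstate lP m)) (translate κ' (eigenstate lP n)) =
      ‖κ - κ'‖ ^ 2 + 2 * lP ^ 2 * (m + n + 1) := by
  have h1 := isStateVector_weylS lP hlP m κ
  have h2 := isStateVector_weylS lP hlP n κ'
  have h : {r : ℝ | ∃ ψ ψ' : 𝓢(ℝ, ℂ), IsStateVector lP (translate κ (eigenstate lP m)) ψ ∧
      IsStateVector lP (translate κ' (eigenstate lP n)) ψ' ∧ (r : ℂ) = meanLengthSq lP ψ ψ'} =
      {‖κ - κ'‖ ^ 2 + 2 * lP ^ 2 * (m + n + 1)} := by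
    ext r
    constructor
    · rintro ⟨ψ, ψ', hψ, hψ', hr⟩
      obtain ⟨c, hc, rfl⟩ := hψ.exists_phase lP hlP h1
      obtain ⟨d, hd, rfl⟩ := hψ'.exists_phase lP hlP h2
      rw [meanLengthSq_smul lP hc hd, meanLengthSq_weylS lP hlP] at hr
      exact_mod_cast hr
    · rintro rfl
      exact ⟨_, _, h1, h2, (meanLengthSq_weylS lP hlP m n κ κ').symm⟩
  rw [sqLength, h, csInf_singleton]

/-- `d'_L` on generalized coherent states. -/
theorem modLength_translate (hlP : 0 < lP) (m n : ℕ) (κ κ' : ℂ) :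
    modLength lP (translate κ (eigenstate lP m)) (translate κ' (eigenstate lP n)) =
      Real.sqrt (‖κ - κ'‖ ^ 2 + (lP * (Real.sqrt (2 * m + 1) - Real.sqrt (2 * n + 1))) ^ 2) := by
  have h1 : Real.sqrt (2 * lP ^ 2 * (m + m + 1) * (2 * lP ^ 2 * (n + n + 1))) =
      2 * lP ^ 2 * (Real.sqrt (2 * m + 1) * Real.sqrt (2 * n + 1)) := by
    rw [Real.sqrt_eq_iff_mul_self_eq (by positivity) (by positivity)]
    have a := Real.mul_self_sqrt (by positivity : (0 : ℝ) ≤ 2 * m + 1)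
    have b := Real.mul_self_sqrt (by positivity : (0 : ℝ) ≤ 2 * n + 1)
    refine Eq.symm ?_
    calc _ = (2 * lP ^ 2) ^ 2 * ((Real.sqrt (2 * m + 1) * Real.sqrt (2 * m + 1)) *
          (Real.sqrt (2 * n + 1) * Real.sqrt (2 * n + 1))) := by ring
      _ = _ := by rw [a, b]; ring
  rw [modLength, sqLength_translate lP hlP, sqLength_translate lP hlP, sqLength_translate lP hlP, sub_self,
    sub_self, norm_zero, zero_pow two_ne_zero, zero_add, zero_add, h1]
  congr 1
  have a := Real.sq_sqrt (by positivity : (0 : ℝ) ≤ 2 * m + 1)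
  have b := Real.sq_sqrt (by positivity : (0 : ℝ) ≤ 2 * n + 1)
  have h2 : ‖κ - κ'‖ ^ 2 + 2 * lP ^ 2 * (m + n + 1) -
      2 * lP ^ 2 * (Real.sqrt (2 * m + 1) * Real.sqrt (2 * n + 1)) =
      ‖κ - κ'‖ ^ 2 + (lP * (Real.sqrt (2 * m + 1) - Real.sqrt (2 * n + 1))) ^ 2 := by
    linear_combination (-lP ^ 2) * a - lP ^ 2 * b
  rw [h2, abs_of_nonneg (by positivity)]

theorem eigenstate_eq_translate (m : ℕ) : eigenstate lP m = translate 0 (eigenstate lP m) := by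
  ext f
  rw [translate_apply]
  congr 1
  ext x
  rw [shift_apply]
  exact congrArg f (by ext <;> simp)

/-! ### Comparison of the distances -/

theorem spectralDist_comm {A E : Type*} [NormedAddCommGroup E] [NormedSpace ℝ E]
    (rep : A → (ℝ × ℝ → E) → (ℝ × ℝ → E)) (D : (ℝ × ℝ → E) → (ℝ × ℝ → E)) (φ₁ φ₂ : A → ℂ) :
    spectralDist rep D φ₁ φ₂ = spectralDist rep D φ₂ φ₁ := by
  unfold spectralDist
  simp_rw [← edist_eq_enorm_sub, edist_comm]

theorem spectralDist_triangle {A E : Type*} [NormedAddCommGroup E] [NormedSpace ℝ E]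
    (rep : A → (ℝ × ℝ → E) → (ℝ × ℝ → E)) (D : (ℝ × ℝ → E) → (ℝ × ℝ → E)) (φ₁ φ₂ φ₃ : A → ℂ) :
    spectralDist rep D φ₁ φ₃ ≤ spectralDist rep D φ₁ φ₂ + spectralDist rep D φ₂ φ₃ := by
  unfold spectralDist
  simp_rw [← edist_eq_enorm_sub]
  refine iSup₂_le fun a ha => (edist_triangle _ (φ₂ a) _).trans (add_le_add ?_ ?_)
  · exact le_iSup₂ (f := fun (a : A) (_ : opNorm (commutator D (rep a)) ≤ 1) => edist (φ₁ a) (φ₂ a)) a ha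
  · exact le_iSup₂ (f := fun (a : A) (_ : opNorm (commutator D (rep a)) ≤ 1) => edist (φ₂ a) (φ₃ a)) a ha

theorem distD_translate (hlP : 0 < lP) (m : ℕ) (κ κ' : ℂ) :
    distD lP (translate κ (eigenstate lP m)) (translate κ' (eigenstate lP m)) = ENNReal.ofReal ‖κ - κ'‖ :=
  (distD_translate_le lP hlP m κ κ').antisymm (norm_sub_le_distD lP hlP m m κ κ')

theorem distD_eigenstate_le_abs (hlP : 0 < lP) (m n : ℕ) (κ : ℂ) :
    distD lP (translate κ (eigenstate lP m)) (translate κ (eigenstate lP n)) ≤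
      ENNReal.ofReal (Real.sqrt 2 * lP * |Real.sqrt n - Real.sqrt m|) := by
  rcases le_total m n with h | h
  · rw [abs_of_nonneg (sub_nonneg.2 (Real.sqrt_le_sqrt (by exact_mod_cast h)))]
    exact distD_eigenstate_le lP hlP m n h κ
  · rw [abs_sub_comm, abs_of_nonneg (sub_nonneg.2 (Real.sqrt_le_sqrt (by exact_mod_cast h))), distD,
      spectralDist_comm]
    exact distD_eigenstate_le lP hlP n m h κ

theorem distD_le (hlP : 0 < lP) (m n : ℕ) (κ κ' : ℂ) :
    distD lP (translate κ (eigenstate lP m)) (translate κ' (eigenstate lP n)) ≤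
      ENNReal.ofReal (‖κ - κ'‖ + Real.sqrt 2 * lP * |Real.sqrt n - Real.sqrt m|) := by
  rw [ENNReal.ofReal_add (norm_nonneg _) (by positivity)]
  refine (spectralDist_triangle _ _ _ (translate κ' (eigenstate lP m)) _).trans (add_le_add ?_ ?_)
  · exact distD_translate_le lP hlP m κ κ'
  · exact distD_eigenstate_le_abs lP hlP m n κ'

theorem distD_ne_top (hlP : 0 < lP) (m n : ℕ) (κ κ' : ℂ) :
    distD lP (translate κ (eigenstate lP m)) (translate κ' (eigenstate lP n)) ≠ ⊤ :=
  ne_top_of_le_ne_top ENNReal.ofReal_ne_top (distD_le lP hlP m n κ κ')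

theorem toReal_distD_le (hlP : 0 < lP) (m n : ℕ) (κ κ' : ℂ) :
    (distD lP (translate κ (eigenstate lP m)) (translate κ' (eigenstate lP n))).toReal ≤
      ‖κ - κ'‖ + Real.sqrt 2 * lP * |Real.sqrt n - Real.sqrt m| :=
  ENNReal.toReal_le_of_le_ofReal (by positivity) (distD_le lP hlP m n κ κ')

theorem norm_sub_le_toReal_distD (hlP : 0 < lP) (m n : ℕ) (κ κ' : ℂ) :
    ‖κ - κ'‖ ≤ (distD lP (translate κ (eigenstate lP m)) (translate κ' (eigenstate lP n))).toReal :=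
  (ENNReal.ofReal_le_iff_le_toReal (distD_ne_top lP hlP m n κ κ')).1 (norm_sub_le_distD lP hlP m n κ κ')

/-- For fixed `m` the distance exceeds, up to a constant, the classical
distance `√(2θn)` between the orbits of the energies `0` and `n θ`. -/
theorem exists_sqrt_sub_le_distD (hlP : 0 < lP) (m : ℕ) (κ κ' : ℂ) : ∃ K : ℝ, ∀ n : ℕ, 0 < n →
    Real.sqrt 2 * lP * Real.sqrt n - K ≤
      (distD lP (translate κ (eigenstate lP m)) (translate κ' (eigenstate lP n))).toReal := by
  set C := ∫ z : ℝ × ℝ, Real.sqrt (1 + (z.1 ^ 2 + z.2 ^ 2)) * husimi lP m z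
  refine ⟨Real.sqrt 2 * lP + C + ‖κ'‖ + ‖κ‖, fun n hn => ?_⟩
  have h1 : (∫ z : ℝ × ℝ, Real.sqrt (1 + (z.1 ^ 2 + z.2 ^ 2)) * husimi lP n z) - C ≤
      ‖κ'‖ + (distD lP (translate κ (eigenstate lP m)) (translate κ' (eigenstate lP n))).toReal + ‖κ‖ := by
    refine (ENNReal.ofReal_le_ofReal_iff (by positivity)).1
      ((integral_radial_sub_le_distD lP hlP n m).trans ?_)
    rw [ENNReal.ofReal_add (by positivity) (by positivity), ENNReal.ofReal_add (by positivity) (by positivity),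
      ENNReal.ofReal_toReal (distD_ne_top lP hlP m n κ κ')]
    refine (spectralDist_triangle _ _ _ (translate κ (eigenstate lP m)) _).trans (add_le_add
      ((spectralDist_triangle _ _ _ (translate κ' (eigenstate lP n)) _).trans (add_le_add ?_ ?_)) ?_)
    · refine (distD_translate_le lP hlP n 0 κ').trans_eq ?_
      rw [zero_sub, norm_neg]
    · rw [spectralDist_comm]; rfl
    · refine (distD_translate_le lP hlP m κ 0).trans_eq ?_
      rw [sub_zero]
  have h2 := le_integral_radial lP hlP hn
  have hn1 : (1 : ℝ) ≤ n := by exact_mod_cast hn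
  have h3 : Real.sqrt 2 * lP * Real.sqrt n * (3 / 2 * ((n + 1) / n) - 1 / 2 * ((n + 1) * (n + 2) / n ^ 2)) =
      Real.sqrt 2 * lP * Real.sqrt n - Real.sqrt 2 * lP * (Real.sqrt n / n ^ 2) := by
    field_simp; ring
  have h4 : Real.sqrt n / n ^ 2 ≤ 1 := by
    rw [div_le_one (by positivity)]
    exact Real.sqrt_le_iff.2 ⟨by positivity, by
      have : (1 : ℝ) ≤ (n : ℝ) ^ 3 := one_le_pow₀ hn1
      nlinarith⟩
  have h5 : Real.sqrt 2 * lP * (Real.sqrt n / n ^ 2) ≤ Real.sqrt 2 * lP :=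
    mul_le_of_le_one_right (by positivity) h4
  rw [h3] at h2
  linarith

/-- `d'_L` is the hypotenuse of a right triangle whose legs are the length of the translation and
`λ_P |√(2m+1) - √(2n+1)|`. -/
theorem modLength_translate_bounds (hlP : 0 < lP) (m n : ℕ) (κ κ' : ℂ) :
    ‖κ - κ'‖ ≤ modLength lP (translate κ (eigenstate lP m)) (translate κ' (eigenstate lP n)) ∧
    lP * |Real.sqrt (2 * m + 1) - Real.sqrt (2 * n + 1)| ≤
      modLength lP (translate κ (eigenstate lP m)) (translate κ' (eigenstate lP n)) ∧
    modLength lP (translate κ (eigenstate lP m)) (translate κ' (eigenstate lP n)) ≤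
      ‖κ - κ'‖ + lP * |Real.sqrt (2 * m + 1) - Real.sqrt (2 * n + 1)| := by
  rw [modLength_translate lP hlP]
  have h : (lP * (Real.sqrt (2 * m + 1) - Real.sqrt (2 * n + 1))) ^ 2 =
      (lP * |Real.sqrt (2 * m + 1) - Real.sqrt (2 * n + 1)|) ^ 2 := by rw [mul_pow, mul_pow, sq_abs]
  rw [h]
  set t := lP * |Real.sqrt (2 * m + 1) - Real.sqrt (2 * n + 1)|
  have ht : 0 ≤ t := by positivity
  refine ⟨Real.le_sqrt_of_sq_le (by nlinarith), Real.le_sqrt_of_sq_le (by nlinarith [norm_nonneg (κ - κ')]),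
    Real.sqrt_le_iff.2 ⟨by positivity, by nlinarith [norm_nonneg (κ - κ'), mul_nonneg (norm_nonneg (κ - κ')) ht]⟩⟩

/-- Quantities at bounded distance, tending to infinity, have relative difference tending to zero. -/
theorem tendsto_sub_div_of_bounded {α : Type*} {l : Filter α} {d L : α → ℝ} {K : ℝ}
    (h : ∀ᶠ x in l, |d x - L x| ≤ K) (hL : Tendsto L l atTop) :
    Tendsto (fun x => (d x - L x) / L x) l (𝓝 0) := by
  refine squeeze_zero_norm' (a := fun x => K / L x) ?_ (hL.const_div_atTop K)
  filter_upwards [h, hL.eventually_gt_atTop 0] with x hx hL0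
  rw [norm_div, Real.norm_eq_abs, Real.norm_of_nonneg hL0.le]
  gcongr

/-- Both lengths differ from `‖κ - κ'‖` by a bounded amount. -/
theorem tendsto_distD_cocompact (hlP : 0 < lP) (m n : ℕ) (κ' : ℂ) :
    Tendsto (fun κ : ℂ =>
      ((distD lP (translate κ (eigenstate lP m)) (translate κ' (eigenstate lP n))).toReal -
          modLength lP (translate κ (eigenstate lP m)) (translate κ' (eigenstate lP n))) /
        modLength lP (translate κ (eigenstate lP m)) (translate κ' (eigenstate lP n)))
      (cocompact ℂ) (𝓝 0) := by
  refine tendsto_sub_div_of_bounded (K := Real.sqrt 2 * lP * |Real.sqrt n - Real.sqrt m| +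
    lP * |Real.sqrt (2 * m + 1) - Real.sqrt (2 * n + 1)|) (Eventually.of_forall fun κ => ?_) ?_
  · have h1 := toReal_distD_le lP hlP m n κ κ'
    have h2 := norm_sub_le_toReal_distD lP hlP m n κ κ'
    obtain ⟨h3, -, h4⟩ := modLength_translate_bounds lP hlP m n κ κ'
    have h5 : 0 ≤ Real.sqrt 2 * lP * |Real.sqrt n - Real.sqrt m| := by positivity
    have h6 : 0 ≤ lP * |Real.sqrt (2 * m + 1) - Real.sqrt (2 * n + 1)| := by positivity
    exact abs_le.2 ⟨by linarith, by linarith⟩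
  · refine tendsto_atTop_mono (fun κ => ?_)
      (tendsto_atTop_add_const_right _ (-‖κ'‖) (tendsto_norm_cocompact_atTop (E := ℂ)))
    obtain ⟨h3, -, -⟩ := modLength_translate_bounds lP hlP m n κ κ'
    linarith [norm_sub_norm_le κ κ']

theorem tendsto_distD_atTop (hlP : 0 < lP) (m : ℕ) (κ κ' : ℂ) :
    Tendsto (fun n : ℕ =>
      ((distD lP (translate κ (eigenstate lP m)) (translate κ' (eigenstate lP n))).toReal -
          modLength lP (translate κ (eigenstate lP m)) (translate κ' (eigenstate lP n))) /
        modLength lP (translate κ (eigenstate lP m)) (translate κ' (eigenstate lP n)))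
      atTop (𝓝 0) := by
  obtain ⟨K, hK⟩ := exists_sqrt_sub_le_distD lP hlP m κ κ'
  -- Both lengths differ from `√2 lP √n` by a bounded amount.
  have hs : ∀ n : ℕ, Real.sqrt 2 * Real.sqrt n ≤ Real.sqrt (2 * n + 1) ∧
      Real.sqrt (2 * n + 1) ≤ Real.sqrt 2 * Real.sqrt n + 1 := by
    intro n
    rw [← Real.sqrt_mul (by norm_num)]
    refine ⟨Real.sqrt_le_sqrt (by linarith), Real.sqrt_le_iff.2 ⟨by positivity, ?_⟩⟩
    nlinarith [Real.sq_sqrt (by positivity : (0 : ℝ) ≤ 2 * n), Real.sqrt_nonneg (2 * (n : ℝ))]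
  have hL1 : ∀ n : ℕ, Real.sqrt 2 * lP * Real.sqrt n - lP * Real.sqrt (2 * m + 1) ≤
      modLength lP (translate κ (eigenstate lP m)) (translate κ' (eigenstate lP n)) := by
    intro n
    refine le_trans ?_ (modLength_translate_bounds lP hlP m n κ κ').2.1
    have := mul_le_mul_of_nonneg_left ((sub_le_sub_right (hs n).1 (Real.sqrt (2 * m + 1))).trans
      ((le_abs_self _).trans_eq (abs_sub_comm _ _))) hlP.le
    linarith
  have hL2 : ∀ n : ℕ, modLength lP (translate κ (eigenstate lP m)) (translate κ' (eigenstate lP n)) ≤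
      ‖κ - κ'‖ + (Real.sqrt 2 * lP * Real.sqrt n + lP + lP * Real.sqrt (2 * m + 1)) := by
    intro n
    refine (modLength_translate_bounds lP hlP m n κ κ').2.2.trans ?_
    have h1 : |Real.sqrt (2 * m + 1) - Real.sqrt (2 * n + 1)| ≤
        Real.sqrt 2 * Real.sqrt n + 1 + Real.sqrt (2 * m + 1) :=
      abs_le.2 ⟨by linarith [(hs n).2, Real.sqrt_nonneg (2 * (m : ℝ) + 1)],
        by linarith [Real.sqrt_nonneg (2 * (n : ℝ) + 1),
          mul_nonneg (Real.sqrt_nonneg 2) (Real.sqrt_nonneg (n : ℝ))]⟩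
    have := mul_le_mul_of_nonneg_left h1 hlP.le
    linarith
  refine tendsto_sub_div_of_bounded (K := |K| + ‖κ - κ'‖ + lP + lP * Real.sqrt (2 * m + 1) +
    Real.sqrt 2 * lP * Real.sqrt m) ?_ ?_
  · filter_upwards [eventually_gt_atTop 0] with n hn
    have h1 := toReal_distD_le lP hlP m n κ κ'
    have h2 := hK n hn
    have h3 : Real.sqrt 2 * lP * |Real.sqrt n - Real.sqrt m| ≤
        Real.sqrt 2 * lP * (Real.sqrt n + Real.sqrt m) := by
      gcongr
      exact abs_le.2 ⟨by linarith [Real.sqrt_nonneg (n : ℝ)], by linarith [Real.sqrt_nonneg (m : ℝ)]⟩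
    have h4 : 0 ≤ lP * Real.sqrt (2 * m + 1) := by positivity
    have h5 : 0 ≤ Real.sqrt 2 * lP * Real.sqrt m := by positivity
    exact abs_le.2 ⟨by linarith [hL2 n, le_abs_self K], by
      linarith [hL1 n, abs_nonneg K]⟩
  · refine tendsto_atTop_mono hL1 (tendsto_atTop_add_const_right _ _ ?_)
    exact (Real.tendsto_sqrt_atTop.comp tendsto_natCast_atTop_atTop).const_mul_atTop (by positivity)

end Moyal

theorem mainTheorem1 (lP : ℝ) (hlP : 0 < lP) :
    -- two-sheet model
    (∀ (m : ℕ) (Λ : ℂ),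
      (‖Λ‖ ^ 2)⁻¹ = Moyal.sqLength lP (Moyal.eigenstate lP m) (Moyal.eigenstate lP m) →
      ∀ ω ∈ Moyal.coherent lP m, ∀ ω' ∈ Moyal.coherent lP m,
        Moyal.distD' lP Λ (Moyal.onSheet ω 0) (Moyal.onSheet ω' 1) ≠ ⊤ ∧
        Moyal.sqLength lP ω ω' =
          (Moyal.distD' lP Λ (Moyal.onSheet ω 0) (Moyal.onSheet ω' 1)).toReal ^ 2) ∧
    -- single sheet
    (∀ m : ℕ, ∀ ω ∈ Moyal.coherent lP m, ∀ ω' ∈ Moyal.coherent lP m,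
        Moyal.distD lP ω ω' ≠ ⊤ ∧
        (Moyal.distD lP ω ω').toReal = Moyal.modLength lP ω ω') ∧
    -- the spectral distance is finite on the set of all generalized coherent states
    (∀ ω ∈ Moyal.allCoherent lP, ∀ ω' ∈ Moyal.allCoherent lP, Moyal.distD lP ω ω' ≠ ⊤) ∧
    -- large translations
    (∀ (m n : ℕ) (κ' : ℂ),
      Tendsto (fun κ : ℂ =>
        ((Moyal.distD lP (Moyal.translate κ (Moyal.eigenstate lP m))
            (Moyal.translate κ' (Moyal.eigenstate lP n))).toReal -
          Moyal.modLength lP (Moyal.translate κ (Moyal.eigenstate lP m))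
            (Moyal.translate κ' (Moyal.eigenstate lP n))) /
          Moyal.modLength lP (Moyal.translate κ (Moyal.eigenstate lP m))
            (Moyal.translate κ' (Moyal.eigenstate lP n)))
        (cocompact ℂ) (𝓝 0)) ∧
    -- large differences of energy
    (∀ (m : ℕ) (κ κ' : ℂ),
      Tendsto (fun n : ℕ =>
        ((Moyal.distD lP (Moyal.translate κ (Moyal.eigenstate lP m))
            (Moyal.translate κ' (Moyal.eigenstate lP n))).toReal -
          Moyal.modLength lP (Moyal.translate κ (Moyal.eigenstate lP m))
            (Moyal.translate κ' (Moyal.eigenstate lP n))) /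
          Moyal.modLength lP (Moyal.translate κ (Moyal.eigenstate lP m))
            (Moyal.translate κ' (Moyal.eigenstate lP n)))
        atTop (𝓝 0)) := by
  refine ⟨fun m Λ hΛ => ?_, fun m => ?_, ?_, Moyal.tendsto_distD_cocompact lP hlP,
    Moyal.tendsto_distD_atTop lP hlP⟩
  · rintro _ ⟨κ, rfl⟩ _ ⟨κ', rfl⟩
    rw [Moyal.eigenstate_eq_translate, Moyal.sqLength_translate lP hlP, sub_self, norm_zero,
      zero_pow two_ne_zero, zero_add] at hΛ
    have hΛ0 : Λ ≠ 0 := by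
      rintro rfl
      rw [norm_zero, zero_pow two_ne_zero, inv_zero] at hΛ
      have : 0 < 2 * lP ^ 2 * ((m : ℝ) + m + 1) := by positivity
      linarith
    have h := (Moyal.distD'_le lP hlP hΛ0 m κ κ').antisymm (Moyal.sqrt_le_distD' lP hlP hΛ0 m m κ κ')
    rw [h, Moyal.sqLength_translate lP hlP, hΛ, ENNReal.toReal_ofReal (Real.sqrt_nonneg _),
      Real.sq_sqrt (by positivity)]
    exact ⟨ENNReal.ofReal_ne_top, rfl⟩
  · rintro _ ⟨κ, rfl⟩ _ ⟨κ', rfl⟩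
    rw [Moyal.distD_translate lP hlP, Moyal.modLength_translate lP hlP, sub_self, mul_zero,
      zero_pow two_ne_zero, add_zero, Real.sqrt_sq (norm_nonneg _),
      ENNReal.toReal_ofReal (norm_nonneg _)]
    exact ⟨ENNReal.ofReal_ne_top, rfl⟩
  · intro ω hω ω' hω'
    obtain ⟨m, κ, rfl⟩ := Set.mem_iUnion.1 hω
    obtain ⟨n, κ', rfl⟩ := Set.mem_iUnion.1 hω'
    exact Moyal.distD_ne_top lP hlP m n κ κ'
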